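/- All modules are right modules. Let $r,s\in\mathbb{C}^*$ be primitive $m$-th and $n$-th roots of unity ($m,n\ge 1$) with $r^2\neq s^2$; $\operatorname{ord}$ denotes multiplicative order. Let $U$ be the $\mathbb{C}$-algebra $U^+_{r,s}(B_2)$ with generators $e_1,e_2$ and relations $$e_1^2e_2-(r^2+s^2)e_1e_2e_1+r^2s^2e_2e_1^2=0,$$ $$e_1e_2^3-(r^2+rs+s^2)e_2e_1e_2^2+rs(r^2+rs+s^2)e_2^2e_1e_2-r^3s^3e_2^3e_1=0.$$ Put $X_1=e_1$, $X_4=e_2$, $X_2=e_1e_2-r^2e_2e_1$, $X_3=e_2X_2-s^{-2}X_2e_2$, $\tilde W=X_2+(r^2-s^2)X_4X_1$, let $B\subseteq U$ be the subalgebra generated by $X_1,X_2,X_3,\tilde W$, and let $\tilde X=\tilde WX_2-\frac{s^2(r^2-s^2)}{1-rs^{-1}}X_3X_1\in B$. For $x\in B$, a $B$-module $N$ is $x$-torsionfree if $vx^k=0$ (with $v\in N$, $k\ge 0$) implies $v=0$, and $x$-torsion if every $v\in N$ satisfies $vx^k=0$ for some $k\ge0$. Define the following $B$-modules; in each of them the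 index $a$ is read modulo its range. $\mathcal M_1(\lambda)$, for $\lambda=(\lambda_1,\lambda_2,\lambda_3,\lambda_4)\in(\mathbb C^*)^3\times\mathbb C$ with $\lambda_4\ne\frac{s^2(r^2-s^2)}{1-rs^{-1}}\lambda_3$: basis $e(a,b)$, $0\le a<\ell_1$, $0\le b<m_1$, where $m_1=\operatorname{ord}(rs^{-1})$, and $\ell_1=\operatorname{ord}(r^2s^2)$ if $\operatorname{ord}(s^2)\mid\operatorname{ord}(r^2s^2)\operatorname{ord}(rs^{-1})$, $\ell_1=2\operatorname{ord}(r^2s^2)$ otherwise; action $$e(a,b)X_1=s^{-2b}\lambda_1e(a+1,b),\qquad e(a,b)X_3=(rs)^{2a+b}\lambda_1^{-1}\lambda_3e(a-1,b),$$ $$e(a,b)X_2=\lambda_2e(a,b+1)\ (b\ne m_1-1),\qquad e(a,m_1-1)X_2=s^{2am_1}\lambda_2e(a,0),$$ $$e(a,b)\tilde W=\lambda_2^{-1}(rs)^{2a}\Bigl(\lambda_4-s^2(r^2-s^2)\tfrac{1-(rs^{-1})^b}{1-rs^{-1}}\lambda_3\Bigr)e(a,b-1)\ (b\neq0),$$ $$e(a,0)\tilde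 W=\lambda_2^{-1}\lambda_4r^{2a}s^{-2a(m_1-1)}e(a,m_1-1).$$ $\mathcal M_2(\mu)$, for $\mu=(\mu_1,\mu_2,\mu_3)\in(\mathbb C^*)^2\times\mathbb C$: basis $e(a,b)$, $0\le a<\ell_2$, $0\le b<m_2$, where $\ell_2=\operatorname{ord}(r^2s^2)$, and $m_2=\operatorname{ord}(rs^{-1})$ if $\operatorname{ord}(r^2)\mid\operatorname{ord}(r^2s^2)\operatorname{ord}(rs^{-1})$ or $\mu_3=0$, $m_2=2\operatorname{ord}(rs^{-1})$ otherwise; action $$e(a,b)X_1=r^{-2b}\mu_1e(a+1,b),\qquad e(a,b)X_3=(rs)^{2a+b}\mu_1^{-1}\mu_2e(a-1,b),$$ $$e(a,b)X_2=(rs)^{2a}s^2(r^2-s^2)\tfrac{1-(r^{-1}s)^b}{1-r^{-1}s}\mu_2e(a,b-1)\ (b\ne0),\qquad e(a,0)X_2=0,$$ $$e(a,b)\tilde W=e(a,b+1)\ (b\neq m_2-1),\qquad e(a,m_2-1)\tilde W=r^{2am_2}\mu_3e(a,0).$$ $\mathcal M_3(\epsilon)$, for $\epsilon=(\epsilon_1,\epsilon_2,\epsilon_3)\in(\mathbb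 C^*)^3$: basis $e(a)$, $0\le a<\ell$, where $\ell=\operatorname{lcm}(\operatorname{ord}(rs),\operatorname{ord}(rs^{-1}))$; action $$e(a)X_1=\epsilon_1^2\epsilon_3\epsilon_2^{-1}\tfrac{1-rs^{-1}}{s^2(r^2-s^2)}s^{-2a}e(a+2),\quad e(a)X_2=\epsilon_1e(a+1),$$ $$e(a)X_3=(rs)^a\epsilon_2e(a),\quad e(a)\tilde W=\epsilon_1\epsilon_3(rs^{-1})^ae(a+1).$$ **Theorem.** Let $N$ be a simple $X_1$-torsionfree and $X_3$-torsionfree $B$-module. Then $N$ is isomorphic to one of the modules $\mathcal M_1(\lambda)$, $\mathcal M_2(\mu)$, $\mathcal M_3(\epsilon)$. More precisely: 1. if $N$ is $\tilde X$-torsionfree and $X_2$-torsionfree, then $N\cong\mathcal M_1(\lambda)$ for some $\lambda\in(\mathbb C^*)^3\times\mathbb C$ with $\lambda_4\ne\frac{s^2(r^2-s^2)}{1-rs^{-1}}\lambda_3$; 2. if $N$ is $\tilde X$-torsionfree and $X_2$-torsion, then $N\cong\mathcal M_2(\mu)$ for some $\mu\in(\mathbb C^*)^2\times\mathbb C$;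 3. if $N$ is $\tilde X$-torsion, then $N\cong\mathcal M_3(\epsilon)$ for some $\epsilon\in(\mathbb C^*)^3$. -/

import Mathlib

noncomputable section

namespace B2

open MulOpposite

/-- The standing assumptions on the parameters: `r` and `s` are primitive `m`-th and `n`-th roots
of unity and `r ^ 2 ≠ s ^ 2`. -/
structure Standing (r s : ℂ) (m n : ℕ) : Prop where
  m_pos : 0 < m
  n_pos : 0 < n
  prim_r : IsPrimitiveRoot r m
  prim_s : IsPrimitiveRoot s n
  sq_ne : r ^ 2 ≠ s ^ 2

/-! ### The algebra `U = U⁺_{r,s}(B₂)` and its subalgebra `B` -/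

/-- The first generator of the free algebra on two letters. -/
def f₁ : FreeAlgebra ℂ (Fin 2) := FreeAlgebra.ι ℂ 0

/-- The second generator of the free algebra on two letters. -/
def f₂ : FreeAlgebra ℂ (Fin 2) := FreeAlgebra.ι ℂ 1

/-- The two defining relations of `U⁺_{r,s}(B₂)`. -/
inductive SerreRel (r s : ℂ) : FreeAlgebra ℂ (Fin 2) → FreeAlgebra ℂ (Fin 2) → Prop
  | rel₁ : SerreRel r s
      (f₁ ^ 2 * f₂ - (r ^ 2 + s ^ 2) • (f₁ * f₂ * f₁) + (r ^ 2 * s ^ 2) • (f₂ * f₁ ^ 2)) 0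
  | rel₂ : SerreRel r s
      (f₁ * f₂ ^ 3 - (r ^ 2 + r * s + s ^ 2) • (f₂ * f₁ * f₂ ^ 2)
        + (r * s * (r ^ 2 + r * s + s ^ 2)) • (f₂ ^ 2 * f₁ * f₂)
        - (r ^ 3 * s ^ 3) • (f₂ ^ 3 * f₁)) 0

/-- The algebra `U⁺_{r,s}(B₂)`. -/
abbrev U (r s : ℂ) : Type := RingQuot (SerreRel r s)

namespace U

variable (r s : ℂ)

/-- `X₁ = e₁`. -/
def X₁ : U r s := RingQuot.mkAlgHom ℂ (SerreRel r s) f₁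

/-- `X₄ = e₂`. -/
def X₄ : U r s := RingQuot.mkAlgHom ℂ (SerreRel r s) f₂

/-- `X₂ = e₁ e₂ - r² e₂ e₁`. -/
def X₂ : U r s := X₁ r s * X₄ r s - r ^ 2 • (X₄ r s * X₁ r s)

/-- `X₃ = e₂ X₂ - s⁻² X₂ e₂`. -/
def X₃ : U r s := X₄ r s * X₂ r s - (s ^ 2)⁻¹ • (X₂ r s * X₄ r s)

/-- `W̃ = X₂ + (r² - s²) X₄ X₁`. -/
def W : U r s := X₂ r s + (r ^ 2 - s ^ 2) • (X₄ r s * X₁ r s)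

end U

/-- The subalgebra `B` of `U⁺_{r,s}(B₂)` generated by `X₁, X₂, X₃, W̃`. -/
def B (r s : ℂ) : Subalgebra ℂ (U r s) :=
  Algebra.adjoin ℂ {U.X₁ r s, U.X₂ r s, U.X₃ r s, U.W r s}

namespace B

variable (r s : ℂ)

/-- `X₁` as an element of `B`. -/
def X₁ : B r s := ⟨U.X₁ r s, Algebra.subset_adjoin (by simp)⟩

/-- `X₂` as an element of `B`. -/
def X₂ : B r s := ⟨U.X₂ r s, Algebra.subset_adjoin (by simp)⟩

/-- `X₃` as an element of `B`. -/
def X₃ : B r s := ⟨U.X₃ r s, Algebra.subset_adjoin (by simp)⟩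

/-- `W̃` as an element of `B`. -/
def W : B r s := ⟨U.W r s, Algebra.subset_adjoin (by simp)⟩

/-- The normal element `X̃ = W̃ X₂ - (s² (r² - s²) / (1 - r s⁻¹)) X₃ X₁` of `B`. -/
def Xt : B r s :=
  W r s * X₂ r s - (s ^ 2 * (r ^ 2 - s ^ 2) / (1 - r * s⁻¹)) • (X₃ r s * X₁ r s)

end B

/-! ### Torsion of right modules

A right `A`-module is a module over the opposite ring, with `v x = op x • v`. -/

section Torsion

variable {A : Type*} [Ring A] (x : A) (N : Type*) [AddCommGroup N] [Module Aᵐᵒᵖ N]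

/-- `tors_x(N)`: the set of all `v` with `v x ^ k = 0` for some `k ≥ 0`. -/
def torsionPart : Set N := {v | ∃ k : ℕ, op (x ^ k) • v = 0}

/-- `N` is `x`-torsion. -/
def IsTorsionAt : Prop := torsionPart x N = Set.univ

/-- `N` is `x`-torsionfree. -/
def IsTorsionFreeAt : Prop := torsionPart x N = {0}

end Torsion

/-! ### Right `B`-modules from four operators

On a space where `X₁` acts invertibly, the action of `B` is given by four operators satisfying the
commutation relations of `X₁, X₂, X₃, W̃`: the action extends to `U⁺_{r,s}(B₂)`, where `X₄` acts as
`(r² - s²)⁻¹ (W̃ - X₂) X₁⁻¹`. -/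

/-- Operators `x₁, x₂, x₃, w` (acting on the right: `v X₁ X₂` is `x₂ (x₁ v)`) subject to the
commutation relations of the generators of `B`, with `x₁` invertible. -/
structure Ops (r s : ℂ) (V : Type*) [AddCommGroup V] [Module ℂ V] where
  x₁ : V →ₗ[ℂ] V
  x₁' : V →ₗ[ℂ] V
  x₂ : V →ₗ[ℂ] V
  x₃ : V →ₗ[ℂ] V
  w : V →ₗ[ℂ] V
  inv₁ : x₁' * x₁ = 1
  inv₂ : x₁ * x₁' = 1
  rel₁₂ : x₂ * x₁ = s ^ 2 • (x₁ * x₂)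
  rel₁₃ : x₃ * x₁ = (r ^ 2 * s ^ 2) • (x₁ * x₃)
  rel₂₃ : x₃ * x₂ = (r * s) • (x₂ * x₃)
  rel₁w : w * x₁ = r ^ 2 • (x₁ * w)
  rel_w₃ : x₃ * w = (r * s) • (w * x₃)
  rel_w₂ : x₂ * w = w * x₂ + (s ^ 2 * (r ^ 2 - s ^ 2)) • (x₁ * x₃)

namespace Ops

variable {r s : ℂ} {V : Type*} [AddCommGroup V] [Module ℂ V] (T : Ops r s V)

/-- The operator by which `X₄` acts: `v X₄ = (r² - s²)⁻¹ (v W̃ - v X₂) X₁⁻¹`. -/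
def y : V →ₗ[ℂ] V := (r ^ 2 - s ^ 2)⁻¹ • (T.x₁' * (T.w - T.x₂))

theorem inv_rel₂ (hs : s ≠ 0) : T.x₂ * T.x₁' = (s ^ 2)⁻¹ • (T.x₁' * T.x₂) := by
  have h := congrArg (fun z => (s ^ 2)⁻¹ • (T.x₁' * z * T.x₁')) T.rel₁₂
  have e1 : T.x₁' * (T.x₂ * T.x₁) * T.x₁' = T.x₁' * T.x₂ := by
    rw [mul_assoc, mul_assoc, T.inv₂, mul_one]
  have e2 : T.x₁' * (T.x₁ * T.x₂) * T.x₁' = T.x₂ * T.x₁' := by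
    rw [← mul_assoc, T.inv₁, one_mul]
  simp only [mul_smul_comm, smul_mul_assoc, e1, e2] at h
  rw [h, smul_smul, inv_mul_cancel₀ (pow_ne_zero 2 hs), one_smul]

theorem inv_rel₃ (hr : r ≠ 0) (hs : s ≠ 0) :
    T.x₃ * T.x₁' = (r ^ 2 * s ^ 2)⁻¹ • (T.x₁' * T.x₃) := by
  have h := congrArg (fun z => (r ^ 2 * s ^ 2)⁻¹ • (T.x₁' * z * T.x₁')) T.rel₁₃
  have e1 : T.x₁' * (T.x₃ * T.x₁) * T.x₁' = T.x₁' * T.x₃ := by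
    rw [mul_assoc, mul_assoc, T.inv₂, mul_one]
  have e2 : T.x₁' * (T.x₁ * T.x₃) * T.x₁' = T.x₃ * T.x₁' := by
    rw [← mul_assoc, T.inv₁, one_mul]
  simp only [mul_smul_comm, smul_mul_assoc, e1, e2] at h
  rw [h, smul_smul, inv_mul_cancel₀ (by positivity), one_smul]

theorem y_x₂ (h : r ^ 2 ≠ s ^ 2) : T.y * T.x₁ - r ^ 2 • (T.x₁ * T.y) = T.x₂ := by
  have hd : r ^ 2 - s ^ 2 ≠ 0 := sub_ne_zero.2 h
  have e : T.x₁ * T.y = (r ^ 2 - s ^ 2)⁻¹ • (T.w - T.x₂) := by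
    rw [y, mul_smul_comm, ← mul_assoc, T.inv₂, one_mul]
  have e' : T.y * T.x₁ = (r ^ 2 - s ^ 2)⁻¹ • (r ^ 2 • T.w - s ^ 2 • T.x₂) := by
    rw [y, smul_mul_assoc, mul_assoc, sub_mul, T.rel₁w, T.rel₁₂, mul_sub, mul_smul_comm,
      mul_smul_comm, ← mul_assoc, ← mul_assoc, T.inv₁, one_mul, one_mul]
  rw [e, e']
  match_scalars <;> field_simp <;> ring

theorem y_w (h : r ^ 2 ≠ s ^ 2) : T.x₂ + (r ^ 2 - s ^ 2) • (T.x₁ * T.y) = T.w := by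
  have hd : r ^ 2 - s ^ 2 ≠ 0 := sub_ne_zero.2 h
  rw [y, mul_smul_comm, ← mul_assoc, T.inv₂, one_mul, smul_smul, mul_inv_cancel₀ hd, one_smul]
  abel

theorem y_x₃ (hs : s ≠ 0) (h : r ^ 2 ≠ s ^ 2) :
    T.x₂ * T.y - (s ^ 2)⁻¹ • (T.y * T.x₂) = T.x₃ := by
  have hd : r ^ 2 - s ^ 2 ≠ 0 := sub_ne_zero.2 h
  have e1 : T.x₂ * T.y =
      (r ^ 2 - s ^ 2)⁻¹ • (s ^ 2)⁻¹ • (T.x₁' * (T.x₂ * T.w - T.x₂ * T.x₂)) := by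
    rw [y, mul_smul_comm, ← mul_assoc, T.inv_rel₂ hs, smul_mul_assoc, mul_assoc, mul_sub]
  have e2 : T.y * T.x₂ = (r ^ 2 - s ^ 2)⁻¹ • (T.x₁' * (T.w * T.x₂ - T.x₂ * T.x₂)) := by
    rw [y, smul_mul_assoc, mul_assoc, sub_mul]
  have e3 : T.x₁' * (T.x₁ * T.x₃) = T.x₃ := by rw [← mul_assoc, T.inv₁, one_mul]
  rw [e1, e2, T.rel_w₂]
  simp only [mul_sub, mul_add, mul_smul_comm, e3]
  match_scalars
  · ring
  · field_simp
  · ring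

theorem y_rel₃ (hr : r ≠ 0) (hs : s ≠ 0) : T.y * T.x₃ = (r * s) • (T.x₃ * T.y) := by
  rw [y, mul_smul_comm, ← mul_assoc, T.inv_rel₃ hr hs, smul_mul_assoc, smul_mul_assoc, mul_assoc,
    mul_assoc, mul_sub T.x₃, T.rel_w₃, T.rel₂₃, sub_mul, mul_sub, mul_sub, mul_smul_comm,
    mul_smul_comm]
  match_scalars <;> field_simp

/-- The images of the generators `e₁, e₂` of `U⁺_{r,s}(B₂)`. -/
def gens : Fin 2 → (Module.End ℂ V)ᵐᵒᵖ := ![op T.x₁, op T.y]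

theorem serre (hr : r ≠ 0) (hs : s ≠ 0) (h : r ^ 2 ≠ s ^ 2) ⦃a b : FreeAlgebra ℂ (Fin 2)⦄
    (hab : SerreRel r s a b) :
    FreeAlgebra.lift ℂ T.gens a = FreeAlgebra.lift ℂ T.gens b := by
  have h1 := T.rel₁₂
  have h2 := T.y_rel₃ hr hs
  rw [← T.y_x₃ hs h] at h2
  rw [← T.y_x₂ h] at h1 h2
  simp only [mul_sub, sub_mul, mul_smul_comm, smul_mul_assoc, mul_assoc, smul_sub] at h1 h2
  induction hab with
  | rel₁ =>
    apply unop_injective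
    simp only [f₁, f₂, map_add, map_sub, map_smul, map_mul, FreeAlgebra.lift_ι_apply, gens,
      Matrix.cons_val_zero, Matrix.cons_val_one, unop_add, unop_sub, unop_smul, unop_mul,
      unop_op, map_zero, unop_zero, pow_succ, pow_zero, one_mul, mul_assoc]
    rw [← sub_eq_zero] at h1
    rw [← h1]
    match_scalars <;> ring
  | rel₂ =>
    apply unop_injective
    simp only [f₁, f₂, map_add, map_sub, map_smul, map_mul, FreeAlgebra.lift_ι_apply, gens,
      Matrix.cons_val_zero, Matrix.cons_val_one, unop_add, unop_sub, unop_smul, unop_mul,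
      unop_op, map_zero, unop_zero, pow_succ, pow_zero, one_mul, mul_assoc]
    rw [← sub_eq_zero] at h2
    have h3 := congrArg (fun z => (-s ^ 2) • z) h2
    simp only [smul_zero] at h3
    rw [← h3]
    match_scalars <;> field_simp <;> ring

/-- The representation of `U⁺_{r,s}(B₂)` by right operators. -/
def rep (hr : r ≠ 0) (hs : s ≠ 0) (h : r ^ 2 ≠ s ^ 2) : U r s →ₐ[ℂ] (Module.End ℂ V)ᵐᵒᵖ :=
  RingQuot.liftAlgHom ℂ ⟨FreeAlgebra.lift ℂ T.gens, T.serre hr hs h⟩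

/-- The right action of the subalgebra `B`. -/
def repB (hr : r ≠ 0) (hs : s ≠ 0) (h : r ^ 2 ≠ s ^ 2) : (B r s)ᵐᵒᵖ →ₐ[ℂ] Module.End ℂ V :=
  AlgHom.opComm ((T.rep hr hs h).comp (B r s).val)

section

variable (hr : r ≠ 0) (hs : s ≠ 0) (h : r ^ 2 ≠ s ^ 2)

theorem rep_X₁ : T.rep hr hs h (U.X₁ r s) = op T.x₁ := by
  simp [rep, U.X₁, f₁, gens]

theorem rep_X₄ : T.rep hr hs h (U.X₄ r s) = op T.y := by
  simp [rep, U.X₄, f₂, gens]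

theorem rep_X₂ : T.rep hr hs h (U.X₂ r s) = op T.x₂ := by
  rw [U.X₂, map_sub, map_smul, map_mul, map_mul, rep_X₁, rep_X₄, ← T.y_x₂ h]
  rfl

theorem rep_X₃ : T.rep hr hs h (U.X₃ r s) = op T.x₃ := by
  rw [U.X₃, map_sub, map_smul, map_mul, map_mul, rep_X₂, rep_X₄, ← T.y_x₃ hs h]
  rfl

theorem rep_W : T.rep hr hs h (U.W r s) = op T.w := by
  rw [U.W, map_add, map_smul, map_mul, rep_X₂, rep_X₄, rep_X₁, ← T.y_w h]
  rfl

theorem repB_X₁ : T.repB hr hs h (op (B.X₁ r s)) = T.x₁ :=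
  congrArg unop (T.rep_X₁ hr hs h)

theorem repB_X₂ : T.repB hr hs h (op (B.X₂ r s)) = T.x₂ :=
  congrArg unop (T.rep_X₂ hr hs h)

theorem repB_X₃ : T.repB hr hs h (op (B.X₃ r s)) = T.x₃ :=
  congrArg unop (T.rep_X₃ hr hs h)

theorem repB_W : T.repB hr hs h (op (B.W r s)) = T.w :=
  congrArg unop (T.rep_W hr hs h)

end

end Ops

/-! ### Operators that permute a basis up to scalars -/

section Shift

variable {G : Type*}

/-- The basis vector `e(g)`. -/
abbrev bas (g : G) : G →₀ ℂ := Finsupp.single g 1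

/-- The linear operator with prescribed values on the basis. -/
def basisOp (F : G → G →₀ ℂ) : (G →₀ ℂ) →ₗ[ℂ] (G →₀ ℂ) := Finsupp.linearCombination ℂ F

theorem basisOp_bas (F : G → G →₀ ℂ) (g : G) : basisOp F (bas g) = F g := by
  simp [basisOp]

theorem op_ext {S T : (G →₀ ℂ) →ₗ[ℂ] (G →₀ ℂ)} (h : ∀ g, S (bas g) = T (bas g)) : S = T :=
  Finsupp.lhom_ext' fun g => LinearMap.ext_ring (h g)

variable [AddCommGroup G]

/-- Four operators that send each basis vector `e(g)` to a multiple of a shifted one give `Ops`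
as soon as the scalars satisfy the evident identities. -/
def Ops.ofShift {r s : ℂ} (F₁ F₂ F₃ F₄ : G → G →₀ ℂ) (g₁ g₂ g₃ g₄ : G) (C₁ C₂ C₃ C₄ : G → ℂ)
    (hg : g₃ + g₁ = g₂ + g₄)
    (h₁ : ∀ g, F₁ g = C₁ g • bas (g + g₁)) (h₂ : ∀ g, F₂ g = C₂ g • bas (g + g₂))
    (h₃ : ∀ g, F₃ g = C₃ g • bas (g + g₃)) (h₄ : ∀ g, F₄ g = C₄ g • bas (g + g₄))
    (hC : ∀ g, C₁ g ≠ 0)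
    (r₁₂ : ∀ g, C₁ g * C₂ (g + g₁) = s ^ 2 * (C₂ g * C₁ (g + g₂)))
    (r₁₃ : ∀ g, C₁ g * C₃ (g + g₁) = r ^ 2 * s ^ 2 * (C₃ g * C₁ (g + g₃)))
    (r₂₃ : ∀ g, C₂ g * C₃ (g + g₂) = r * s * (C₃ g * C₂ (g + g₃)))
    (r₁₄ : ∀ g, C₁ g * C₄ (g + g₁) = r ^ 2 * (C₄ g * C₁ (g + g₄)))
    (r₄₃ : ∀ g, C₄ g * C₃ (g + g₄) = r * s * (C₃ g * C₄ (g + g₃)))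
    (r₄₂ : ∀ g, C₄ g * C₂ (g + g₄) = C₂ g * C₄ (g + g₂)
      + s ^ 2 * (r ^ 2 - s ^ 2) * (C₃ g * C₁ (g + g₃))) :
    Ops r s (G →₀ ℂ) where
  x₁ := basisOp F₁
  x₁' := basisOp fun g => (C₁ (g - g₁))⁻¹ • bas (g - g₁)
  x₂ := basisOp F₂
  x₃ := basisOp F₃
  w := basisOp F₄
  inv₁ := op_ext fun g => by
    simp [Module.End.mul_apply, basisOp_bas, h₁, smul_smul, hC, -Finsupp.smul_single]
  inv₂ := op_ext fun g => by
    simp [Module.End.mul_apply, basisOp_bas, h₁, smul_smul, hC, -Finsupp.smul_single]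
  rel₁₂ := op_ext fun g => by
    simp only [Module.End.mul_apply, LinearMap.smul_apply, basisOp_bas, h₁, h₂, map_smul,
      smul_smul, r₁₂, add_right_comm g g₁]
  rel₁₃ := op_ext fun g => by
    simp only [Module.End.mul_apply, LinearMap.smul_apply, basisOp_bas, h₁, h₃, map_smul,
      smul_smul, r₁₃, add_right_comm g g₁]
  rel₂₃ := op_ext fun g => by
    simp only [Module.End.mul_apply, LinearMap.smul_apply, basisOp_bas, h₂, h₃, map_smul,
      smul_smul, r₂₃, add_right_comm g g₂]
  rel₁w := op_ext fun g => by
    simp only [Module.End.mul_apply, LinearMap.smul_apply, basisOp_bas, h₁, h₄, map_smul,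
      smul_smul, r₁₄, add_right_comm g g₁]
  rel_w₃ := op_ext fun g => by
    simp only [Module.End.mul_apply, LinearMap.smul_apply, basisOp_bas, h₃, h₄, map_smul,
      smul_smul, r₄₃, add_right_comm g g₄]
  rel_w₂ := op_ext fun g => by
    simp only [Module.End.mul_apply, LinearMap.smul_apply, LinearMap.add_apply, basisOp_bas,
      h₁, h₂, h₃, h₄, map_smul, smul_smul, r₄₂, add_smul]
    rw [add_assoc g g₄, add_assoc g g₂, add_assoc g g₃, hg, add_comm g₄]

end Shift

/-! ### Powers indexed by `ℤ/n`

The representative of `a : ZMod n` in `{0, …, n - 1}` is `a.val`. -/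

section Val

variable {n : ℕ} [NeZero n]

theorem pv_add {x : ℂ} (hx : x ^ n = 1) (a b : ZMod n) :
    x ^ (a + b).val = x ^ a.val * x ^ b.val := by
  rw [ZMod.val_add, ← pow_eq_pow_mod _ hx, pow_add]

theorem pv_one {n : ℕ} {x : ℂ} (hx : x ^ n = 1) : x ^ (1 : ZMod n).val = x := by
  have h : ((1 : ℕ) : ZMod n).val = 1 % n := ZMod.val_natCast n 1
  rw [Nat.cast_one] at h
  rw [h, ← pow_eq_pow_mod _ hx, pow_one]

theorem pv_add_one {x : ℂ} (hx : x ^ n = 1) (a : ZMod n) :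
    x ^ (a + 1).val = x ^ a.val * x := by
  rw [pv_add hx, pv_one hx]

theorem pv_ne {x : ℂ} (hx : x ^ n = 1) : x ≠ 0 := by
  rintro rfl
  rw [zero_pow (NeZero.ne n)] at hx
  exact zero_ne_one hx

theorem pv_sub_one {x : ℂ} (hx : x ^ n = 1) (a : ZMod n) :
    x ^ (a + -1).val = x ^ a.val * x⁻¹ := by
  have h := pv_add_one hx (a + -1)
  rw [neg_add_cancel_right] at h
  rw [h, mul_inv_cancel_right₀ (pv_ne hx)]

theorem val_add_one_of {b : ZMod n} (hb : b.val ≠ n - 1) : (b + 1).val = b.val + 1 := by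
  have h1 := ZMod.val_lt b
  have h : ((b.val + 1 : ℕ) : ZMod n).val = (b.val + 1) % n := ZMod.val_natCast n _
  rw [Nat.mod_eq_of_lt (by omega)] at h
  rw [← h]
  simp

theorem add_one_of {b : ZMod n} (hb : b.val = n - 1) : b + 1 = 0 := by
  have h1 : 0 < n := Nat.pos_of_ne_zero (NeZero.ne n)
  have h : ((b.val + 1 : ℕ) : ZMod n) = b + 1 := by simp
  rw [← h, hb, Nat.sub_add_cancel h1, ZMod.natCast_self]

theorem cast_pred : ((n - 1 : ℕ) : ZMod n) = -1 := by
  have h1 : 1 ≤ n := Nat.pos_of_ne_zero (NeZero.ne n)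
  rw [Nat.cast_sub h1]
  simp

theorem val_neg_one' : (-1 : ZMod n).val = n - 1 := by
  have h1 : 0 < n := Nat.pos_of_ne_zero (NeZero.ne n)
  rw [← cast_pred, ZMod.val_natCast, Nat.mod_eq_of_lt (by omega)]

theorem val_pred_of {b : ZMod n} (hb : b ≠ 0) : b.val = (b + -1).val + 1 ∧
    (b + -1).val ≠ n - 1 := by
  have h : (b + -1).val ≠ n - 1 := by
    intro h
    apply hb
    have := add_one_of h
    rwa [neg_add_cancel_right] at this
  refine ⟨?_, h⟩
  have := val_add_one_of h
  rwa [neg_add_cancel_right] at this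

end Val

/-! ### The parameters `ℓ₁, m₁, ℓ₂, m₂, ℓ` -/

open Classical in
/-- `ℓ₁ = ord(r²s²)` if `ord(s²) ∣ ord(r²s²) ord(rs⁻¹)`, and `2 ord(r²s²)` otherwise. -/
def ell₁ (r s : ℂ) : ℕ :=
  if orderOf (s ^ 2) ∣ orderOf (r ^ 2 * s ^ 2) * orderOf (r * s⁻¹) then orderOf (r ^ 2 * s ^ 2)
  else 2 * orderOf (r ^ 2 * s ^ 2)

/-- `m₁ = ord(rs⁻¹)`. -/
def m₁ (r s : ℂ) : ℕ := orderOf (r * s⁻¹)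

/-- `ℓ₂ = ord(r²s²)`. -/
def ell₂ (r s : ℂ) : ℕ := orderOf (r ^ 2 * s ^ 2)

open Classical in
/-- `m₂ = ord(rs⁻¹)` if `ord(r²) ∣ ord(r²s²) ord(rs⁻¹)` or `μ₃ = 0`, and `2 ord(rs⁻¹)`
otherwise. -/
def m₂ (r s μ₃ : ℂ) : ℕ :=
  if orderOf (r ^ 2) ∣ orderOf (r ^ 2 * s ^ 2) * orderOf (r * s⁻¹) ∨ μ₃ = 0 then
    orderOf (r * s⁻¹)
  else 2 * orderOf (r * s⁻¹)

/-- `ℓ = lcm(ord(rs), ord(rs⁻¹))`. -/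
def ell₃ (r s : ℂ) : ℕ := Nat.lcm (orderOf (r * s)) (orderOf (r * s⁻¹))

namespace Standing

variable {r s : ℂ} {m n : ℕ}

theorem r_ne (h : Standing r s m n) : r ≠ 0 := h.prim_r.ne_zero h.m_pos.ne'

theorem s_ne (h : Standing r s m n) : s ≠ 0 := h.prim_s.ne_zero h.n_pos.ne'

theorem ord_pos (h : Standing r s m n) {x : ℂ} (hx : x ^ (m * n) = 1) : 0 < orderOf x :=
  orderOf_pos_iff.2 (isOfFinOrder_iff_pow_eq_one.2 ⟨m * n, Nat.mul_pos h.m_pos h.n_pos, hx⟩)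

theorem r_pow (h : Standing r s m n) : r ^ (m * n) = 1 := by rw [pow_mul, h.prim_r.pow_eq_one, one_pow]

theorem s_pow (h : Standing r s m n) : s ^ (m * n) = 1 := by rw [mul_comm, pow_mul, h.prim_s.pow_eq_one, one_pow]

theorem ord_pos₁ (h : Standing r s m n) : 0 < orderOf (r ^ 2 * s ^ 2) := h.ord_pos <| by
  rw [mul_pow, pow_right_comm, pow_right_comm s, h.r_pow, h.s_pow]; simp

theorem ord_pos₂ (h : Standing r s m n) : 0 < orderOf (r * s⁻¹) := h.ord_pos <| by
  rw [mul_pow, inv_pow, h.r_pow, h.s_pow]; simp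

theorem ord_pos₃ (h : Standing r s m n) : 0 < orderOf (r * s) := h.ord_pos <| by
  rw [mul_pow, h.r_pow, h.s_pow]; simp

theorem ell₁_ne (h : Standing r s m n) : ell₁ r s ≠ 0 := by
  have := h.ord_pos₁
  unfold ell₁; split_ifs <;> omega

theorem m₁_ne (h : Standing r s m n) : m₁ r s ≠ 0 := h.ord_pos₂.ne'

theorem ell₂_ne (h : Standing r s m n) : ell₂ r s ≠ 0 := h.ord_pos₁.ne'

theorem m₂_ne (h : Standing r s m n) (μ₃ : ℂ) : m₂ r s μ₃ ≠ 0 := by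
  have := h.ord_pos₂
  unfold m₂; split_ifs <;> omega

theorem ell₃_ne (h : Standing r s m n) : ell₃ r s ≠ 0 := Nat.lcm_ne_zero h.ord_pos₃.ne' h.ord_pos₂.ne'

theorem div_ne (h : Standing r s m n) : 1 - r * s⁻¹ ≠ 0 := by
  intro e
  apply h.sq_ne
  have hs := h.s_ne
  have : r = s := by field_simp at e; linear_combination -e
  rw [this]

theorem div_ne' (h : Standing r s m n) : 1 - r⁻¹ * s ≠ 0 := by
  intro e
  apply h.sq_ne
  have hr := h.r_ne
  have : r = s := by field_simp at e; linear_combination e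
  rw [this]

theorem pow_m (h : Standing r s m n) {k : ℕ} (hk : (r * s⁻¹) ^ k = 1) : r ^ k = s ^ k := by
  have hs := pow_ne_zero k h.s_ne
  rw [mul_pow, inv_pow] at hk
  field_simp at hk
  exact hk

theorem sq_sq_pow (h : Standing r s m n) : (s ^ 2) ^ (2 * (orderOf (r ^ 2 * s ^ 2) * orderOf (r * s⁻¹))) = 1 ∧
    (r ^ 2) ^ (2 * (orderOf (r ^ 2 * s ^ 2) * orderOf (r * s⁻¹))) = 1 := by
  have hr := h.r_ne
  have hs := h.s_ne
  have e1 : (r ^ 2 * s ^ 2) ^ (orderOf (r ^ 2 * s ^ 2) * orderOf (r * s⁻¹)) = 1 := by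
    rw [pow_mul, pow_orderOf_eq_one, one_pow]
  have e2 : (r * s⁻¹) ^ (orderOf (r ^ 2 * s ^ 2) * orderOf (r * s⁻¹)) = 1 := by
    rw [mul_comm (orderOf _), pow_mul, pow_orderOf_eq_one, one_pow]
  constructor
  · have : (s ^ 2) ^ 2 = (r ^ 2 * s ^ 2) * ((r * s⁻¹) ^ 2)⁻¹ := by field_simp
    rw [pow_mul, this, mul_pow, inv_pow, e1, ← pow_mul, mul_comm 2, pow_mul, e2]
    simp
  · have : (r ^ 2) ^ 2 = (r ^ 2 * s ^ 2) * (r * s⁻¹) ^ 2 := by field_simp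
    rw [pow_mul, this, mul_pow, e1, ← pow_mul, mul_comm 2, pow_mul, e2]
    simp

theorem per₁ (_h : Standing r s m n) : ((r * s) ^ 2) ^ ell₁ r s = 1 := by
  rw [mul_pow]
  unfold ell₁
  split_ifs
  · exact pow_orderOf_eq_one _
  · rw [mul_comm 2, pow_mul, pow_orderOf_eq_one, one_pow]

theorem per₁' (h : Standing r s m n) : (s ^ (2 * m₁ r s)) ^ ell₁ r s = 1 := by
  rw [← pow_mul, mul_assoc, pow_mul]
  unfold ell₁ m₁
  split_ifs with hd
  · rw [mul_comm]
    exact orderOf_dvd_iff_pow_eq_one.1 hd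
  · have := h.sq_sq_pow.1
    rwa [show orderOf (r * s⁻¹) * (2 * orderOf (r ^ 2 * s ^ 2))
      = 2 * (orderOf (r ^ 2 * s ^ 2) * orderOf (r * s⁻¹)) by ring]

theorem per₂ (_h : Standing r s m n) : ((r * s) ^ 2) ^ ell₂ r s = 1 := by
  rw [mul_pow]
  exact pow_orderOf_eq_one _

theorem per₂' (h : Standing r s m n) {μ₃ : ℂ} (hμ : μ₃ ≠ 0) : (r ^ (2 * m₂ r s μ₃)) ^ ell₂ r s = 1 := by
  rw [← pow_mul, mul_assoc, pow_mul]
  unfold m₂ ell₂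
  split_ifs with hd
  · rw [mul_comm]
    exact orderOf_dvd_iff_pow_eq_one.1 (hd.resolve_right hμ)
  · have := h.sq_sq_pow.2
    rwa [show 2 * orderOf (r * s⁻¹) * orderOf (r ^ 2 * s ^ 2)
      = 2 * (orderOf (r ^ 2 * s ^ 2) * orderOf (r * s⁻¹)) by ring]

theorem m₁_pow (h : Standing r s m n) : r ^ m₁ r s = s ^ m₁ r s := h.pow_m (pow_orderOf_eq_one _)

theorem m₂_pow (h : Standing r s m n) (μ₃ : ℂ) : r ^ m₂ r s μ₃ = s ^ m₂ r s μ₃ := by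
  apply h.pow_m
  unfold m₂
  split_ifs
  · exact pow_orderOf_eq_one _
  · rw [mul_comm 2, pow_mul, pow_orderOf_eq_one, one_pow]

theorem per₃ (_h : Standing r s m n) : (r * s) ^ ell₃ r s = 1 :=
  orderOf_dvd_iff_pow_eq_one.1 (Nat.dvd_lcm_left _ _)

theorem per₃' (_h : Standing r s m n) : (r * s⁻¹) ^ ell₃ r s = 1 :=
  orderOf_dvd_iff_pow_eq_one.1 (Nat.dvd_lcm_right _ _)

end Standing
theorem smul_bas {G : Type*} {c d : ℂ} {g k : G} (hc : c = d) (hg : g = k) :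
    c • bas g = d • bas k := by
  rw [hc, hg]

/-! ### The modules `M₁(λ)` -/

/-- Parameters `λ = (λ₁, λ₂, λ₃, λ₄) ∈ (ℂˣ)³ × ℂ` with `λ₄ ≠ s² (r² - s²) / (1 - rs⁻¹) λ₃`. -/
structure Param₁ (r s : ℂ) where
  l₁ : ℂ
  l₂ : ℂ
  l₃ : ℂ
  l₄ : ℂ
  l₁_ne : l₁ ≠ 0
  l₂_ne : l₂ ≠ 0
  l₃_ne : l₃ ≠ 0
  l₄_ne : l₄ ≠ s ^ 2 * (r ^ 2 - s ^ 2) / (1 - r * s⁻¹) * l₃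

/-- The vector space `M₁(λ)` with basis `e(a, b)`, `0 ≤ a ≤ ℓ₁ - 1`, `0 ≤ b ≤ m₁ - 1`. -/
def M₁ {r s : ℂ} {m n : ℕ} (_h : Standing r s m n) (_lam : Param₁ r s) : Type :=
  ZMod (ell₁ r s) × ZMod (m₁ r s) →₀ ℂ

namespace M₁

variable {r s : ℂ} {m n : ℕ} (h : Standing r s m n) (lam : Param₁ r s)

instance : AddCommGroup (M₁ h lam) :=
  inferInstanceAs (AddCommGroup (ZMod (ell₁ r s) × ZMod (m₁ r s) →₀ ℂ))

instance : Module ℂ (M₁ h lam) :=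
  inferInstanceAs (Module ℂ (ZMod (ell₁ r s) × ZMod (m₁ r s) →₀ ℂ))

/-- `e(a, b)`. -/
def e (a : ZMod (ell₁ r s)) (b : ZMod (m₁ r s)) : M₁ h lam := bas (a, b)

/-- `e(a, b) X₁`. -/
def F₁ (g : ZMod (ell₁ r s) × ZMod (m₁ r s)) : M₁ h lam :=
  ((s ^ (2 * g.2.val))⁻¹ * lam.l₁) • e h lam (g.1 + 1) g.2

/-- `e(a, b) X₂`. -/
def F₂ (g : ZMod (ell₁ r s) × ZMod (m₁ r s)) : M₁ h lam :=
  if g.2.val = m₁ r s - 1 then (s ^ (2 * g.1.val * m₁ r s) * lam.l₂) • e h lam g.1 0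
  else lam.l₂ • e h lam g.1 (g.2 + 1)

/-- `e(a, b) X₃`. -/
def F₃ (g : ZMod (ell₁ r s) × ZMod (m₁ r s)) : M₁ h lam :=
  ((r * s) ^ (2 * g.1.val + g.2.val) * lam.l₁⁻¹ * lam.l₃) • e h lam (g.1 - 1) g.2

/-- `e(a, b) W̃`. -/
def F₄ (g : ZMod (ell₁ r s) × ZMod (m₁ r s)) : M₁ h lam :=
  if g.2 = 0 then
    (lam.l₂⁻¹ * lam.l₄ * r ^ (2 * g.1.val) * (s ^ (2 * g.1.val * (m₁ r s - 1)))⁻¹) •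
      e h lam g.1 ((m₁ r s - 1 : ℕ) : ZMod (m₁ r s))
  else
    (lam.l₂⁻¹ * (r * s) ^ (2 * g.1.val) *
      (lam.l₄ - s ^ 2 * (r ^ 2 - s ^ 2) * ((1 - (r * s⁻¹) ^ g.2.val) / (1 - r * s⁻¹)) * lam.l₃)) •
      e h lam g.1 (g.2 - 1)

/-- The four operators on `M₁(λ)`. -/
def ops : Ops r s (M₁ h lam) :=
  haveI : NeZero (ell₁ r s) := ⟨h.ell₁_ne⟩
  haveI : NeZero (m₁ r s) := ⟨h.m₁_ne⟩
  Ops.ofShift (G := ZMod (ell₁ r s) × ZMod (m₁ r s))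
    (F₁ h lam) (F₂ h lam) (F₃ h lam) (F₄ h lam) (1, 0) (0, 1) (-1, 0) (0, -1)
    (fun g => ((s ^ 2) ^ g.2.val)⁻¹ * lam.l₁)
    (fun g => if g.2.val = m₁ r s - 1 then (s ^ (2 * m₁ r s)) ^ g.1.val * lam.l₂ else lam.l₂)
    (fun g => ((r * s) ^ 2) ^ g.1.val * (r * s) ^ g.2.val * lam.l₁⁻¹ * lam.l₃)
    (fun g => if g.2 = 0 then
        lam.l₂⁻¹ * lam.l₄ * (((r * s) ^ 2) ^ g.1.val * ((s ^ (2 * m₁ r s)) ^ g.1.val)⁻¹)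
      else lam.l₂⁻¹ * ((r * s) ^ 2) ^ g.1.val *
        (lam.l₄ - s ^ 2 * (r ^ 2 - s ^ 2) * ((1 - (r * s⁻¹) ^ g.2.val) / (1 - r * s⁻¹)) * lam.l₃))
    (by simp)
    (fun g => smul_bas (by rw [pow_mul]) (by simp [Prod.ext_iff]))
    (fun g => by
      unfold F₂
      split_ifs with hb
      · exact smul_bas (by rw [← pow_mul]; ring) (by simp [Prod.ext_iff, add_one_of hb])
      · exact smul_bas rfl (by simp [Prod.ext_iff]))
    (fun g => smul_bas (by rw [pow_add, pow_mul]) (by simp [Prod.ext_iff, sub_eq_add_neg]))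
    (fun g => by
      have hs := h.s_ne
      unfold F₄
      split_ifs with hb
      · refine smul_bas ?_ (by simp [Prod.ext_iff, hb, cast_pred])
        have e1 : s ^ (2 * m₁ r s) = (s ^ (m₁ r s - 1) * s) ^ 2 := by
          rw [pow_sub_one_mul h.m₁_ne, ← pow_mul, mul_comm]
        have e2 : s ^ (2 * g.1.val * (m₁ r s - 1)) = (s ^ (m₁ r s - 1)) ^ (2 * g.1.val) := by
          rw [← pow_mul, mul_comm]
        have hp : s ^ (m₁ r s - 1) ≠ 0 := pow_ne_zero _ hs
        rw [e1, e2]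
        generalize s ^ (m₁ r s - 1) = p at *
        rw [← pow_mul, ← pow_mul, mul_pow, mul_pow]
        field_simp
      · exact smul_bas (by rw [pow_mul]) (by simp [Prod.ext_iff, sub_eq_add_neg]))
    (fun g => mul_ne_zero (inv_ne_zero (pow_ne_zero _ (pow_ne_zero _ h.s_ne))) lam.l₁_ne)
    (fun ⟨a, b⟩ => by
      have hs := h.s_ne
      simp only [Prod.mk_add_mk, add_zero]
      split_ifs with hb
      · rw [add_one_of hb, hb, pv_add_one h.per₁', ZMod.val_zero]
        have e1 : s ^ (2 * m₁ r s) = (s ^ 2) ^ (m₁ r s - 1) * s ^ 2 := by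
          rw [pow_sub_one_mul h.m₁_ne, pow_mul]
        rw [e1]
        field_simp
      · rw [val_add_one_of hb, pow_succ (s ^ 2) b.val]
        field_simp)
    (fun ⟨a, b⟩ => by
      simp only [Prod.mk_add_mk, add_zero]
      rw [pv_add_one h.per₁]
      ring)
    (fun ⟨a, b⟩ => by
      have hs := h.s_ne
      have hr := h.r_ne
      simp only [Prod.mk_add_mk, add_zero]
      split_ifs with hb
      · rw [add_one_of hb, hb, pv_sub_one h.per₁', ZMod.val_zero]
        have e1 : s ^ (2 * m₁ r s) = (r * s) ^ (m₁ r s - 1) * (r * s) := by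
          rw [pow_sub_one_mul h.m₁_ne, mul_pow, h.m₁_pow]; ring
        rw [e1]
        field_simp
      · rw [val_add_one_of hb]
        ring)
    (fun ⟨a, b⟩ => by
      have hs := h.s_ne
      have hr := h.r_ne
      simp only [Prod.mk_add_mk, add_zero]
      split_ifs with hb
      · rw [hb, zero_add, val_neg_one', pv_add_one h.per₁, pv_add_one h.per₁', ZMod.val_zero]
        have e1 : s ^ (2 * m₁ r s) = (s ^ 2) ^ (m₁ r s - 1) * s ^ 2 := by
          rw [pow_sub_one_mul h.m₁_ne, pow_mul]
        rw [e1]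
        field_simp
      · rw [(val_pred_of hb).1, pv_add_one h.per₁]
        generalize (1 - (r * s⁻¹) ^ ((b + -1).val + 1)) / (1 - r * s⁻¹) = z
        rw [pow_succ (s ^ 2)]
        field_simp)
    (fun ⟨a, b⟩ => by
      have hs := h.s_ne
      have hr := h.r_ne
      simp only [Prod.mk_add_mk, add_zero]
      split_ifs with hb
      · rw [hb, zero_add, val_neg_one', pv_sub_one h.per₁, pv_sub_one h.per₁', ZMod.val_zero]
        have e1 : s ^ (2 * m₁ r s) = (r * s) ^ (m₁ r s - 1) * (r * s) := by
          rw [pow_sub_one_mul h.m₁_ne, mul_pow, h.m₁_pow]; ring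
        rw [e1]
        field_simp
      · rw [(val_pred_of hb).1, pv_sub_one h.per₁]
        generalize (1 - (r * s⁻¹) ^ ((b + -1).val + 1)) / (1 - r * s⁻¹) = z
        rw [pow_succ (r * s) (b + -1).val]
        field_simp)
    (fun ⟨a, b⟩ => by
      have hs := h.s_ne
      have hr := h.r_ne
      have hl := lam.l₁_ne
      have hl₂ := lam.l₂_ne
      have hd := h.div_ne
      have e0 : (r * s) ^ b.val = (r * s⁻¹) ^ b.val * (s ^ 2) ^ b.val := by
        rw [← mul_pow]; congr 1; field_simp
      have hq : (r * s⁻¹) ^ m₁ r s = 1 := pow_orderOf_eq_one _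
      have hm1 : m₁ r s ≠ 1 := by
        intro e; rw [e, pow_one] at hq; exact hd (by rw [hq, sub_self])
      have hm0 := h.m₁_ne
      simp only [Prod.mk_add_mk, add_zero]
      rw [e0]
      have hT : (s ^ 2) ^ b.val ≠ 0 := pow_ne_zero _ (pow_ne_zero 2 hs)
      have hS : (s ^ (2 * m₁ r s)) ^ a.val ≠ 0 := pow_ne_zero _ (pow_ne_zero _ hs)
      have hA : ((r * s) ^ 2) ^ a.val ≠ 0 := pow_ne_zero _ (pow_ne_zero _ (mul_ne_zero hr hs))
      by_cases hb : b = 0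
      · subst hb
        have h0 : (0 : ZMod (m₁ r s)).val ≠ m₁ r s - 1 := by rw [ZMod.val_zero]; omega
        have h1 : (0 + 1 : ZMod (m₁ r s)).val = 1 := by rw [val_add_one_of h0, ZMod.val_zero]
        have h2 : (0 + 1 : ZMod (m₁ r s)) ≠ 0 := by
          intro e; rw [e, ZMod.val_zero] at h1; exact zero_ne_one h1
        rw [if_pos rfl, zero_add (-1 : ZMod (m₁ r s)), if_pos val_neg_one', if_neg h0, if_neg h2,
          h1, pow_one, div_self hd, ZMod.val_zero]
        field_simp
        ring
      · obtain ⟨hb1, hb2⟩ := val_pred_of hb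
        rw [if_neg hb, if_neg hb2]
        by_cases hb3 : b.val = m₁ r s - 1
        · rw [if_pos hb3, if_pos (add_one_of hb3)]
          have hQ : (r * s⁻¹) ^ b.val * (r * s⁻¹) = 1 := by
            rw [hb3, pow_sub_one_mul h.m₁_ne, hq]
          generalize (r * s⁻¹) ^ b.val = Q at *
          generalize (s ^ 2) ^ b.val = T at *
          generalize r * s⁻¹ = q at *
          generalize s ^ 2 * (r ^ 2 - s ^ 2) = c at *
          field_simp
          linear_combination (c * lam.l₃) * hQ
        · have h2 : b + 1 ≠ 0 := by
            intro e
            have := val_add_one_of hb3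
            rw [e, ZMod.val_zero] at this
            omega
          rw [if_neg hb3, if_neg h2, val_add_one_of hb3, pow_succ (r * s⁻¹)]
          generalize (r * s⁻¹) ^ b.val = Q at *
          generalize (s ^ 2) ^ b.val = T at *
          generalize r * s⁻¹ = q at *
          generalize s ^ 2 * (r ^ 2 - s ^ 2) = c at *
          field_simp
          ring)

/-- `M₁(λ)` as a right `B`-module. -/
instance : Module (B r s)ᵐᵒᵖ (M₁ h lam) :=
  Module.compHom _ ((ops h lam).repB h.r_ne h.s_ne h.sq_ne).toRingHom

theorem op_smul (x : B r s) (v : M₁ h lam) :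
    op x • v = (ops h lam).repB h.r_ne h.s_ne h.sq_ne (op x) v := rfl

/-- The action of `B` is `ℂ`-linear in the evident sense. -/
theorem op_algebraMap (c : ℂ) (v : M₁ h lam) : op (algebraMap ℂ (B r s) c) • v = c • v := by
  rw [op_smul, show op (algebraMap ℂ (B r s) c) = algebraMap ℂ (B r s)ᵐᵒᵖ c from rfl,
    AlgHom.commutes, Module.algebraMap_end_apply]

theorem e_X₁ (a : ZMod (ell₁ r s)) (b : ZMod (m₁ r s)) :
    op (B.X₁ r s) • e h lam a b = ((s ^ (2 * b.val))⁻¹ * lam.l₁) • e h lam (a + 1) b := by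
  rw [op_smul, Ops.repB_X₁]
  exact basisOp_bas _ (a, b)

theorem e_X₂ (a : ZMod (ell₁ r s)) (b : ZMod (m₁ r s)) :
    op (B.X₂ r s) • e h lam a b =
      if b.val = m₁ r s - 1 then (s ^ (2 * a.val * m₁ r s) * lam.l₂) • e h lam a 0
      else lam.l₂ • e h lam a (b + 1) := by
  rw [op_smul, Ops.repB_X₂]
  exact basisOp_bas _ (a, b)

theorem e_X₃ (a : ZMod (ell₁ r s)) (b : ZMod (m₁ r s)) :
    op (B.X₃ r s) • e h lam a b =
      ((r * s) ^ (2 * a.val + b.val) * lam.l₁⁻¹ * lam.l₃) • e h lam (a - 1) b := by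
  rw [op_smul, Ops.repB_X₃]
  exact basisOp_bas _ (a, b)

theorem e_W (a : ZMod (ell₁ r s)) (b : ZMod (m₁ r s)) :
    op (B.W r s) • e h lam a b =
      if b = 0 then
        (lam.l₂⁻¹ * lam.l₄ * r ^ (2 * a.val) * (s ^ (2 * a.val * (m₁ r s - 1)))⁻¹) •
          e h lam a ((m₁ r s - 1 : ℕ) : ZMod (m₁ r s))
      else
        (lam.l₂⁻¹ * (r * s) ^ (2 * a.val) *
          (lam.l₄ - s ^ 2 * (r ^ 2 - s ^ 2) * ((1 - (r * s⁻¹) ^ b.val) / (1 - r * s⁻¹)) * lam.l₃)) •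
          e h lam a (b - 1) := by
  rw [op_smul, Ops.repB_W]
  exact basisOp_bas _ (a, b)

end M₁

/-! ### The modules `M₂(μ)` -/

/-- Parameters `μ = (μ₁, μ₂, μ₃) ∈ (ℂˣ)² × ℂ`. -/
structure Param₂ where
  u₁ : ℂ
  u₂ : ℂ
  u₃ : ℂ
  u₁_ne : u₁ ≠ 0
  u₂_ne : u₂ ≠ 0

/-- The vector space `M₂(μ)` with basis `e(a, b)`, `0 ≤ a ≤ ℓ₂ - 1`, `0 ≤ b ≤ m₂ - 1`. -/
def M₂ {r s : ℂ} {m n : ℕ} (_h : Standing r s m n) (mu : Param₂) : Type :=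
  ZMod (ell₂ r s) × ZMod (m₂ r s mu.u₃) →₀ ℂ

namespace M₂

variable {r s : ℂ} {m n : ℕ} (h : Standing r s m n) (mu : Param₂)

instance : AddCommGroup (M₂ h mu) :=
  inferInstanceAs (AddCommGroup (ZMod (ell₂ r s) × ZMod (m₂ r s mu.u₃) →₀ ℂ))

instance : Module ℂ (M₂ h mu) :=
  inferInstanceAs (Module ℂ (ZMod (ell₂ r s) × ZMod (m₂ r s mu.u₃) →₀ ℂ))

/-- `e(a, b)`. -/
def e (a : ZMod (ell₂ r s)) (b : ZMod (m₂ r s mu.u₃)) : M₂ h mu := bas (a, b)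

/-- `e(a, b) X₁`. -/
def F₁ (g : ZMod (ell₂ r s) × ZMod (m₂ r s mu.u₃)) : M₂ h mu :=
  ((r ^ (2 * g.2.val))⁻¹ * mu.u₁) • e h mu (g.1 + 1) g.2

/-- `e(a, b) X₂`. -/
def F₂ (g : ZMod (ell₂ r s) × ZMod (m₂ r s mu.u₃)) : M₂ h mu :=
  if g.2 = 0 then 0
  else ((r * s) ^ (2 * g.1.val) * s ^ 2 * (r ^ 2 - s ^ 2) *
    ((1 - (r⁻¹ * s) ^ g.2.val) / (1 - r⁻¹ * s)) * mu.u₂) • e h mu g.1 (g.2 - 1)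

/-- `e(a, b) X₃`. -/
def F₃ (g : ZMod (ell₂ r s) × ZMod (m₂ r s mu.u₃)) : M₂ h mu :=
  ((r * s) ^ (2 * g.1.val + g.2.val) * mu.u₁⁻¹ * mu.u₂) • e h mu (g.1 - 1) g.2

/-- `e(a, b) W̃`. -/
def F₄ (g : ZMod (ell₂ r s) × ZMod (m₂ r s mu.u₃)) : M₂ h mu :=
  if g.2.val = m₂ r s mu.u₃ - 1 then
    (r ^ (2 * g.1.val * m₂ r s mu.u₃) * mu.u₃) • e h mu g.1 0
  else e h mu g.1 (g.2 + 1)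

theorem per_succ (h : Standing r s m n) (mu : Param₂) (a : ZMod (ell₂ r s)) [NeZero (ell₂ r s)] :
    (r ^ (2 * m₂ r s mu.u₃)) ^ (a + 1).val * mu.u₃ =
      (r ^ (2 * m₂ r s mu.u₃)) ^ a.val * r ^ (2 * m₂ r s mu.u₃) * mu.u₃ := by
  by_cases h0 : mu.u₃ = 0
  · simp [h0]
  · rw [pv_add_one (h.per₂' h0)]

theorem per_pred (h : Standing r s m n) (mu : Param₂) (a : ZMod (ell₂ r s)) [NeZero (ell₂ r s)] :
    (r ^ (2 * m₂ r s mu.u₃)) ^ (a + -1).val * mu.u₃ =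
      (r ^ (2 * m₂ r s mu.u₃)) ^ a.val * (r ^ (2 * m₂ r s mu.u₃))⁻¹ * mu.u₃ := by
  by_cases h0 : mu.u₃ = 0
  · simp [h0]
  · rw [pv_sub_one (h.per₂' h0)]

/-- The four operators on `M₂(μ)`. -/
def ops : Ops r s (M₂ h mu) :=
  haveI : NeZero (ell₂ r s) := ⟨h.ell₂_ne⟩
  haveI : NeZero (m₂ r s mu.u₃) := ⟨h.m₂_ne _⟩
  Ops.ofShift (G := ZMod (ell₂ r s) × ZMod (m₂ r s mu.u₃))
    (F₁ h mu) (F₂ h mu) (F₃ h mu) (F₄ h mu) (1, 0) (0, -1) (-1, 0) (0, 1)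
    (fun g => ((r ^ 2) ^ g.2.val)⁻¹ * mu.u₁)
    (fun g => ((r * s) ^ 2) ^ g.1.val * (s ^ 2 * (r ^ 2 - s ^ 2)) *
      ((1 - (r⁻¹ * s) ^ g.2.val) / (1 - r⁻¹ * s)) * mu.u₂)
    (fun g => ((r * s) ^ 2) ^ g.1.val * (r * s) ^ g.2.val * mu.u₁⁻¹ * mu.u₂)
    (fun g => if g.2.val = m₂ r s mu.u₃ - 1 then
      (r ^ (2 * m₂ r s mu.u₃)) ^ g.1.val * mu.u₃ else 1)
    (by simp)
    (fun g => smul_bas (by rw [pow_mul]) (by simp [Prod.ext_iff]))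
    (fun g => by
      unfold F₂
      split_ifs with hb
      · rw [hb, ZMod.val_zero, pow_zero, sub_self, zero_div, mul_zero, zero_mul]
        exact (zero_smul ℂ (bas (g + (0, -1)))).symm
      · exact smul_bas (by rw [pow_mul]; ring) (by simp [Prod.ext_iff, sub_eq_add_neg]))
    (fun g => smul_bas (by rw [pow_add, pow_mul]) (by simp [Prod.ext_iff, sub_eq_add_neg]))
    (fun g => by
      unfold F₄
      split_ifs with hb
      · exact smul_bas (by rw [← pow_mul]; ring) (by simp [Prod.ext_iff, add_one_of hb])
      · refine Eq.trans ?_ (one_smul ℂ _).symm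
        exact congrArg bas (by simp [Prod.ext_iff]))
    (fun g => mul_ne_zero (inv_ne_zero (pow_ne_zero _ (pow_ne_zero _ h.r_ne))) mu.u₁_ne)
    (fun ⟨a, b⟩ => by
      have hr := h.r_ne
      simp only [Prod.mk_add_mk, add_zero]
      by_cases hb : b = 0
      · simp [hb]
      · rw [pv_add_one h.per₂, (val_pred_of hb).1]
        generalize (1 - (r⁻¹ * s) ^ ((b + -1).val + 1)) / (1 - r⁻¹ * s) = z
        rw [pow_succ (r ^ 2) (b + -1).val]
        field_simp)
    (fun ⟨a, b⟩ => by
      simp only [Prod.mk_add_mk, add_zero]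
      rw [pv_add_one h.per₂]
      ring)
    (fun ⟨a, b⟩ => by
      have hr := h.r_ne
      have hs := h.s_ne
      simp only [Prod.mk_add_mk, add_zero]
      by_cases hb : b = 0
      · simp [hb]
      · rw [pv_sub_one h.per₂, (val_pred_of hb).1]
        generalize (1 - (r⁻¹ * s) ^ ((b + -1).val + 1)) / (1 - r⁻¹ * s) = z
        rw [pow_succ (r * s) (b + -1).val]
        field_simp)
    (fun ⟨a, b⟩ => by
      have hr := h.r_ne
      simp only [Prod.mk_add_mk, add_zero]
      split_ifs with hb
      · rw [per_succ h mu, add_one_of hb, hb, ZMod.val_zero]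
        have e1 : r ^ (2 * m₂ r s mu.u₃) = (r ^ 2) ^ (m₂ r s mu.u₃ - 1) * r ^ 2 := by
          rw [pow_sub_one_mul (h.m₂_ne _), pow_mul]
        rw [e1]
        field_simp
      · rw [val_add_one_of hb, pow_succ (r ^ 2) b.val]
        field_simp)
    (fun ⟨a, b⟩ => by
      have hr := h.r_ne
      have hs := h.s_ne
      simp only [Prod.mk_add_mk, add_zero]
      split_ifs with hb
      · rw [per_pred h mu, add_one_of hb, hb, ZMod.val_zero]
        have e1 : r ^ (2 * m₂ r s mu.u₃) = (r * s) ^ (m₂ r s mu.u₃ - 1) * (r * s) := by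
          rw [pow_sub_one_mul (h.m₂_ne _), mul_pow, ← h.m₂_pow]; ring
        rw [e1]
        field_simp
      · rw [val_add_one_of hb]
        ring)
    (fun ⟨a, b⟩ => by
      have hs := h.s_ne
      have hr := h.r_ne
      have hl := mu.u₁_ne
      have hd := h.div_ne'
      have e0 : (r * s) ^ b.val = (r⁻¹ * s) ^ b.val * (r ^ 2) ^ b.val := by
        rw [← mul_pow]; congr 1; field_simp
      have hq : (r⁻¹ * s) ^ m₂ r s mu.u₃ = 1 := by
        rw [mul_pow, ← h.m₂_pow, inv_pow, inv_mul_cancel₀ (pow_ne_zero _ hr)]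
      have hm1 : m₂ r s mu.u₃ ≠ 1 := by
        intro e; rw [e, pow_one] at hq; exact hd (by rw [hq, sub_self])
      have hm0 := h.m₂_ne mu.u₃
      simp only [Prod.mk_add_mk, add_zero]
      rw [e0]
      have hT : (r ^ 2) ^ b.val ≠ 0 := pow_ne_zero _ (pow_ne_zero 2 hr)
      by_cases hb3 : b.val = m₂ r s mu.u₃ - 1
      · have hb : b ≠ 0 := by
          intro e; rw [e, ZMod.val_zero] at hb3; omega
        have hQ : (r⁻¹ * s) ^ b.val * (r⁻¹ * s) = 1 := by
          rw [hb3, pow_sub_one_mul (h.m₂_ne _), hq]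
        rw [if_pos hb3, if_neg (val_pred_of hb).2, add_one_of hb3, ZMod.val_zero, pow_zero,
          sub_self, zero_div]
        have hA : ((r * s) ^ 2) ^ a.val ≠ 0 := pow_ne_zero _ (pow_ne_zero _ (mul_ne_zero hr hs))
        generalize (r⁻¹ * s) ^ b.val = Q at *
        generalize (r ^ 2) ^ b.val = T at *
        generalize r⁻¹ * s = q at *
        generalize s ^ 2 * (r ^ 2 - s ^ 2) = c at *
        generalize ((r * s) ^ 2) ^ a.val = A at *
        field_simp
        linear_combination (c * mu.u₂) * hQ
      · rw [if_neg hb3, val_add_one_of hb3, pow_succ (r⁻¹ * s)]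
        have e5 : ((1 - (r⁻¹ * s) ^ b.val) / (1 - r⁻¹ * s)) *
            (if (b + -1).val = m₂ r s mu.u₃ - 1 then
              (r ^ (2 * m₂ r s mu.u₃)) ^ a.val * mu.u₃ else 1) =
            (1 - (r⁻¹ * s) ^ b.val) / (1 - r⁻¹ * s) := by
          by_cases hb : b = 0
          · simp [hb]
          · rw [if_neg (val_pred_of hb).2, mul_one]
        rw [mul_right_comm _ mu.u₂, mul_assoc _ _ (ite _ _ _), e5]
        generalize (r⁻¹ * s) ^ b.val = Q at *
        generalize (r ^ 2) ^ b.val = T at *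
        generalize r⁻¹ * s = q at *
        generalize s ^ 2 * (r ^ 2 - s ^ 2) = c at *
        field_simp
        ring)

/-- `M₂(μ)` as a right `B`-module. -/
instance : Module (B r s)ᵐᵒᵖ (M₂ h mu) :=
  Module.compHom _ ((ops h mu).repB h.r_ne h.s_ne h.sq_ne).toRingHom

theorem op_smul (x : B r s) (v : M₂ h mu) :
    op x • v = (ops h mu).repB h.r_ne h.s_ne h.sq_ne (op x) v := rfl

/-- The action of `B` is `ℂ`-linear in the evident sense. -/
theorem op_algebraMap (c : ℂ) (v : M₂ h mu) : op (algebraMap ℂ (B r s) c) • v = c • v := by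
  rw [op_smul, show op (algebraMap ℂ (B r s) c) = algebraMap ℂ (B r s)ᵐᵒᵖ c from rfl,
    AlgHom.commutes, Module.algebraMap_end_apply]

theorem e_X₁ (a : ZMod (ell₂ r s)) (b : ZMod (m₂ r s mu.u₃)) :
    op (B.X₁ r s) • e h mu a b = ((r ^ (2 * b.val))⁻¹ * mu.u₁) • e h mu (a + 1) b := by
  rw [op_smul, Ops.repB_X₁]
  exact basisOp_bas _ (a, b)

theorem e_X₂ (a : ZMod (ell₂ r s)) (b : ZMod (m₂ r s mu.u₃)) :
    op (B.X₂ r s) • e h mu a b =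
      if b = 0 then 0
      else ((r * s) ^ (2 * a.val) * s ^ 2 * (r ^ 2 - s ^ 2) *
        ((1 - (r⁻¹ * s) ^ b.val) / (1 - r⁻¹ * s)) * mu.u₂) • e h mu a (b - 1) := by
  rw [op_smul, Ops.repB_X₂]
  exact basisOp_bas _ (a, b)

theorem e_X₃ (a : ZMod (ell₂ r s)) (b : ZMod (m₂ r s mu.u₃)) :
    op (B.X₃ r s) • e h mu a b =
      ((r * s) ^ (2 * a.val + b.val) * mu.u₁⁻¹ * mu.u₂) • e h mu (a - 1) b := by
  rw [op_smul, Ops.repB_X₃]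
  exact basisOp_bas _ (a, b)

theorem e_W (a : ZMod (ell₂ r s)) (b : ZMod (m₂ r s mu.u₃)) :
    op (B.W r s) • e h mu a b =
      if b.val = m₂ r s mu.u₃ - 1 then
        (r ^ (2 * a.val * m₂ r s mu.u₃) * mu.u₃) • e h mu a 0
      else e h mu a (b + 1) := by
  rw [op_smul, Ops.repB_W]
  exact basisOp_bas _ (a, b)

end M₂

/-! ### The modules `M₃(ε)` -/

/-- Parameters `ε = (ε₁, ε₂, ε₃) ∈ (ℂˣ)³`. -/
structure Param₃ where
  p₁ : ℂ
  p₂ : ℂ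
  p₃ : ℂ
  p₁_ne : p₁ ≠ 0
  p₂_ne : p₂ ≠ 0
  p₃_ne : p₃ ≠ 0

/-- The vector space `M₃(ε)` with basis `e(a)`, `0 ≤ a ≤ ℓ - 1`. -/
def M₃ {r s : ℂ} {m n : ℕ} (_h : Standing r s m n) (_eps : Param₃) : Type :=
  ZMod (ell₃ r s) →₀ ℂ

namespace M₃

variable {r s : ℂ} {m n : ℕ} (h : Standing r s m n) (eps : Param₃)

instance : AddCommGroup (M₃ h eps) := inferInstanceAs (AddCommGroup (ZMod (ell₃ r s) →₀ ℂ))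

instance : Module ℂ (M₃ h eps) := inferInstanceAs (Module ℂ (ZMod (ell₃ r s) →₀ ℂ))

/-- `e(a)`. -/
def e (a : ZMod (ell₃ r s)) : M₃ h eps := bas a

/-- `e(a) X₁`. -/
def F₁ (a : ZMod (ell₃ r s)) : M₃ h eps :=
  (eps.p₁ ^ 2 * eps.p₃ * eps.p₂⁻¹ * ((1 - r * s⁻¹) / (s ^ 2 * (r ^ 2 - s ^ 2))) *
    (s ^ (2 * a.val))⁻¹) • e h eps (a + 2)

/-- `e(a) X₂`. -/
def F₂ (a : ZMod (ell₃ r s)) : M₃ h eps := eps.p₁ • e h eps (a + 1)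

/-- `e(a) X₃`. -/
def F₃ (a : ZMod (ell₃ r s)) : M₃ h eps := ((r * s) ^ a.val * eps.p₂) • e h eps a

/-- `e(a) W̃`. -/
def F₄ (a : ZMod (ell₃ r s)) : M₃ h eps :=
  (eps.p₁ * eps.p₃ * (r * s⁻¹) ^ a.val) • e h eps (a + 1)

/-- The four operators on `M₃(ε)`. -/
def ops : Ops r s (M₃ h eps) :=
  haveI : NeZero (ell₃ r s) := ⟨h.ell₃_ne⟩
  Ops.ofShift (G := ZMod (ell₃ r s))
    (F₁ h eps) (F₂ h eps) (F₃ h eps) (F₄ h eps) 2 1 0 1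
    (fun a => eps.p₁ ^ 2 * eps.p₃ * eps.p₂⁻¹ * ((1 - r * s⁻¹) / (s ^ 2 * (r ^ 2 - s ^ 2))) *
      (((r * s) ^ a.val)⁻¹ * (r * s⁻¹) ^ a.val))
    (fun _ => eps.p₁)
    (fun a => (r * s) ^ a.val * eps.p₂)
    (fun a => eps.p₁ * eps.p₃ * (r * s⁻¹) ^ a.val)
    (by rw [zero_add, one_add_one_eq_two])
    (fun a => by
      have hs := h.s_ne
      have hr := h.r_ne
      refine smul_bas ?_ rfl
      congr 1
      rw [← inv_pow ((r * s)), ← mul_pow, pow_mul, ← inv_pow]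
      congr 1
      field_simp)
    (fun a => rfl)
    (fun a => smul_bas rfl (add_zero a).symm)
    (fun a => rfl)
    (fun a => by
      have hs := h.s_ne
      have hr := h.r_ne
      have h1 := eps.p₁_ne
      have h2 := eps.p₂_ne
      have h3 := eps.p₃_ne
      have hd := h.div_ne
      have hq := sub_ne_zero.2 h.sq_ne
      have hrs : (r * s) ^ a.val ≠ 0 := pow_ne_zero _ (mul_ne_zero hr hs)
      have hrs' : (r * s⁻¹) ^ a.val ≠ 0 := pow_ne_zero _ (mul_ne_zero hr (inv_ne_zero hs))
      generalize 1 - r * s⁻¹ = d at *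
      generalize r ^ 2 - s ^ 2 = c at *
      positivity)
    (fun a => by
      have hs := h.s_ne
      have hr := h.r_ne
      rw [pv_add_one h.per₃, pv_add_one h.per₃']
      generalize (1 - r * s⁻¹) / (s ^ 2 * (r ^ 2 - s ^ 2)) = z
      generalize (r * s) ^ a.val = x
      generalize (r * s⁻¹) ^ a.val = x'
      field_simp)
    (fun a => by
      rw [show a + 2 = a + 1 + 1 by rw [add_assoc, one_add_one_eq_two], pv_add_one h.per₃, pv_add_one h.per₃, add_zero]
      ring)
    (fun a => by
      rw [pv_add_one h.per₃]
      ring)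
    (fun a => by
      have hs := h.s_ne
      have hr := h.r_ne
      rw [show a + 2 = a + 1 + 1 by rw [add_assoc, one_add_one_eq_two], pv_add_one h.per₃, pv_add_one h.per₃',
        pv_add_one h.per₃']
      generalize (1 - r * s⁻¹) / (s ^ 2 * (r ^ 2 - s ^ 2)) = z
      generalize (r * s) ^ a.val = x
      generalize (r * s⁻¹) ^ a.val = x'
      field_simp)
    (fun a => by
      rw [pv_add_one h.per₃, add_zero]
      ring)
    (fun a => by
      have hs := h.s_ne
      have hr := h.r_ne
      have h2 := eps.p₂_ne
      have hq := sub_ne_zero.2 h.sq_ne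
      have hrs : (r * s) ^ a.val ≠ 0 := pow_ne_zero _ (mul_ne_zero hr hs)
      rw [pv_add_one h.per₃', add_zero]
      generalize (r * s) ^ a.val = x at *
      generalize (r * s⁻¹) ^ a.val = x' at *
      generalize r ^ 2 - s ^ 2 = c at *
      generalize r * s⁻¹ = q at *
      field_simp
      ring)

/-- `M₃(ε)` as a right `B`-module. -/
instance : Module (B r s)ᵐᵒᵖ (M₃ h eps) :=
  Module.compHom _ ((ops h eps).repB h.r_ne h.s_ne h.sq_ne).toRingHom

theorem op_smul (x : B r s) (v : M₃ h eps) :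
    op x • v = (ops h eps).repB h.r_ne h.s_ne h.sq_ne (op x) v := rfl

/-- The action of `B` is `ℂ`-linear in the evident sense. -/
theorem op_algebraMap (c : ℂ) (v : M₃ h eps) : op (algebraMap ℂ (B r s) c) • v = c • v := by
  rw [op_smul, show op (algebraMap ℂ (B r s) c) = algebraMap ℂ (B r s)ᵐᵒᵖ c from rfl,
    AlgHom.commutes, Module.algebraMap_end_apply]

theorem e_X₁ (a : ZMod (ell₃ r s)) :
    op (B.X₁ r s) • e h eps a =
      (eps.p₁ ^ 2 * eps.p₃ * eps.p₂⁻¹ * ((1 - r * s⁻¹) / (s ^ 2 * (r ^ 2 - s ^ 2))) *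
        (s ^ (2 * a.val))⁻¹) • e h eps (a + 2) := by
  rw [op_smul, Ops.repB_X₁]
  exact basisOp_bas _ a

theorem e_X₂ (a : ZMod (ell₃ r s)) :
    op (B.X₂ r s) • e h eps a = eps.p₁ • e h eps (a + 1) := by
  rw [op_smul, Ops.repB_X₂]
  exact basisOp_bas _ a

theorem e_X₃ (a : ZMod (ell₃ r s)) :
    op (B.X₃ r s) • e h eps a = ((r * s) ^ a.val * eps.p₂) • e h eps a := by
  rw [op_smul, Ops.repB_X₃]
  exact basisOp_bas _ a

theorem e_W (a : ZMod (ell₃ r s)) :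
    op (B.W r s) • e h eps a =
      (eps.p₁ * eps.p₃ * (r * s⁻¹) ^ a.val) • e h eps (a + 1) := by
  rw [op_smul, Ops.repB_W]
  exact basisOp_bas _ a

end M₃

end B2

/-!
A simple module `N` on which `X₁` is injective has `X₁` invertible, since the image of `X₁` is a
submodule. So `N` is an irreducible family of operators `x₁, x₂, x₃, w` satisfying the relations
of `B` (`exists_ops_represents`). Products are in the order of composition; thus `X₃ X₁` acts as
`z = x₁ x₃` and `X̃` as `t = x₂ w - d z`, with `d = s² (r² - s²) / (1 - r s⁻¹)`.

Everything rests on `z` and `t`. Both commute up to scalars with all four operators, `t` commutes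
with `x₂` and `w`, and `x₂ w`, `w x₂` are combinations of `t` and `z`. As `r` and `s` are roots of
unity, suitable powers of `x₁`, `x₂`, `x₃`, `w`, `z`, `t` commute with `B`. They are scalars by
Schur's lemma, which holds because `N` has countable dimension over the uncountable field `ℂ`
(`exists_eq_smul_of_simple`). Hence commuting operators of this kind have a joint eigenvector
(`Ops.IsNormal.exists_eigenvector`), which can be chosen in a prescribed invariant subspace.

There are three cases. If `t` is not injective, it vanishes; if `t` and `x₂` are injective, the
joint eigenvector is arbitrary; if `x₂` is not injective, it is taken in the kernel of `x₂`. From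
the joint eigenvector, the powers of `x₂`, of `x₁` and `x₂`, or of `x₁` and `w` produce vectors on
which `B` acts by the formulas of `M₃`, `M₁` or `M₂` (`Ops.isoTo_M₃`, `Ops.isoTo_M₁`,
`Ops.isoTo_M₂`). They are joint eigenvectors of further operators, with systems of eigenvalues
that differ by the definition of the numbers `ℓ₁, m₁, ℓ₂, m₂, ℓ`; so they are linearly independent
(`linearIndependent_of_joint_eigenvalues`), and they span `N` by simplicity.
-/

/-! ### Eigenvectors and Schur's lemma in countable dimension -/

namespace B2

open MulOpposite Polynomial

section Eigenvectors

variable {V : Type*} [AddCommGroup V] [Module ℂ V]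

/-- If a nonzero polynomial in `S` kills `v ≠ 0`, then the cyclic module `ℂ[S] v` contains an
eigenvector of `S`. -/
theorem exists_eigenvector_of_aeval_apply_eq_zero (S : Module.End ℂ V) {v : V} (hv : v ≠ 0)
    {p : ℂ[X]} (hp : p ≠ 0) (h : aeval S p v = 0) :
    ∃ (f : ℂ[X]) (κ : ℂ), aeval S f v ≠ 0 ∧ S (aeval S f v) = κ • aeval S f v := by
  induction hn : p.natDegree generalizing p with
  | zero =>
    rw [natDegree_eq_zero] at hn
    obtain ⟨a, rfl⟩ := hn
    have ha : a ≠ 0 := by rintro rfl; simp at hp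
    rw [aeval_C, Module.algebraMap_end_apply] at h
    exact absurd h (smul_ne_zero ha hv)
  | succ k ih =>
    obtain ⟨c, hc⟩ := IsAlgClosed.exists_root p (by
      rw [degree_eq_natDegree hp, hn]; exact_mod_cast k.succ_ne_zero)
    obtain ⟨g, rfl⟩ := dvd_iff_isRoot.2 hc
    have hg : g ≠ 0 := right_ne_zero_of_mul hp
    by_cases h0 : aeval S g v = 0
    · refine ih hg h0 ?_
      rw [natDegree_mul (X_sub_C_ne_zero c) hg, natDegree_X_sub_C] at hn
      omega
    · refine ⟨g, c, h0, ?_⟩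
      rw [map_mul, Module.End.mul_apply, map_sub, aeval_X, aeval_C, LinearMap.sub_apply,
        Module.algebraMap_end_apply] at h
      exact sub_eq_zero.1 h

/-- An operator with a scalar power has an eigenvector in each subspace that it preserves. The
eigenvector can be chosen in all the invariant subspaces that contain a given `v ≠ 0`. -/
theorem exists_eigenvector_of_pow_eq_smul {S : Module.End ℂ V} {K : ℕ} (hK : K ≠ 0) {c : ℂ}
    (hS : S ^ K = c • 1) {v : V} (hv : v ≠ 0) :
    ∃ (v' : V) (κ : ℂ), v' ≠ 0 ∧ S v' = κ • v' ∧
      ∀ P : Submodule ℂ V, (∀ x ∈ P, S x ∈ P) → v ∈ P → v' ∈ P := by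
  obtain ⟨f, κ, h1, h2⟩ := exists_eigenvector_of_aeval_apply_eq_zero S hv
    (X_pow_sub_C_ne_zero (Nat.pos_of_ne_zero hK) c) (by
      rw [map_sub, map_pow, aeval_X, aeval_C, hS, Algebra.algebraMap_eq_smul_one, sub_self,
        LinearMap.zero_apply])
  refine ⟨_, κ, h1, h2, fun P hP hvP => ?_⟩
  clear h1 h2
  induction f using Polynomial.induction_on with
  | C a => rw [aeval_C, Module.algebraMap_end_apply]; exact P.smul_mem _ hvP
  | add f g hf hg => rw [map_add, LinearMap.add_apply]; exact P.add_mem hf hg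
  | monomial k a ih =>
    rw [pow_succ, ← mul_assoc, mul_comm, map_mul, aeval_X, Module.End.mul_apply]
    exact hP _ ih

/-- Nonzero joint eigenvectors whose systems of eigenvalues differ are linearly independent. -/
theorem linearIndependent_of_joint_eigenvalues {G ι : Type*} (S : ι → Module.End ℂ V)
    (χ : ι → G → ℂ) (u : G → V) (hu : ∀ g, u g ≠ 0) (hS : ∀ i g, S i (u g) = χ i g • u g)
    (hχ : ∀ g g', (∀ i, χ i g = χ i g') → g = g') : LinearIndependent ℂ u := by
  classical
  rw [linearIndependent_iff']
  intro s
  induction s using Finset.induction_on with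
  | empty => simp
  | insert g₀ s hg₀ ih =>
    intro a ha
    have key : ∀ g ∈ s, a g = 0 := by
      intro g hg
      by_contra hne
      refine hg₀ ((hχ g g₀ fun i => ?_) ▸ hg)
      have h1 := congrArg (fun x => S i x - χ i g₀ • x) ha
      simp only [map_sum, map_smul, hS, map_zero, smul_zero, sub_zero, Finset.smul_sum,
        ← Finset.sum_sub_distrib] at h1
      rw [Finset.sum_insert hg₀, smul_comm, sub_self, zero_add] at h1
      have h2 := ih (fun g => a g * (χ i g - χ i g₀)) (by
        rw [← h1]
        refine Finset.sum_congr rfl fun x _ => ?_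
        module) g hg
      exact sub_eq_zero.1 ((mul_eq_zero.1 h2).resolve_left hne)
    rw [Finset.sum_insert hg₀, Finset.sum_eq_zero fun g hg => by rw [key g hg, zero_smul],
      add_zero] at ha
    intro g hg
    rcases Finset.mem_insert.1 hg with rfl | hg
    · exact (smul_eq_zero.1 ha).resolve_right (hu _)
    · exact key g hg

end Eigenvectors

section Schur

variable {R N : Type*} [Ring R] [AddCommGroup N] [Module R N] [IsSimpleModule R N] [Module ℂ N]
  [SMulCommClass R ℂ N]

/-- Schur's lemma in countable dimension: if an endomorphism `φ` of a simple module were not a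
scalar, then `φ - c` would be invertible for all `c ∈ ℂ`, and the vectors `(φ - c)⁻¹ v` would
be uncountably many linearly independent ones. -/
theorem exists_eq_smul_of_simple (hrank : Module.rank ℂ N ≤ Cardinal.aleph0)
    (φ : N →ₗ[ℂ] N) (hφ : ∀ (b : R) (v : N), φ (b • v) = b • φ v) : ∃ c : ℂ, ∀ v, φ v = c • v := by
  by_contra! hcon
  have hbij : ∀ c : ℂ, Function.Bijective fun x => φ x - c • x := by
    intro c
    let ψ : N →ₗ[R] N :=
      { toFun := fun x => φ x - c • x
        map_add' := fun x y => by rw [map_add, smul_add]; abel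
        map_smul' := fun b x => by rw [hφ, ← smul_comm b c, RingHom.id_apply, smul_sub] }
    refine (LinearMap.bijective_or_eq_zero ψ).resolve_right fun h => ?_
    obtain ⟨v, hv⟩ := hcon c
    exact hv (sub_eq_zero.1 (LinearMap.congr_fun h v))
  have hinj : ∀ (p : ℂ[X]) (v : N), v ≠ 0 → aeval φ p v = 0 → p = 0 := by
    intro p v hv hpv
    by_contra hp
    obtain ⟨f, κ, h1, h2⟩ := exists_eigenvector_of_aeval_apply_eq_zero φ hv hp hpv
    refine h1 ((hbij κ).1 ?_)
    simp [h2]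
  have := IsSimpleModule.nontrivial R N
  obtain ⟨v, hv⟩ := exists_ne (0 : N)
  choose u hu using fun c : ℂ => (hbij c).2 v
  simp only at hu
  have hu' : ∀ c, φ (u c) = v + c • u c := fun c => by rw [← hu c]; abel
  -- Multiplying a relation by `φ - c` produces multiples of `v`; hence a polynomial part `p`.
  have key : ∀ (s : Finset ℂ) (a : ℂ → ℂ) (p : ℂ[X]),
      aeval φ p v + ∑ c ∈ s, a c • u c = 0 → ∀ c ∈ s, a c = 0 := by
    classical
    intro s
    induction s using Finset.induction_on with
    | empty => simp
    | insert c₀ s hc₀ ih =>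
      intro a p h
      have hs : ∀ c ∈ s, a c = 0 := by
        intro c hc
        have h1 := ih (fun c => a c * (c - c₀))
          ((X - C c₀) * p + C (∑ c ∈ insert c₀ s, a c)) (by
            have h2 := congrArg (fun x => φ x - c₀ • x) h
            simp only [map_add, map_sum, map_smul, map_zero, smul_zero, sub_zero, smul_add,
              hu', Finset.smul_sum, Finset.sum_add_distrib] at h2
            rw [← h2, map_add, map_mul, map_sub, aeval_X, aeval_C, aeval_C, LinearMap.add_apply,
              Module.End.mul_apply, LinearMap.sub_apply, Module.algebraMap_end_apply,
              Module.algebraMap_end_apply, Finset.sum_smul, Finset.sum_insert hc₀,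
              Finset.sum_insert hc₀, Finset.sum_insert hc₀]
            have h3 : ∑ c ∈ s, (a c * (c - c₀)) • u c
                = ∑ c ∈ s, a c • c • u c - ∑ c ∈ s, c₀ • a c • u c := by
              rw [← Finset.sum_sub_distrib]
              exact Finset.sum_congr rfl fun x _ => by module
            rw [h3, smul_comm c₀ (a c₀)]
            abel) c hc
        refine (mul_eq_zero.1 h1).resolve_right (sub_ne_zero.2 ?_)
        rintro rfl
        exact hc₀ hc
      rw [Finset.sum_insert hc₀, Finset.sum_eq_zero fun c hc => by rw [hs c hc, zero_smul],
        add_zero] at h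
      have h1 := hinj ((X - C c₀) * p + C (a c₀)) v hv (by
        have h2 := congrArg (fun x => φ x - c₀ • x) h
        simp only [map_add, map_smul, map_zero, smul_zero, sub_zero, hu'] at h2
        rw [← h2, map_add, map_mul, map_sub, aeval_X, aeval_C, aeval_C, LinearMap.add_apply,
          Module.End.mul_apply, LinearMap.sub_apply, Module.algebraMap_end_apply,
          Module.algebraMap_end_apply]
        module)
      have h2 := congrArg (eval c₀) h1
      simp only [eval_add, eval_mul, eval_sub, eval_X, eval_C, sub_self, zero_mul, zero_add,
        eval_zero] at h2
      intro c hc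
      rcases Finset.mem_insert.1 hc with rfl | hc
      · exact h2
      · exact hs c hc
  have hlin : LinearIndependent ℂ u := by
    rw [linearIndependent_iff']
    intro s a ha
    exact key s a 0 (by rw [map_zero, LinearMap.zero_apply, zero_add, ha])
  have h1 := hlin.cardinal_lift_le_rank
  rw [Cardinal.mk_complex, Cardinal.lift_continuum] at h1
  have h2 := h1.trans (Cardinal.lift_le.2 hrank)
  rw [Cardinal.lift_aleph0] at h2
  exact absurd h2 (not_le.2 Cardinal.aleph0_lt_continuum)

end Schur

end B2

/-! ### Commutation up to scalars -/

namespace B2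

open MulOpposite

/-- `a` and `b` commute up to the scalar `c`: `a b = c b a`. -/
def QComm {A : Type*} [Ring A] [Algebra ℂ A] (c : ℂ) (a b : A) : Prop := a * b = c • (b * a)

namespace QComm

section

variable {A : Type*} [Ring A] [Algebra ℂ A] {a a' b b' : A} {c c' : ℂ}

theorem one_right (a : A) : QComm 1 a 1 := by simp [QComm]

theorem mul_right (h : QComm c a b) (h' : QComm c' a b') : QComm (c * c') a (b * b') := by
  unfold QComm at *
  rw [← mul_assoc, h, smul_mul_assoc, mul_assoc, h', mul_smul_comm, smul_smul, mul_assoc]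

theorem pow_right (h : QComm c a b) (k : ℕ) : QComm (c ^ k) a (b ^ k) := by
  induction k with
  | zero => simpa using one_right a
  | succ k ih => rw [pow_succ, pow_succ]; exact ih.mul_right h

theorem symm (h : QComm c a b) (hc : c ≠ 0) : QComm c⁻¹ b a := by
  unfold QComm at *
  rw [h, smul_smul, inv_mul_cancel₀ hc, one_smul]

theorem mul_left (h : QComm c a b) (h' : QComm c' a' b) : QComm (c * c') (a * a') b := by
  unfold QComm at *
  rw [mul_assoc, h', mul_smul_comm, ← mul_assoc, h, smul_mul_assoc, smul_smul, mul_assoc,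
    mul_comm c]

theorem pow_left (h : QComm c a b) (k : ℕ) : QComm (c ^ k) (a ^ k) b := by
  induction k with
  | zero => simp [QComm]
  | succ k ih => rw [pow_succ, pow_succ]; exact ih.mul_left h

theorem sub_smul_left (h : QComm c a b) (h' : QComm c a' b) (d : ℂ) :
    QComm c (a - d • a') b := by
  unfold QComm at *
  rw [sub_mul, smul_mul_assoc, h, h', mul_sub, mul_smul_comm, smul_sub, smul_comm c d]

theorem add_smul_left (h : QComm c a b) (h' : QComm c a' b) (d : ℂ) :
    QComm c (a + d • a') b := by
  unfold QComm at *
  rw [add_mul, smul_mul_assoc, h, h', mul_add, mul_smul_comm, smul_add, smul_comm c d]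

theorem smul_left (h : QComm c a b) (d : ℂ) : QComm c (d • a) b := by
  unfold QComm at *
  rw [smul_mul_assoc, h, mul_smul_comm, smul_comm]

theorem smul_right (h : QComm c a b) (d : ℂ) : QComm c a (d • b) := by
  unfold QComm at *
  rw [smul_mul_assoc, mul_smul_comm, h, smul_comm]

theorem of_eq (h : QComm c a b) (e : c = c') : QComm c' a b := e ▸ h

end

section

variable {V : Type*} [AddCommGroup V] [Module ℂ V] {a b b' : Module.End ℂ V} {c c' : ℂ}

theorem apply (h : QComm c a b) (v : V) : a (b v) = c • b (a v) := LinearMap.congr_fun h v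

theorem pow_apply (h : QComm c a b) {κ : ℂ} {v : V} (hv : a v = κ • v) (i : ℕ) :
    a ((b ^ i) v) = (c ^ i * κ) • (b ^ i) v := by
  rw [(h.pow_right i).apply, hv, map_smul, smul_smul]

/-- An eigenvector stays one under the action of operators that commute with `a` up to scalars. -/
theorem pow_pow_apply (h : QComm c a b) (h' : QComm c' a b') {κ : ℂ} {v : V} (hv : a v = κ • v)
    (i j : ℕ) : a ((b' ^ j) ((b ^ i) v)) = (c ^ i * c' ^ j * κ) • (b' ^ j) ((b ^ i) v) := by
  rw [h'.pow_apply (h.pow_apply hv i)]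
  congr 1
  ring

theorem ker_mapsTo (h : QComm c a b) : ∀ x ∈ LinearMap.ker a, b x ∈ LinearMap.ker a := by
  intro x hx
  rw [LinearMap.mem_ker] at hx ⊢
  rw [h.apply, hx, map_zero, smul_zero]

theorem eigenspace_mapsTo (h : QComm 1 a b) (κ : ℂ) :
    ∀ x ∈ Module.End.eigenspace a κ, b x ∈ Module.End.eigenspace a κ := by
  intro x hx
  rw [Module.End.mem_eigenspace_iff] at hx ⊢
  rw [h.apply, hx, map_smul, one_smul]

end

end QComm

section Powers

variable {V : Type*} [AddCommGroup V] [Module ℂ V]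

theorem pow_mod_apply {Y : Module.End ℂ V} {v : V} {n : ℕ} (hY : (Y ^ n) v = v) (k : ℕ) :
    (Y ^ (k % n)) v = (Y ^ k) v := by
  have h : ∀ j, ((Y ^ n) ^ j) v = v := by
    intro j
    induction j with
    | zero => simp
    | succ j ih => rw [pow_succ, Module.End.mul_apply, hY, ih]
  conv_rhs => rw [← Nat.mod_add_div k n, pow_add, pow_mul, Module.End.mul_apply, h]

theorem pow_val_add_one_apply {Y : Module.End ℂ V} {v : V} {n : ℕ} [NeZero n]
    (hY : (Y ^ n) v = v) (a : ZMod n) : (Y ^ (a + 1).val) v = (Y ^ (a.val + 1)) v := by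
  have h : ((a.val + 1 : ℕ) : ZMod n) = a + 1 := by simp
  rw [← h, ZMod.val_natCast, pow_mod_apply hY]

theorem pow_inv_smul_apply (S : Module.End ℂ V) {l : ℂ} (hl : l ≠ 0) {k : ℕ} {v : V}
    (hv : (S ^ k) v = l ^ k • v) : ((l⁻¹ • S) ^ k) v = v := by
  rw [smul_pow, LinearMap.smul_apply, hv, smul_smul, inv_pow, inv_mul_cancel₀ (pow_ne_zero _ hl),
    one_smul]

theorem pow_injective {S : Module.End ℂ V} (hS : ∀ v, S v = 0 → v = 0) (k : ℕ) (v : V)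
    (hv : (S ^ k) v = 0) : v = 0 := by
  induction k generalizing v with
  | zero => simpa using hv
  | succ k ih => rw [pow_succ, Module.End.mul_apply] at hv; exact hS _ (ih _ hv)

/-- An injective power of `S` has a nonzero eigenvalue, which has a root. -/
theorem exists_root_eigenvalue {S : Module.End ℂ V} (hS : ∀ v, S v = 0 → v = 0) {k : ℕ}
    (hk : k ≠ 0) {κ : ℂ} {v : V} (hv : v ≠ 0) (h : (S ^ k) v = κ • v) :
    ∃ l : ℂ, l ≠ 0 ∧ (S ^ k) v = l ^ k • v := by
  obtain ⟨l, hl⟩ := IsAlgClosed.exists_pow_nat_eq κ (Nat.pos_of_ne_zero hk)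
  refine ⟨l, ?_, by rw [h, hl]⟩
  rintro rfl
  rw [zero_pow hk] at hl
  rw [← hl, zero_smul] at h
  exact hv (pow_injective hS k v h)

end Powers

section Separation

theorem eq_one_of_pow_add {x : ℂ} (hx : x ≠ 0) {i k : ℕ} (h : x ^ (i + k) = x ^ i) : x ^ k = 1 := by
  rw [pow_add] at h
  exact mul_left_cancel₀ (pow_ne_zero i hx) (by rw [h, mul_one])

/-- The pair of powers `(xⁱ, yⁱ)` determines `i` in the stated range. -/
theorem eq_of_pow_eq_of_lt {x y : ℂ} (hx : x ≠ 0) (hy : y ≠ 0) {N i j : ℕ}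
    (hN : N = orderOf x ∨ N = 2 * orderOf x ∧ y ^ orderOf x ≠ 1) (hi : i < N) (hj : j < N)
    (h : x ^ i = x ^ j) (h' : y ^ i = y ^ j) : i = j := by
  wlog hij : i ≤ j generalizing i j
  · exact (this hj hi h.symm h'.symm (le_of_not_ge hij)).symm
  obtain ⟨k, rfl⟩ := Nat.exists_eq_add_of_le hij
  obtain ⟨a, rfl⟩ := orderOf_dvd_of_pow_eq_one (eq_one_of_pow_add hx h.symm)
  have hy1 := eq_one_of_pow_add hy h'.symm
  rcases hN with rfl | ⟨rfl, hN⟩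
  · have : a < 1 := Nat.lt_of_mul_lt_mul_left (a := orderOf x) (by omega)
    obtain rfl : a = 0 := by omega
    simp
  · have : a < 2 := Nat.lt_of_mul_lt_mul_left (a := orderOf x) (by omega)
    interval_cases a
    · simp
    · exact absurd (by simpa using hy1) hN

theorem eq_of_pow_eq_of_lt_lcm {x y : ℂ} (hx : x ≠ 0) (hy : y ≠ 0) {i j : ℕ}
    (hi : i < Nat.lcm (orderOf x) (orderOf y)) (hj : j < Nat.lcm (orderOf x) (orderOf y))
    (h : x ^ i = x ^ j) (h' : y ^ i = y ^ j) : i = j := by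
  wlog hij : i ≤ j generalizing i j
  · exact (this hj hi h.symm h'.symm (le_of_not_ge hij)).symm
  obtain ⟨k, rfl⟩ := Nat.exists_eq_add_of_le hij
  have hk := Nat.lcm_dvd (orderOf_dvd_of_pow_eq_one (eq_one_of_pow_add hx h.symm))
    (orderOf_dvd_of_pow_eq_one (eq_one_of_pow_add hy h'.symm))
  rw [Nat.eq_zero_of_dvd_of_lt hk (by omega), add_zero]

end Separation

/-! ### Operators satisfying the relations of `B` -/

namespace Ops

variable {r s : ℂ} {V : Type*} [AddCommGroup V] [Module ℂ V] (T : Ops r s V)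

/-- The action of `X₃ X₁`. -/
def z : Module.End ℂ V := T.x₁ * T.x₃

/-- The action of `X̃ = W̃ X₂ - (s² (r² - s²) / (1 - r s⁻¹)) X₃ X₁`. -/
def t : Module.End ℂ V := T.x₂ * T.w - (s ^ 2 * (r ^ 2 - s ^ 2) / (1 - r * s⁻¹)) • T.z

theorem x₂_mul_w : T.x₂ * T.w = T.t + (s ^ 2 * (r ^ 2 - s ^ 2) / (1 - r * s⁻¹)) • T.z := by
  rw [t, sub_add_cancel]

theorem w_mul_x₂ (hd : 1 - r * s⁻¹ ≠ 0) : T.w * T.x₂ =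
    T.t + (s ^ 2 * (r ^ 2 - s ^ 2) / (1 - r * s⁻¹) * (r * s⁻¹)) • T.z := by
  rw [t, T.rel_w₂, ← z]
  generalize r * s⁻¹ = q at *
  match_scalars
  · ring
  · field_simp
    ring

theorem q_x₂x₁ : QComm (s ^ 2) T.x₂ T.x₁ := T.rel₁₂

theorem q_x₃x₁ : QComm (r ^ 2 * s ^ 2) T.x₃ T.x₁ := T.rel₁₃

theorem q_x₃x₂ : QComm (r * s) T.x₃ T.x₂ := T.rel₂₃

theorem q_wx₁ : QComm (r ^ 2) T.w T.x₁ := T.rel₁w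

theorem q_x₃w : QComm (r * s) T.x₃ T.w := T.rel_w₃

theorem q_refl {A : Type*} [Ring A] [Algebra ℂ A] (a : A) : QComm 1 a a := by simp [QComm]

theorem q_zx₁ : QComm ((r * s) ^ 2) T.z T.x₁ :=
  ((q_refl T.x₁).mul_left T.q_x₃x₁).of_eq (by ring)

theorem q_tx₁ : QComm ((r * s) ^ 2) T.t T.x₁ :=
  ((T.q_x₂x₁.mul_left T.q_wx₁).of_eq (by ring)).sub_smul_left T.q_zx₁ _

section

variable (hr : r ≠ 0) (hs : s ≠ 0)
include hr hs

theorem q_zx₂ : QComm (r * s⁻¹) T.z T.x₂ :=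
  ((T.q_x₂x₁.symm (pow_ne_zero 2 hs)).mul_left T.q_x₃x₂).of_eq (by field_simp)

theorem q_zw : QComm (r⁻¹ * s) T.z T.w :=
  ((T.q_wx₁.symm (pow_ne_zero 2 hr)).mul_left T.q_x₃w).of_eq (by field_simp)

theorem q_zx₃ : QComm ((r * s) ^ 2)⁻¹ T.z T.x₃ :=
  ((T.q_x₃x₁.symm (by positivity)).mul_left (q_refl T.x₃)).of_eq (by field_simp)

theorem q_tx₃ : QComm ((r * s) ^ 2)⁻¹ T.t T.x₃ :=
  (((T.q_x₃x₂.symm (mul_ne_zero hr hs)).mul_left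
    (T.q_x₃w.symm (mul_ne_zero hr hs))).of_eq (by field_simp)).sub_smul_left (T.q_zx₃ hr hs) _

theorem q_tx₂ (hd : 1 - r * s⁻¹ ≠ 0) : QComm 1 T.t T.x₂ := by
  have h1 := congrArg (T.x₂ * ·) (T.w_mul_x₂ hd)
  have h2 := congrArg (· * T.x₂) T.x₂_mul_w
  simp only [mul_add, add_mul, smul_mul_assoc, mul_smul_comm] at h1 h2
  rw [QComm, one_smul, eq_sub_of_add_eq h2.symm, eq_sub_of_add_eq h1.symm, T.q_zx₂ hr hs,
    smul_smul, mul_assoc]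

theorem q_tw (hd : 1 - r * s⁻¹ ≠ 0) : QComm 1 T.t T.w := by
  have h1 := congrArg (T.w * ·) T.x₂_mul_w
  have h2 := congrArg (· * T.w) (T.w_mul_x₂ hd)
  simp only [mul_add, add_mul, smul_mul_assoc, mul_smul_comm] at h1 h2
  have e : r * s⁻¹ * (r⁻¹ * s) = 1 := by field_simp
  rw [QComm, one_smul, eq_sub_of_add_eq h2.symm, eq_sub_of_add_eq h1.symm, T.q_zw hr hs,
    smul_smul, mul_assoc, mul_assoc _ _ (r⁻¹ * s), e, mul_one]

/-- Although `x₂` and `w` do not commute up to a scalar, `x₂ᵏ` and `w` commute if `qᵏ = 1`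
for `q = r s⁻¹`: both `x₂ w` and `w x₂` are combinations of `t` and `z`. -/
theorem q_w_x₂_pow (hd : 1 - r * s⁻¹ ≠ 0) {k : ℕ} (hk : k ≠ 0) (hq : (r * s⁻¹) ^ k = 1) :
    QComm 1 T.w (T.x₂ ^ k) := by
  obtain ⟨k, rfl⟩ := Nat.exists_eq_add_one_of_ne_zero hk
  have h1 := (T.q_tx₂ hr hs hd).pow_right k
  have h2 := (T.q_zx₂ hr hs).pow_right k
  rw [QComm, one_pow, one_smul] at h1
  rw [QComm] at h2
  rw [QComm, one_smul, pow_succ' T.x₂ k, ← mul_assoc, T.w_mul_x₂ hd, ← pow_succ' T.x₂ k,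
    pow_succ T.x₂ k, mul_assoc, T.x₂_mul_w, add_mul, mul_add, smul_mul_assoc, mul_smul_comm, h1, h2,
    smul_smul, mul_assoc, ← pow_succ' (r * s⁻¹) k, hq, mul_one]

theorem q_x₂_w_pow (hd : 1 - r * s⁻¹ ≠ 0) {k : ℕ} (hk : k ≠ 0) (hq : (r * s⁻¹) ^ k = 1) :
    QComm 1 T.x₂ (T.w ^ k) := by
  obtain ⟨k, rfl⟩ := Nat.exists_eq_add_one_of_ne_zero hk
  have h1 := (T.q_tw hr hs hd).pow_right k
  have h2 := (T.q_zw hr hs).pow_right k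
  rw [QComm, one_pow, one_smul] at h1
  rw [QComm] at h2
  have e : (r⁻¹ * s) ^ k = r * s⁻¹ := by
    rw [show r⁻¹ * s = (r * s⁻¹)⁻¹ by field_simp, inv_pow]
    exact inv_eq_of_mul_eq_one_right (by rw [← pow_succ, hq])
  rw [QComm, one_smul, pow_succ' T.w k, ← mul_assoc, T.x₂_mul_w, ← pow_succ' T.w k,
    pow_succ T.w k, mul_assoc, T.w_mul_x₂ hd, add_mul, mul_add, smul_mul_assoc, mul_smul_comm, h1, h2,
    smul_smul, e]

end

end Ops
end B2

/-! ### Irreducible families of operators -/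

namespace B2

open MulOpposite

namespace Ops

variable {r s : ℂ} {m n : ℕ} {V : Type*} [AddCommGroup V] [Module ℂ V]

/-- No proper nonzero subspace is invariant under the four operators. -/
def IsIrred (T : Ops r s V) : Prop :=
  ∀ P : Submodule ℂ V, P ≠ ⊥ → (∀ v ∈ P, T.x₁ v ∈ P ∧ T.x₂ v ∈ P ∧ T.x₃ v ∈ P ∧ T.w v ∈ P) → P = ⊤

/-- Only scalars commute with the four operators. -/
def IsSchur (T : Ops r s V) : Prop :=
  ∀ φ : Module.End ℂ V, QComm 1 T.x₁ φ → QComm 1 T.x₂ φ → QComm 1 T.x₃ φ → QComm 1 T.w φ →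
    ∃ c : ℂ, φ = c • 1

/-- `S` commutes with each of the four operators up to a `K`-th root of unity. -/
def IsNormal (T : Ops r s V) (K : ℕ) (S : Module.End ℂ V) : Prop :=
  (∃ c : ℂ, c ^ K = 1 ∧ QComm c T.x₁ S) ∧ (∃ c : ℂ, c ^ K = 1 ∧ QComm c T.x₂ S) ∧
    (∃ c : ℂ, c ^ K = 1 ∧ QComm c T.x₃ S) ∧ (∃ c : ℂ, c ^ K = 1 ∧ QComm c T.w S)

/-- The two families of operators are isomorphic. -/
def IsoTo {W : Type*} [AddCommGroup W] [Module ℂ W] (S : Ops r s W) (T : Ops r s V) : Prop :=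
  ∃ f : W ≃ₗ[ℂ] V, ∀ v, f (S.x₁ v) = T.x₁ (f v) ∧ f (S.x₂ v) = T.x₂ (f v) ∧
    f (S.x₃ v) = T.x₃ (f v) ∧ f (S.w v) = T.w (f v)

variable {T : Ops r s V} {K : ℕ}

theorem IsNormal.mul {S S' : Module.End ℂ V} (hS : T.IsNormal K S) (hS' : T.IsNormal K S') :
    T.IsNormal K (S * S') := by
  obtain ⟨⟨c₁, e₁, h₁⟩, ⟨c₂, e₂, h₂⟩, ⟨c₃, e₃, h₃⟩, ⟨c₄, e₄, h₄⟩⟩ := hS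
  obtain ⟨⟨d₁, e₁', h₁'⟩, ⟨d₂, e₂', h₂'⟩, ⟨d₃, e₃', h₃'⟩, ⟨d₄, e₄', h₄'⟩⟩ := hS'
  exact ⟨⟨_, by rw [mul_pow, e₁, e₁', one_mul], h₁.mul_right h₁'⟩,
    ⟨_, by rw [mul_pow, e₂, e₂', one_mul], h₂.mul_right h₂'⟩,
    ⟨_, by rw [mul_pow, e₃, e₃', one_mul], h₃.mul_right h₃'⟩,
    ⟨_, by rw [mul_pow, e₄, e₄', one_mul], h₄.mul_right h₄'⟩⟩

theorem IsNormal.pow {S : Module.End ℂ V} (hS : T.IsNormal K S) (k : ℕ) :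
    T.IsNormal K (S ^ k) := by
  induction k with
  | zero =>
    rw [pow_zero]
    exact ⟨⟨1, one_pow _, QComm.one_right _⟩, ⟨1, one_pow _, QComm.one_right _⟩,
      ⟨1, one_pow _, QComm.one_right _⟩, ⟨1, one_pow _, QComm.one_right _⟩⟩
  | succ k ih => rw [pow_succ]; exact ih.mul hS

theorem IsNormal.exists_pow_eq_smul {S : Module.End ℂ V} (hS : T.IsNormal K S) (hT : T.IsSchur) :
    ∃ c : ℂ, S ^ K = c • 1 := by
  obtain ⟨⟨c₁, e₁, h₁⟩, ⟨c₂, e₂, h₂⟩, ⟨c₃, e₃, h₃⟩, ⟨c₄, e₄, h₄⟩⟩ := hS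
  exact hT _ ((h₁.pow_right K).of_eq e₁) ((h₂.pow_right K).of_eq e₂) ((h₃.pow_right K).of_eq e₃)
    ((h₄.pow_right K).of_eq e₄)

/-- Normal operators have eigenvectors in all invariant subspaces. -/
theorem IsNormal.exists_eigenvector {S : Module.End ℂ V} (hS : T.IsNormal K S) (hT : T.IsSchur)
    (hK : K ≠ 0) {v : V} (hv : v ≠ 0) : ∃ (v' : V) (κ : ℂ), v' ≠ 0 ∧ S v' = κ • v' ∧
      ∀ P : Submodule ℂ V, (∀ x ∈ P, S x ∈ P) → v ∈ P → v' ∈ P := by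
  obtain ⟨c, hc⟩ := hS.exists_pow_eq_smul hT
  exact exists_eigenvector_of_pow_eq_smul hK hc hv

section Normal

variable (h : Standing r s m n) (T)
include h

theorem isNormal_x₁ : T.IsNormal (m * n) T.x₁ := by
  have h1 := h.r_pow
  have h2 := h.s_pow
  exact ⟨⟨_, one_pow _, q_refl T.x₁⟩,
    ⟨_, by rw [pow_right_comm, h2, one_pow], T.q_x₂x₁⟩,
    ⟨_, by rw [mul_pow, pow_right_comm, h1, pow_right_comm, h2]; simp, T.q_x₃x₁⟩,
    ⟨_, by rw [pow_right_comm, h1, one_pow], T.q_wx₁⟩⟩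

theorem isNormal_x₃ : T.IsNormal (m * n) T.x₃ := by
  have h1 := h.r_pow
  have h2 := h.s_pow
  have hr := h.r_ne
  have hs := h.s_ne
  have h3 : (r * s)⁻¹ ^ (m * n) = 1 := by rw [inv_pow, mul_pow, h1, h2]; simp
  exact ⟨⟨_, by rw [inv_pow, mul_pow, pow_right_comm, h1, pow_right_comm, h2]; simp,
      T.q_x₃x₁.symm (by positivity)⟩,
    ⟨_, h3, T.q_x₃x₂.symm (mul_ne_zero hr hs)⟩,
    ⟨_, one_pow _, q_refl T.x₃⟩,
    ⟨_, h3, T.q_x₃w.symm (mul_ne_zero hr hs)⟩⟩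

theorem isNormal_z : T.IsNormal (m * n) T.z := (T.isNormal_x₁ h).mul (T.isNormal_x₃ h)

theorem isNormal_t : T.IsNormal (m * n) T.t := by
  have h1 := h.r_pow
  have h2 := h.s_pow
  have hr := h.r_ne
  have hs := h.s_ne
  have h3 : ((r * s) ^ 2)⁻¹ ^ (m * n) = 1 := by
    rw [inv_pow, pow_right_comm, mul_pow, h1, h2]; simp
  exact ⟨⟨_, h3, T.q_tx₁.symm (by positivity)⟩,
    ⟨_, by simp, (T.q_tx₂ hr hs h.div_ne).symm one_ne_zero⟩,
    ⟨_, by rw [inv_pow, h3, inv_one], (T.q_tx₃ hr hs).symm (by positivity)⟩,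
    ⟨_, by simp, (T.q_tw hr hs h.div_ne).symm one_ne_zero⟩⟩

theorem isNormal_x₂_pow {k : ℕ} {c : ℂ} (hc : c ^ (m * n) = 1) (hk : QComm c T.w (T.x₂ ^ k)) :
    T.IsNormal (m * n) (T.x₂ ^ k) := by
  have h1 := h.r_pow
  have h2 := h.s_pow
  exact ⟨⟨_, by rw [pow_right_comm, inv_pow, pow_right_comm s, h2]; simp,
      (T.q_x₂x₁.symm (pow_ne_zero 2 h.s_ne)).pow_right k⟩,
    ⟨_, by simp, (q_refl T.x₂).pow_right k⟩,
    ⟨_, by rw [pow_right_comm, mul_pow, h1, h2]; simp, T.q_x₃x₂.pow_right k⟩,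
    ⟨_, hc, hk⟩⟩

theorem isNormal_w_pow {k : ℕ} {c : ℂ} (hc : c ^ (m * n) = 1) (hk : QComm c T.x₂ (T.w ^ k)) :
    T.IsNormal (m * n) (T.w ^ k) := by
  have h1 := h.r_pow
  have h2 := h.s_pow
  exact ⟨⟨_, by rw [pow_right_comm, inv_pow, pow_right_comm r, h1]; simp,
      (T.q_wx₁.symm (pow_ne_zero 2 h.r_ne)).pow_right k⟩,
    ⟨_, hc, hk⟩,
    ⟨_, by rw [pow_right_comm, mul_pow, h1, h2]; simp, T.q_x₃w.pow_right k⟩,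
    ⟨_, by simp, (q_refl T.w).pow_right k⟩⟩

end Normal

theorem x₁_injective (T : Ops r s V) (v : V) (hv : T.x₁ v = 0) : v = 0 := by
  have h := LinearMap.congr_fun T.inv₁ v
  rw [Module.End.mul_apply, hv, map_zero] at h
  exact h.symm

theorem z_injective (hx₃ : ∀ v, T.x₃ v = 0 → v = 0) (v : V) (hv : T.z v = 0) : v = 0 :=
  hx₃ _ (T.x₁_injective _ hv)

/-- A family of linearly independent vectors in `V` on which `T` acts by the formulas of `S`
identifies `S` with `T`, if `T` is irreducible. -/
theorem IsIrred.isoTo (hT : T.IsIrred) {G : Type*} [Nonempty G] (S : Ops r s (G →₀ ℂ)) (u : G → V)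
    (hu : LinearIndependent ℂ u)
    (h₁ : ∀ g, Finsupp.linearCombination ℂ u (S.x₁ (bas g)) = T.x₁ (u g))
    (h₂ : ∀ g, Finsupp.linearCombination ℂ u (S.x₂ (bas g)) = T.x₂ (u g))
    (h₃ : ∀ g, Finsupp.linearCombination ℂ u (S.x₃ (bas g)) = T.x₃ (u g))
    (h₄ : ∀ g, Finsupp.linearCombination ℂ u (S.w (bas g)) = T.w (u g)) : S.IsoTo T := by
  set f := Finsupp.linearCombination ℂ u with hf
  have ext : ∀ {A : Module.End ℂ (G →₀ ℂ)} {B : Module.End ℂ V},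
      (∀ g, f (A (bas g)) = B (u g)) → ∀ v, f (A v) = B (f v) := by
    intro A B hAB
    refine LinearMap.congr_fun (f := f ∘ₗ A) (g := B ∘ₗ f) ?_
    refine Finsupp.lhom_ext' fun g => LinearMap.ext_ring ?_
    simpa [hf] using hAB g
  have h₁ := ext h₁
  have h₂ := ext h₂
  have h₃ := ext h₃
  have h₄ := ext h₄
  have hsurj : LinearMap.range f = ⊤ := by
    refine hT _ ?_ ?_
    · intro hbot
      obtain ⟨g⟩ := ‹Nonempty G›
      have h0 : u g ∈ LinearMap.range f := ⟨bas g, by simp [hf]⟩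
      rw [hbot, Submodule.mem_bot] at h0
      exact hu.ne_zero g h0
    · rintro _ ⟨v, rfl⟩
      exact ⟨⟨_, h₁ v⟩, ⟨_, h₂ v⟩, ⟨_, h₃ v⟩, ⟨_, h₄ v⟩⟩
  exact ⟨LinearEquiv.ofBijective f ⟨hu, LinearMap.range_eq_top.1 hsurj⟩,
    fun v => ⟨h₁ v, h₂ v, h₃ v, h₄ v⟩⟩

end Ops

theorem linearCombination_smul_bas {V G : Type*} [AddCommGroup V] [Module ℂ V] (u : G → V) (c : ℂ)
    (g : G) : Finsupp.linearCombination ℂ u (c • bas g) = c • u g := by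
  rw [map_smul, Finsupp.linearCombination_single, one_smul]

theorem Standing.d_ne {r s : ℂ} {m n : ℕ} (h : Standing r s m n) :
    s ^ 2 * (r ^ 2 - s ^ 2) / (1 - r * s⁻¹) ≠ 0 :=
  div_ne_zero (mul_ne_zero (pow_ne_zero 2 h.s_ne) (sub_ne_zero.2 h.sq_ne)) h.div_ne

/-! ### The modules on which `X̃` is not injective -/

namespace Ops

variable {r s : ℂ} {m n : ℕ} {V : Type*} [AddCommGroup V] [Module ℂ V] {T : Ops r s V}

/-- A joint eigenvector of `x₃`, of a power of `x₂` and of `w` relative to `x₂` generates a copy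
of `M₃(ε)`. -/
theorem isoTo_M₃ (h : Standing r s m n) (hT : T.IsIrred) (ht : T.t = 0) (eps : Param₃) {v : V}
    (hv : v ≠ 0) (hx₂ : ∀ v, T.x₂ v = 0 → v = 0) (hv₁ : (T.x₂ ^ ell₃ r s) v = eps.p₁ ^ ell₃ r s • v)
    (hv₂ : T.x₃ v = eps.p₂ • v) (hv₃ : T.w v = eps.p₃ • T.x₂ v) :
    (M₃.ops h eps).IsoTo T := by
  have : NeZero (ell₃ r s) := ⟨h.ell₃_ne⟩
  have hr := h.r_ne
  have hs := h.s_ne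
  have hd := h.d_ne
  have hp₁ := eps.p₁_ne
  have hp₂ := eps.p₂_ne
  have hp₃ := eps.p₃_ne
  have hx₂w := T.x₂_mul_w
  have hwx₂ := T.w_mul_x₂ h.div_ne
  rw [ht, zero_add] at hx₂w hwx₂
  have q_wx₂ : QComm (r * s⁻¹) T.w T.x₂ := by rw [QComm, hx₂w, hwx₂, smul_smul, mul_comm]
  set Y : Module.End ℂ V := eps.p₁⁻¹ • T.x₂ with hY
  have hYx : ∀ x, T.x₂ x = eps.p₁ • Y x := fun x => by
    rw [hY, LinearMap.smul_apply, smul_smul, mul_inv_cancel₀ hp₁, one_smul]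
  have hYper : (Y ^ ell₃ r s) v = v := pow_inv_smul_apply _ hp₁ hv₁
  let u : ZMod (ell₃ r s) → V := fun a => (Y ^ a.val) v
  have hu : ∀ a, u a = (Y ^ a.val) v := fun _ => rfl
  have hu1 : ∀ a, u (a + 1) = Y (u a) := fun a => by
    rw [hu, pow_val_add_one_apply hYper, pow_succ', Module.End.mul_apply]
  have u₂ : ∀ a, T.x₂ (u a) = eps.p₁ • u (a + 1) := fun a => by rw [hu1, hYx]
  have u₃ : ∀ a, T.x₃ (u a) = ((r * s) ^ a.val * eps.p₂) • u a := fun a =>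
    (T.q_x₃x₂.smul_right eps.p₁⁻¹).pow_apply hv₂ a.val
  have u₄ : ∀ a, T.w (u a) = (eps.p₁ * eps.p₃ * (r * s⁻¹) ^ a.val) • u (a + 1) := fun a => by
    rw [hu1, hu, ((q_wx₂.smul_right eps.p₁⁻¹).pow_right a.val).apply, hv₃, hYx,
      ← Module.End.mul_apply Y, ← pow_succ', pow_succ, Module.End.mul_apply]
    simp only [map_smul, smul_smul]
    congr 1
    ring
  have u₁ : ∀ a, T.x₁ (u a) = (eps.p₁ ^ 2 * eps.p₃ * eps.p₂⁻¹ *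
      ((1 - r * s⁻¹) / (s ^ 2 * (r ^ 2 - s ^ 2))) * (s ^ (2 * a.val))⁻¹) • u (a + 2) := fun a => by
    have h1 := LinearMap.congr_fun hx₂w (u a)
    rw [Module.End.mul_apply, u₄, map_smul, u₂, LinearMap.smul_apply, z, Module.End.mul_apply, u₃,
      map_smul, add_assoc, one_add_one_eq_two, smul_smul, smul_smul] at h1
    have hrs : (r * s) ^ a.val ≠ 0 := pow_ne_zero _ (mul_ne_zero hr hs)
    have e : (r * s⁻¹) ^ a.val = (r * s) ^ a.val * (s ^ (2 * a.val))⁻¹ := by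
      rw [pow_mul, ← inv_pow, ← mul_pow]
      congr 1
      field_simp
    rw [← inv_smul_smul₀ (mul_ne_zero hd (mul_ne_zero hrs hp₂)) (T.x₁ (u a)), ← h1, smul_smul, e]
    congr 1
    have hq₁ := h.div_ne
    have hq₂ := sub_ne_zero.2 h.sq_ne
    clear h1 hd hx₂w hwx₂ e
    generalize (r * s) ^ a.val = R at *
    generalize s ^ (2 * a.val) = R' at *
    generalize 1 - r * s⁻¹ = R₁ at *
    generalize r ^ 2 - s ^ 2 = R₂ at *
    field_simp
  have hY0 : ∀ x, Y x = 0 → x = 0 := fun x hx => hx₂ x (by rw [hYx, hx, smul_zero])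
  have hlin : LinearIndependent ℂ u := by
    -- `u a` is an eigenvector of `x₃` and of `x₂ ^ (ℓ - 1) * w`.
    refine linearIndependent_of_joint_eigenvalues (ι := Bool)
      (fun i => bif i then T.x₃ else Y ^ (ell₃ r s - 1) * T.w)
      (fun i a => bif i then (r * s) ^ a.val * eps.p₂
        else (r * s⁻¹) ^ a.val * (eps.p₁ * eps.p₃)) u
      (fun a h0 => hv (pow_injective hY0 _ _ h0)) ?_ ?_
    · rintro (_ | _) a
      · have h1 : QComm (r * s⁻¹) (Y ^ (ell₃ r s - 1) * T.w) Y :=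
          (((q_refl Y).pow_left (ell₃ r s - 1)).mul_left (q_wx₂.smul_right eps.p₁⁻¹)).of_eq
            (by simp)
        refine h1.pow_apply (κ := eps.p₁ * eps.p₃) ?_ a.val
        rw [Module.End.mul_apply, hv₃, hYx, map_smul, map_smul, ← Module.End.mul_apply,
          pow_sub_one_mul h.ell₃_ne, hYper, smul_smul, mul_comm]
      · exact u₃ a
    · intro a b hab
      have h1 := mul_right_cancel₀ hp₂ (hab true)
      have h2 := mul_right_cancel₀ (mul_ne_zero hp₁ hp₃) (hab false)
      exact ZMod.val_injective _ (eq_of_pow_eq_of_lt_lcm (mul_ne_zero hr hs)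
        (mul_ne_zero hr (inv_ne_zero hs)) (ZMod.val_lt a) (ZMod.val_lt b) h1 h2)
  refine hT.isoTo (M₃.ops h eps) u hlin (fun a => ?_) (fun a => ?_) (fun a => ?_) (fun a => ?_)
  · exact (congrArg _ (basisOp_bas _ a)).trans ((linearCombination_smul_bas _ _ _).trans (u₁ a).symm)
  · exact (congrArg _ (basisOp_bas _ a)).trans ((linearCombination_smul_bas _ _ _).trans (u₂ a).symm)
  · exact (congrArg _ (basisOp_bas _ a)).trans ((linearCombination_smul_bas _ _ _).trans (u₃ a).symm)
  · exact (congrArg _ (basisOp_bas _ a)).trans ((linearCombination_smul_bas _ _ _).trans (u₄ a).symm)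

/-- If `t` is not injective, then it vanishes, `x₂` and `w` commute up to a scalar, and both are
injective because their product is a nonzero multiple of `z`. -/
theorem exists_isoTo_M₃ (h : Standing r s m n) (hT : T.IsIrred) (hS : T.IsSchur)
    (hx₃ : ∀ v, T.x₃ v = 0 → v = 0) {v : V} (hv : v ≠ 0) (htv : T.t v = 0) :
    ∃ eps : Param₃, (M₃.ops h eps).IsoTo T := by
  have hr := h.r_ne
  have hs := h.s_ne
  have hd := h.d_ne
  have hq0 : r * s⁻¹ ≠ 0 := mul_ne_zero hr (inv_ne_zero hs)
  have hK : m * n ≠ 0 := (Nat.mul_pos h.m_pos h.n_pos).ne'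
  -- The kernel of `t` is invariant, because `t` commutes with all operators up to scalars.
  have ht : T.t = 0 := by
    rw [← LinearMap.ker_eq_top]
    refine hT _ ((Submodule.ne_bot_iff _).2 ⟨v, htv, hv⟩) fun x hx => ?_
    exact ⟨T.q_tx₁.ker_mapsTo x hx, (T.q_tx₂ hr hs h.div_ne).ker_mapsTo x hx,
      (T.q_tx₃ hr hs).ker_mapsTo x hx, (T.q_tw hr hs h.div_ne).ker_mapsTo x hx⟩
  have hx₂w := T.x₂_mul_w
  have hwx₂ := T.w_mul_x₂ h.div_ne
  rw [ht, zero_add] at hx₂w hwx₂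
  have q_wx₂ : QComm (r * s⁻¹) T.w T.x₂ := by rw [QComm, hx₂w, hwx₂, smul_smul, mul_comm]
  have hqK : (r * s⁻¹) ^ (m * n) = 1 := by rw [mul_pow, inv_pow, h.r_pow, h.s_pow]; simp
  have hx₂ : ∀ x, T.x₂ x = 0 → x = 0 := fun x hx => by
    have h1 := LinearMap.congr_fun hwx₂ x
    rw [Module.End.mul_apply, hx, map_zero, LinearMap.smul_apply] at h1
    exact z_injective hx₃ x ((smul_eq_zero.1 h1.symm).resolve_left (mul_ne_zero hd hq0))
  have hw : ∀ x, T.w x = 0 → x = 0 := fun x hx => by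
    have h1 := LinearMap.congr_fun hx₂w x
    rw [Module.End.mul_apply, hx, map_zero, LinearMap.smul_apply] at h1
    exact z_injective hx₃ x ((smul_eq_zero.1 h1.symm).resolve_left hd)
  have n₂ : T.IsNormal (m * n) T.x₂ := by
    simpa using T.isNormal_x₂_pow h (k := 1) hqK (by simpa using q_wx₂)
  have n₄ : T.IsNormal (m * n) T.w := by
    simpa using T.isNormal_w_pow h (k := 1) (c := (r * s⁻¹)⁻¹) (by rw [inv_pow, hqK, inv_one])
      (by simpa using q_wx₂.symm hq0)
  set L := ell₃ r s with hL
  have hper : (r * s) ^ L = 1 := h.per₃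
  have hper' : (r * s⁻¹) ^ L = 1 := h.per₃'
  have hL1 : L - 1 + 1 = L := Nat.succ_pred h.ell₃_ne
  -- A joint eigenvector of `x₃`, `x₂ ^ ℓ` and `x₂ ^ (ℓ - 1) * w`, which commute.
  obtain ⟨v₁, κ₁, hv₁, e₁, -⟩ := (T.isNormal_x₃ h).exists_eigenvector hS hK hv
  obtain ⟨v₂, κ₂, hv₂, e₂, i₂⟩ := (n₂.pow L).exists_eigenvector hS hK hv₁
  obtain ⟨v₃, κ₃, hv₃, e₃, i₃⟩ := ((n₂.pow (L - 1)).mul n₄).exists_eigenvector hS hK hv₂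
  have c₁ : QComm 1 T.x₃ (T.x₂ ^ L) := (T.q_x₃x₂.pow_right L).of_eq hper
  have c₂ : QComm 1 T.x₃ (T.x₂ ^ (L - 1) * T.w) :=
    ((T.q_x₃x₂.pow_right (L - 1)).mul_right T.q_x₃w).of_eq (by rw [← pow_succ, hL1, hper])
  have c₃' : QComm 1 (T.x₂ ^ L) T.w :=
    ((q_wx₂.symm hq0).pow_left L).of_eq (by rw [inv_pow, hper', inv_one])
  have c₃ : QComm 1 (T.x₂ ^ L) (T.x₂ ^ (L - 1) * T.w) :=
    (((q_refl T.x₂).pow_left L).pow_right (L - 1)).mul_right c₃' |>.of_eq (by simp)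
  have e₁' : T.x₃ v₃ = κ₁ • v₃ := Module.End.mem_eigenspace_iff.1 <|
    i₃ _ (c₂.eigenspace_mapsTo κ₁) <| i₂ _ (c₁.eigenspace_mapsTo κ₁) <|
    Module.End.mem_eigenspace_iff.2 e₁
  have e₂' : (T.x₂ ^ L) v₃ = κ₂ • v₃ := Module.End.mem_eigenspace_iff.1 <|
    i₃ _ (c₃.eigenspace_mapsTo κ₂) <| Module.End.mem_eigenspace_iff.2 e₂
  obtain ⟨l, hl, e₂''⟩ := exists_root_eigenvalue hx₂ h.ell₃_ne hv₃ e₂'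
  have hκ₁ : κ₁ ≠ 0 := by
    rintro rfl
    exact hv₃ (hx₃ _ (by rw [e₁', zero_smul]))
  have hκ₃ : κ₃ ≠ 0 := by
    rintro rfl
    rw [zero_smul, Module.End.mul_apply] at e₃
    exact hv₃ (hw _ (pow_injective hx₂ _ _ e₃))
  have hlL : l ^ L ≠ 0 := pow_ne_zero _ hl
  have hwv : T.w v₃ = (κ₃ * (l ^ L)⁻¹) • T.x₂ v₃ := by
    have h1 := congrArg T.x₂ e₃
    rw [← Module.End.mul_apply, ← mul_assoc, ← pow_succ', hL1, Module.End.mul_apply, c₃'.apply,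
      one_smul, e₂'', map_smul, map_smul] at h1
    rw [mul_comm, mul_smul, ← h1, smul_smul, inv_mul_cancel₀ hlL, one_smul]
  exact ⟨⟨l, κ₁, κ₃ * (l ^ L)⁻¹, hl, hκ₁, mul_ne_zero hκ₃ (inv_ne_zero hlL)⟩,
    isoTo_M₃ h hT ht _ hv₃ hx₂ e₂'' e₁' hwv⟩

end Ops
end B2

/-! ### The modules on which `X̃` and `X₂` are injective -/

namespace B2

open MulOpposite

/-- With `Yᵏ v = v`, the vectors `Sʲ Yᵃ v` can be indexed by `a ∈ ℤ/k`, and `Y` shifts `a` up to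
a scalar. -/
theorem QComm.apply_pow_val_add_one {V : Type*} [AddCommGroup V] [Module ℂ V] {c : ℂ}
    {S Y : Module.End ℂ V} (h : QComm c S Y) {k : ℕ} [NeZero k] {v : V} (hY : (Y ^ k) v = v)
    (a : ZMod k) (j : ℕ) :
    (S ^ j) ((Y ^ (a + 1).val) v) = c ^ j • Y ((S ^ j) ((Y ^ a.val) v)) := by
  rw [pow_val_add_one_apply hY, pow_succ', Module.End.mul_apply, (h.pow_left j).apply]

/-- The order `ℓ₁` in the form needed to separate eigenvalues by the powers of `(r s)²` and
`s^(2 m₁)`. -/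
theorem Standing.ell₁_eq {r s : ℂ} {m n : ℕ} (_h : Standing r s m n) :
    ell₁ r s = orderOf ((r * s) ^ 2) ∨ ell₁ r s = 2 * orderOf ((r * s) ^ 2) ∧
      ((s ^ 2) ^ m₁ r s) ^ orderOf ((r * s) ^ 2) ≠ 1 := by
  rw [mul_pow, ← pow_mul]
  unfold ell₁ m₁
  split_ifs with hd
  · exact Or.inl rfl
  · exact Or.inr ⟨rfl, fun e => hd (orderOf_dvd_of_pow_eq_one (by rw [mul_comm]; exact e))⟩

/-- The order `m₂` in the form needed to separate eigenvalues by the powers of `r s⁻¹` and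
`r^(2 ℓ₂)`; the first alternative covers `μ₃ = 0`. -/
theorem Standing.m₂_eq {r s : ℂ} {m n : ℕ} (_h : Standing r s m n) (μ₃ : ℂ) :
    m₂ r s μ₃ = orderOf (r * s⁻¹) ∨ m₂ r s μ₃ = 2 * orderOf (r * s⁻¹) ∧
      ((r ^ 2) ^ ell₂ r s) ^ orderOf (r * s⁻¹) ≠ 1 := by
  rw [← pow_mul]
  unfold m₂ ell₂
  split_ifs with hd
  · exact Or.inl rfl
  · exact Or.inr ⟨rfl, fun e => hd (Or.inl (orderOf_dvd_of_pow_eq_one e))⟩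

namespace Ops

variable {r s : ℂ} {m n : ℕ} {V : Type*} [AddCommGroup V] [Module ℂ V] {T : Ops r s V}

/-- A joint eigenvector of powers of `x₁` and `x₂` and of `z` and `t` generates a copy of
`M₁(λ)`. -/
theorem isoTo_M₁ (h : Standing r s m n) (hT : T.IsIrred) (lam : Param₁ r s) {v : V}
    (hv : v ≠ 0) (hx₂ : ∀ v, T.x₂ v = 0 → v = 0)
    (hv₁ : (T.x₁ ^ ell₁ r s) v = lam.l₁ ^ ell₁ r s • v)
    (hv₂ : (T.x₂ ^ m₁ r s) v = lam.l₂ ^ m₁ r s • v) (hv₃ : T.z v = lam.l₃ • v)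
    (hv₄ : T.t v =
      (lam.l₄ - s ^ 2 * (r ^ 2 - s ^ 2) / (1 - r * s⁻¹) * lam.l₃) • v) :
    (M₁.ops h lam).IsoTo T := by
  have : NeZero (ell₁ r s) := ⟨h.ell₁_ne⟩
  have : NeZero (m₁ r s) := ⟨h.m₁_ne⟩
  have hr := h.r_ne
  have hs := h.s_ne
  have hl₁ := lam.l₁_ne
  have hl₂ := lam.l₂_ne
  have hl₃ := lam.l₃_ne
  have hl₄ := sub_ne_zero.2 lam.l₄_ne
  set Y₁ : Module.End ℂ V := lam.l₁⁻¹ • T.x₁ with hY₁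
  set Y₂ : Module.End ℂ V := lam.l₂⁻¹ • T.x₂ with hY₂
  have hYx₁ : ∀ x, T.x₁ x = lam.l₁ • Y₁ x := fun x => by
    rw [hY₁, LinearMap.smul_apply, smul_smul, mul_inv_cancel₀ hl₁, one_smul]
  have hYx₂ : ∀ x, T.x₂ x = lam.l₂ • Y₂ x := fun x => by
    rw [hY₂, LinearMap.smul_apply, smul_smul, mul_inv_cancel₀ hl₂, one_smul]
  have hper₁ : (Y₁ ^ ell₁ r s) v = v := pow_inv_smul_apply _ hl₁ hv₁
  have hper₂ : (Y₂ ^ m₁ r s) v = v := pow_inv_smul_apply _ hl₂ hv₂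
  have hY₁0 : ∀ x, Y₁ x = 0 → x = 0 := fun x hx => T.x₁_injective x (by rw [hYx₁, hx, smul_zero])
  have hY₂0 : ∀ x, Y₂ x = 0 → x = 0 := fun x hx => hx₂ x (by rw [hYx₂, hx, smul_zero])
  have qY : QComm (s ^ 2) Y₂ Y₁ := (T.q_x₂x₁.smul_left _).smul_right _
  let u : ZMod (ell₁ r s) × ZMod (m₁ r s) → V := fun g => (Y₂ ^ g.2.val) ((Y₁ ^ g.1.val) v)
  have hu : ∀ a b, u (a, b) = (Y₂ ^ b.val) ((Y₁ ^ a.val) v) := fun _ _ => rfl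
  have hu1 : ∀ a b, u (a + 1, b) = (s ^ 2) ^ b.val • Y₁ (u (a, b)) := fun a b =>
    qY.apply_pow_val_add_one hper₁ a b.val
  have hs2 : ∀ k : ℕ, (s ^ 2) ^ k ≠ 0 := fun k => pow_ne_zero _ (pow_ne_zero 2 hs)
  have uz : ∀ a b, T.z (u (a, b)) =
      (((r * s) ^ 2) ^ a.val * (r * s⁻¹) ^ b.val * lam.l₃) • u (a, b) := fun a b =>
    (T.q_zx₁.smul_right _).pow_pow_apply ((T.q_zx₂ hr hs).smul_right _) hv₃ a.val b.val
  have ut : ∀ a b, T.t (u (a, b)) = (((r * s) ^ 2) ^ a.val *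
      (lam.l₄ - s ^ 2 * (r ^ 2 - s ^ 2) / (1 - r * s⁻¹) * lam.l₃)) • u (a, b) := fun a b => by
    have h1 := (T.q_tx₁.smul_right lam.l₁⁻¹).pow_pow_apply
      ((T.q_tx₂ hr hs h.div_ne).smul_right lam.l₂⁻¹) hv₄ a.val b.val
    rwa [one_pow, mul_one] at h1
  have u₁ : ∀ a b, T.x₁ (u (a, b)) = ((s ^ (2 * b.val))⁻¹ * lam.l₁) • u (a + 1, b) := fun a b => by
    rw [hu1, hYx₁, smul_smul, pow_mul, mul_right_comm, inv_mul_cancel₀ (hs2 _), one_mul]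
  have u₂ : ∀ a b, b.val = m₁ r s - 1 →
      T.x₂ (u (a, b)) = (s ^ (2 * a.val * m₁ r s) * lam.l₂) • u (a, 0) := fun a b hb => by
    rw [hYx₂, hu, hu, ZMod.val_zero, pow_zero, Module.End.one_apply, ← Module.End.mul_apply,
      ← pow_succ', hb, Nat.sub_add_cancel (Nat.pos_of_ne_zero h.m₁_ne),
      (qY.pow_left (m₁ r s)).pow_apply (κ := 1) (by rw [hper₂, one_smul]), smul_smul]
    congr 1
    rw [← pow_mul, ← pow_mul]
    ring
  have u₂' : ∀ a b, b.val ≠ m₁ r s - 1 → T.x₂ (u (a, b)) = lam.l₂ • u (a, b + 1) :=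
    fun a b hb => by
      rw [hYx₂, hu, hu, val_add_one_of hb, pow_succ', Module.End.mul_apply]
  have u₃ : ∀ a b, T.x₃ (u (a, b)) =
      ((r * s) ^ (2 * a.val + b.val) * lam.l₁⁻¹ * lam.l₃) • u (a - 1, b) := fun a b => by
    obtain ⟨a, rfl⟩ : ∃ a', a = a' + 1 := ⟨a - 1, by simp⟩
    rw [add_sub_cancel_right, hu1, map_smul, hY₁, LinearMap.smul_apply, map_smul, T.q_x₃x₁.apply,
      ← Module.End.mul_apply, ← z, uz, smul_smul, smul_smul, smul_smul, pow_add, pow_mul,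
      pv_add_one h.per₁]
    congr 1
    have e : (r * s) ^ b.val = (s ^ 2) ^ b.val * (r * s⁻¹) ^ b.val := by
      rw [← mul_pow]
      congr 1
      field_simp
    rw [e]
    ring
  have uwx : ∀ a b, T.w (T.x₂ (u (a, b))) = (((r * s) ^ 2) ^ a.val * (lam.l₄ -
      s ^ 2 * (r ^ 2 - s ^ 2) * ((1 - (r * s⁻¹) ^ (b.val + 1)) / (1 - r * s⁻¹)) * lam.l₃)) •
      u (a, b) := fun a b => by
    rw [← Module.End.mul_apply, T.w_mul_x₂ h.div_ne, LinearMap.add_apply, ut, LinearMap.smul_apply,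
      uz, smul_smul, ← add_smul]
    congr 1
    ring
  have u₄ : ∀ a, T.w (u (a, 0)) = (lam.l₂⁻¹ * lam.l₄ * r ^ (2 * a.val) *
      (s ^ (2 * a.val * (m₁ r s - 1)))⁻¹) • u (a, ((m₁ r s - 1 : ℕ) : ZMod (m₁ r s))) :=
    fun a => by
      have h1 := congrArg T.w (u₂ a (-1) val_neg_one')
      have hne : s ^ (2 * a.val * m₁ r s) * lam.l₂ ≠ 0 := mul_ne_zero (pow_ne_zero _ hs) hl₂
      have hq : (r * s⁻¹) ^ m₁ r s = 1 := pow_orderOf_eq_one _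
      rw [uwx, val_neg_one', Nat.sub_add_cancel (Nat.pos_of_ne_zero h.m₁_ne), hq, sub_self,
        zero_div, mul_zero, zero_mul, sub_zero, map_smul] at h1
      rw [cast_pred, ← inv_smul_smul₀ hne (T.w (u (a, 0))), ← h1, smul_smul]
      congr 1
      have e : s ^ (2 * a.val * m₁ r s) = s ^ (2 * a.val * (m₁ r s - 1)) * s ^ (2 * a.val) := by
        rw [← pow_add, ← Nat.mul_succ, Nat.succ_eq_add_one,
          Nat.sub_add_cancel (Nat.pos_of_ne_zero h.m₁_ne)]
      rw [e, ← pow_mul, mul_pow]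
      have := pow_ne_zero (2 * a.val) hs
      have := pow_ne_zero (2 * a.val * (m₁ r s - 1)) hs
      field_simp
  have u₄' : ∀ a b, b ≠ 0 → T.w (u (a, b)) = (lam.l₂⁻¹ * (r * s) ^ (2 * a.val) *
      (lam.l₄ - s ^ 2 * (r ^ 2 - s ^ 2) * ((1 - (r * s⁻¹) ^ b.val) / (1 - r * s⁻¹)) * lam.l₃)) •
      u (a, b - 1) := fun a b hb => by
    obtain ⟨hb1, hb2⟩ := val_pred_of hb
    have h1 := uwx a (b + -1)
    rw [u₂' a _ hb2, ← hb1, map_smul, neg_add_cancel_right, ← sub_eq_add_neg] at h1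
    rw [← inv_smul_smul₀ hl₂ (T.w (u (a, b))), h1, smul_smul, ← mul_assoc, pow_mul]
  have hlin : LinearIndependent ℂ u := by
    -- The eigenvalues of `t` and `x₂ ^ m₁` determine `a`, and then that of `z` determines `b`.
    refine linearIndependent_of_joint_eigenvalues (ι := Fin 3)
      ![T.t, T.z, Y₂ ^ m₁ r s]
      ![fun g => ((r * s) ^ 2) ^ g.1.val *
          (lam.l₄ - s ^ 2 * (r ^ 2 - s ^ 2) / (1 - r * s⁻¹) * lam.l₃),
        fun g => ((r * s) ^ 2) ^ g.1.val * (r * s⁻¹) ^ g.2.val * lam.l₃,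
        fun g => ((s ^ 2) ^ m₁ r s) ^ g.1.val] u
      (fun g h0 => hv (pow_injective hY₁0 _ _ (pow_injective hY₂0 _ _ h0))) ?_ ?_
    · intro i g
      fin_cases i
      · exact ut g.1 g.2
      · exact uz g.1 g.2
      · have h1 := (qY.pow_left (m₁ r s)).pow_pow_apply ((q_refl Y₂).pow_left (m₁ r s))
          (κ := 1) (v := v) (by rw [hper₂, one_smul]) g.1.val g.2.val
        rwa [one_pow, one_pow, mul_one, mul_one] at h1
    · rintro ⟨a, b⟩ ⟨a', b'⟩ hab
      have h1 := mul_right_cancel₀ hl₄ (hab 0)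
      have h3 : ((s ^ 2) ^ m₁ r s) ^ a.val = ((s ^ 2) ^ m₁ r s) ^ a'.val := hab 2
      obtain rfl : a = a' := ZMod.val_injective _ <|
        eq_of_pow_eq_of_lt (pow_ne_zero 2 (mul_ne_zero hr hs)) (hs2 _) h.ell₁_eq
          (ZMod.val_lt a) (ZMod.val_lt a') h1 h3
      have h2 := mul_left_cancel₀ (pow_ne_zero _ (pow_ne_zero 2 (mul_ne_zero hr hs)))
        (mul_right_cancel₀ hl₃ (hab 1))
      rw [Prod.mk.injEq]
      exact ⟨rfl, ZMod.val_injective _ (pow_injOn_Iio_orderOf (ZMod.val_lt b) (ZMod.val_lt b') h2)⟩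
  refine hT.isoTo (M₁.ops h lam) u hlin (fun ⟨a, b⟩ => ?_) (fun ⟨a, b⟩ => ?_) (fun ⟨a, b⟩ => ?_)
    (fun ⟨a, b⟩ => ?_) <;>
  refine (congrArg _ (basisOp_bas _ (a, b))).trans ?_
  · exact (linearCombination_smul_bas _ _ _).trans (u₁ a b).symm
  · unfold M₁.F₂
    split_ifs with hb
    · exact (linearCombination_smul_bas _ _ _).trans (u₂ a b hb).symm
    · exact (linearCombination_smul_bas _ _ _).trans (u₂' a b hb).symm
  · exact (linearCombination_smul_bas _ _ _).trans (u₃ a b).symm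
  · unfold M₁.F₄
    split_ifs with hb
    · dsimp only at hb
      subst hb
      exact (linearCombination_smul_bas _ _ _).trans (u₄ a).symm
    · exact (linearCombination_smul_bas _ _ _).trans (u₄' a b hb).symm

/-- The parameters `λ₁`, `λ₂` are roots of the eigenvalues of `x₁ ^ ℓ₁` and `x₂ ^ m₁`, `λ₃` is that
of `z`, and the condition on `λ₄` says that the eigenvalue of `t` is not zero. -/
theorem exists_isoTo_M₁ (h : Standing r s m n) (hT : T.IsIrred) (hS : T.IsSchur)
    (hx₃ : ∀ v, T.x₃ v = 0 → v = 0) (ht : ∀ v, T.t v = 0 → v = 0) (hx₂ : ∀ v, T.x₂ v = 0 → v = 0)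
    {v : V} (hv : v ≠ 0) : ∃ lam : Param₁ r s, (M₁.ops h lam).IsoTo T := by
  have hr := h.r_ne
  have hs := h.s_ne
  have hK : m * n ≠ 0 := (Nat.mul_pos h.m_pos h.n_pos).ne'
  have hq : (r * s⁻¹) ^ m₁ r s = 1 := pow_orderOf_eq_one _
  have hp : ((r * s) ^ 2) ^ ell₁ r s = 1 := h.per₁
  have hp' : (s ^ (2 * m₁ r s)) ^ ell₁ r s = 1 := h.per₁'
  -- The operators `z`, `t`, `x₁ ^ ℓ₁` and `x₂ ^ m₁` commute.
  have czt : QComm 1 T.t T.z := (T.q_tx₁.mul_right (T.q_tx₃ hr hs)).of_eq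
    (mul_inv_cancel₀ (pow_ne_zero 2 (mul_ne_zero hr hs)))
  have cz₁ : QComm 1 T.z (T.x₁ ^ ell₁ r s) := (T.q_zx₁.pow_right _).of_eq hp
  have ct₁ : QComm 1 T.t (T.x₁ ^ ell₁ r s) := (T.q_tx₁.pow_right _).of_eq hp
  have cz₂ : QComm 1 T.z (T.x₂ ^ m₁ r s) := ((T.q_zx₂ hr hs).pow_right _).of_eq hq
  have ct₂ : QComm 1 T.t (T.x₂ ^ m₁ r s) := ((T.q_tx₂ hr hs h.div_ne).pow_right _).of_eq (one_pow _)
  have c₂₁ : QComm 1 (T.x₂ ^ m₁ r s) (T.x₁ ^ ell₁ r s) :=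
    ((T.q_x₂x₁.pow_left _).pow_right _).of_eq (by rw [← pow_mul s, hp'])
  obtain ⟨v₁, κ₁, hv₁, e₁, -⟩ := (T.isNormal_t h).exists_eigenvector hS hK hv
  obtain ⟨v₂, κ₂, hv₂, e₂, i₂⟩ := (T.isNormal_z h).exists_eigenvector hS hK hv₁
  obtain ⟨v₃, κ₃, hv₃, e₃, i₃⟩ := (T.isNormal_x₂_pow h (one_pow _)
    (T.q_w_x₂_pow hr hs h.div_ne h.m₁_ne hq)).exists_eigenvector hS hK hv₂
  obtain ⟨v₄, κ₄, hv₄, e₄, i₄⟩ := ((T.isNormal_x₁ h).pow (ell₁ r s)).exists_eigenvector hS hK hv₃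
  have e₁' : T.t v₄ = κ₁ • v₄ := Module.End.mem_eigenspace_iff.1 <|
    i₄ _ (ct₁.eigenspace_mapsTo κ₁) <| i₃ _ (ct₂.eigenspace_mapsTo κ₁) <|
    i₂ _ (czt.eigenspace_mapsTo κ₁) <| Module.End.mem_eigenspace_iff.2 e₁
  have e₂' : T.z v₄ = κ₂ • v₄ := Module.End.mem_eigenspace_iff.1 <|
    i₄ _ (cz₁.eigenspace_mapsTo κ₂) <| i₃ _ (cz₂.eigenspace_mapsTo κ₂) <|
    Module.End.mem_eigenspace_iff.2 e₂
  have e₃' : (T.x₂ ^ m₁ r s) v₄ = κ₃ • v₄ := Module.End.mem_eigenspace_iff.1 <|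
    i₄ _ (c₂₁.eigenspace_mapsTo κ₃) <| Module.End.mem_eigenspace_iff.2 e₃
  obtain ⟨l₁, hl₁, f₁⟩ := exists_root_eigenvalue T.x₁_injective h.ell₁_ne hv₄ e₄
  obtain ⟨l₂, hl₂, f₂⟩ := exists_root_eigenvalue hx₂ h.m₁_ne hv₄ e₃'
  have hκ₁ : κ₁ ≠ 0 := by
    rintro rfl
    exact hv₄ (ht _ (by rw [e₁', zero_smul]))
  have hκ₂ : κ₂ ≠ 0 := by
    rintro rfl
    exact hv₄ (z_injective hx₃ _ (by rw [e₂', zero_smul]))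
  refine ⟨⟨l₁, l₂, κ₂, κ₁ + s ^ 2 * (r ^ 2 - s ^ 2) / (1 - r * s⁻¹) * κ₂, hl₁, hl₂, hκ₂, ?_⟩,
    isoTo_M₁ h hT _ hv₄ hx₂ f₁ f₂ e₂' ?_⟩
  · rwa [Ne, add_eq_right]
  · rw [e₁', add_sub_cancel_right]

end Ops
end B2

/-! ### The modules on which `X₂` is not injective -/

namespace B2

open MulOpposite

namespace Ops

variable {r s : ℂ} {m n : ℕ} {V : Type*} [AddCommGroup V] [Module ℂ V] {T : Ops r s V}

/-- Vectors killed by `x₂` that are eigenvectors of `z` are eigenvectors of `t`. -/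
theorem t_apply_of_x₂_apply_eq_zero (h : Standing r s m n) {v : V} (hv₂ : T.x₂ v = 0) {κ : ℂ}
    (hz : T.z v = κ • v) :
    T.t v = (-(s ^ 2 * (r ^ 2 - s ^ 2) / (1 - r * s⁻¹) * (r * s⁻¹) * κ)) • v := by
  have h1 := LinearMap.congr_fun (T.w_mul_x₂ h.div_ne) v
  rw [Module.End.mul_apply, hv₂, map_zero, LinearMap.add_apply, LinearMap.smul_apply, hz,
    smul_smul] at h1
  rw [neg_smul]
  exact eq_neg_of_add_eq_zero_left h1.symm

/-- A vector killed by `x₂` that is a joint eigenvector of powers of `x₁` and `w` and of `z`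
generates a copy of `M₂(μ)`. -/
theorem isoTo_M₂ (h : Standing r s m n) (hT : T.IsIrred) (mu : Param₂) {v : V}
    (hv : ∀ b < m₂ r s mu.u₃, (T.w ^ b) v ≠ 0)
    (hv₁ : (T.x₁ ^ ell₂ r s) v = mu.u₁ ^ ell₂ r s • v) (hv₂ : T.x₂ v = 0)
    (hv₃ : T.z v = mu.u₂ • v) (hv₄ : (T.w ^ m₂ r s mu.u₃) v = mu.u₃ • v) :
    (M₂.ops h mu).IsoTo T := by
  have : NeZero (ell₂ r s) := ⟨h.ell₂_ne⟩
  have : NeZero (m₂ r s mu.u₃) := ⟨h.m₂_ne _⟩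
  have hr := h.r_ne
  have hs := h.s_ne
  have hd := h.d_ne
  have hq0 : r * s⁻¹ ≠ 0 := mul_ne_zero hr (inv_ne_zero hs)
  have hrs : (r * s) ^ 2 ≠ 0 := pow_ne_zero 2 (mul_ne_zero hr hs)
  have hμ₁ := mu.u₁_ne
  have hμ₂ := mu.u₂_ne
  set Y : Module.End ℂ V := mu.u₁⁻¹ • T.x₁ with hY
  have hYx : ∀ x, T.x₁ x = mu.u₁ • Y x := fun x => by
    rw [hY, LinearMap.smul_apply, smul_smul, mul_inv_cancel₀ hμ₁, one_smul]
  have hper : (Y ^ ell₂ r s) v = v := pow_inv_smul_apply _ hμ₁ hv₁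
  have hY0 : ∀ x, Y x = 0 → x = 0 := fun x hx => T.x₁_injective x (by rw [hYx, hx, smul_zero])
  have qY : QComm (r ^ 2) T.w Y := T.q_wx₁.smul_right _
  have htv := t_apply_of_x₂_apply_eq_zero h hv₂ hv₃
  let u : ZMod (ell₂ r s) × ZMod (m₂ r s mu.u₃) → V :=
    fun g => (T.w ^ g.2.val) ((Y ^ g.1.val) v)
  have hu : ∀ a b, u (a, b) = (T.w ^ b.val) ((Y ^ a.val) v) := fun _ _ => rfl
  have hu1 : ∀ a b, u (a + 1, b) = (r ^ 2) ^ b.val • Y (u (a, b)) := fun a b =>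
    qY.apply_pow_val_add_one hper a b.val
  have hr2 : ∀ k : ℕ, (r ^ 2) ^ k ≠ 0 := fun k => pow_ne_zero _ (pow_ne_zero 2 hr)
  have uz : ∀ a b, T.z (u (a, b)) =
      (((r * s) ^ 2) ^ a.val * (r⁻¹ * s) ^ b.val * mu.u₂) • u (a, b) := fun a b =>
    (T.q_zx₁.smul_right _).pow_pow_apply (T.q_zw hr hs) hv₃ a.val b.val
  have ut : ∀ a b, T.t (u (a, b)) = (((r * s) ^ 2) ^ a.val *
      (-(s ^ 2 * (r ^ 2 - s ^ 2) / (1 - r * s⁻¹) * (r * s⁻¹) * mu.u₂))) • u (a, b) := fun a b => by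
    have h1 := (T.q_tx₁.smul_right mu.u₁⁻¹).pow_pow_apply (T.q_tw hr hs h.div_ne) htv a.val b.val
    rwa [one_pow, mul_one] at h1
  have u₁ : ∀ a b, T.x₁ (u (a, b)) = ((r ^ (2 * b.val))⁻¹ * mu.u₁) • u (a + 1, b) := fun a b => by
    rw [hu1, hYx, smul_smul, pow_mul, mul_right_comm, inv_mul_cancel₀ (hr2 _), one_mul]
  have u₂ : ∀ a, T.x₂ (u (a, 0)) = 0 := fun a => by
    rw [hu, ZMod.val_zero, pow_zero, Module.End.one_apply,
      (T.q_x₂x₁.smul_right mu.u₁⁻¹).pow_apply (κ := 0) (by rw [hv₂, zero_smul]), mul_zero, zero_smul]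
  have u₃ : ∀ a b, T.x₃ (u (a, b)) =
      ((r * s) ^ (2 * a.val + b.val) * mu.u₁⁻¹ * mu.u₂) • u (a - 1, b) := fun a b => by
    obtain ⟨a, rfl⟩ : ∃ a', a = a' + 1 := ⟨a - 1, by simp⟩
    rw [add_sub_cancel_right, hu1, map_smul, hY, LinearMap.smul_apply, map_smul, T.q_x₃x₁.apply,
      ← Module.End.mul_apply, ← z, uz, smul_smul, smul_smul, smul_smul, pow_add, pow_mul,
      pv_add_one h.per₂]
    congr 1
    have e : (r * s) ^ b.val = (r ^ 2) ^ b.val * (r⁻¹ * s) ^ b.val := by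
      rw [← mul_pow]
      congr 1
      field_simp
    rw [e]
    ring
  have u₄ : ∀ a b, b.val = m₂ r s mu.u₃ - 1 →
      T.w (u (a, b)) = (r ^ (2 * a.val * m₂ r s mu.u₃) * mu.u₃) • u (a, 0) := fun a b hb => by
    rw [hu, hu, ZMod.val_zero, pow_zero, Module.End.one_apply, ← Module.End.mul_apply,
      ← pow_succ', hb, Nat.sub_add_cancel (Nat.pos_of_ne_zero (h.m₂_ne _)),
      (qY.pow_left (m₂ r s mu.u₃)).pow_apply hv₄]
    congr 1
    rw [← pow_mul, ← pow_mul]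
    ring
  have u₄' : ∀ a b, b.val ≠ m₂ r s mu.u₃ - 1 → T.w (u (a, b)) = u (a, b + 1) :=
    fun a b hb => by
      rw [hu, hu, val_add_one_of hb, pow_succ', Module.End.mul_apply]
  have u₂' : ∀ a b, b ≠ 0 → T.x₂ (u (a, b)) = ((r * s) ^ (2 * a.val) * s ^ 2 * (r ^ 2 - s ^ 2) *
      ((1 - (r⁻¹ * s) ^ b.val) / (1 - r⁻¹ * s)) * mu.u₂) • u (a, b - 1) := fun a b hb => by
    obtain ⟨hb1, hb2⟩ := val_pred_of hb
    have h1 := u₄' a _ hb2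
    rw [neg_add_cancel_right] at h1
    rw [← h1, ← Module.End.mul_apply, T.x₂_mul_w, LinearMap.add_apply, ut, LinearMap.smul_apply,
      uz, smul_smul, ← add_smul, ← sub_eq_add_neg, hb1, pow_succ (r⁻¹ * s), pow_mul,
      ← sub_eq_add_neg]
    congr 1
    have e : r⁻¹ * s = (r * s⁻¹)⁻¹ := by field_simp
    have hq := h.div_ne
    have hq' := h.div_ne'
    rw [e] at hq' ⊢
    generalize ((r * s) ^ 2) ^ a.val = R
    generalize r * s⁻¹ = q at *
    generalize q⁻¹ ^ (b - 1).val = Q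
    have e' : 1 - q⁻¹ = -(1 - q) / q := by field_simp; ring
    rw [e']
    field_simp
    ring
  have hne : ∀ g, u g ≠ 0 := by
    rintro ⟨a, b⟩ h0
    refine hv b.val (ZMod.val_lt b) (pow_injective hY0 a.val _ ?_)
    rw [hu, ((qY.pow_left b.val).pow_right a.val).apply] at h0
    exact (smul_eq_zero.1 h0).resolve_left (pow_ne_zero _ (hr2 _))
  have hlin : LinearIndependent ℂ u := by
    -- The eigenvalue of `t` determines `a`, and then those of `z` and `x₁ ^ ℓ₂` determine `b`.
    refine linearIndependent_of_joint_eigenvalues (ι := Fin 3)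
      ![T.t, T.z, Y ^ ell₂ r s]
      ![fun g => ((r * s) ^ 2) ^ g.1.val *
          (-(s ^ 2 * (r ^ 2 - s ^ 2) / (1 - r * s⁻¹) * (r * s⁻¹) * mu.u₂)),
        fun g => ((r * s) ^ 2) ^ g.1.val * (r⁻¹ * s) ^ g.2.val * mu.u₂,
        fun g => ((r ^ 2)⁻¹ ^ ell₂ r s) ^ g.2.val] u hne ?_ ?_
    · intro i g
      fin_cases i
      · exact ut g.1 g.2
      · exact uz g.1 g.2
      · have h1 := ((q_refl Y).pow_left (ell₂ r s)).pow_pow_apply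
          ((qY.symm (pow_ne_zero 2 hr)).pow_left (ell₂ r s))
          (κ := 1) (v := v) (by rw [hper, one_smul]) g.1.val g.2.val
        rwa [one_pow, one_pow, one_mul, mul_one] at h1
    · rintro ⟨a, b⟩ ⟨a', b'⟩ hab
      have h1 := mul_right_cancel₀
        (neg_ne_zero.2 (mul_ne_zero (mul_ne_zero hd hq0) hμ₂)) (hab 0)
      obtain rfl : a = a' := ZMod.val_injective _ <| pow_injOn_Iio_orderOf
        ((ZMod.val_lt a).trans_eq (by rw [ell₂, mul_pow]))
        ((ZMod.val_lt a').trans_eq (by rw [ell₂, mul_pow])) h1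
      have h2 := mul_left_cancel₀ (pow_ne_zero _ hrs) (mul_right_cancel₀ hμ₂ (hab 1))
      have h3 : ((r ^ 2)⁻¹ ^ ell₂ r s) ^ b.val = ((r ^ 2)⁻¹ ^ ell₂ r s) ^ b'.val := hab 2
      dsimp only at h2
      rw [show r⁻¹ * s = (r * s⁻¹)⁻¹ by field_simp, inv_pow, inv_pow, inv_inj] at h2
      rw [inv_pow, inv_pow, inv_pow, inv_inj] at h3
      rw [Prod.mk.injEq]
      exact ⟨rfl, ZMod.val_injective _ <| eq_of_pow_eq_of_lt hq0 (hr2 _) (h.m₂_eq mu.u₃)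
        (ZMod.val_lt b) (ZMod.val_lt b') h2 h3⟩
  refine hT.isoTo (M₂.ops h mu) u hlin (fun ⟨a, b⟩ => ?_) (fun ⟨a, b⟩ => ?_) (fun ⟨a, b⟩ => ?_)
    (fun ⟨a, b⟩ => ?_) <;>
  refine (congrArg _ (basisOp_bas _ (a, b))).trans ?_
  · exact (linearCombination_smul_bas _ _ _).trans (u₁ a b).symm
  · unfold M₂.F₂
    split_ifs with hb
    · dsimp only at hb
      subst hb
      exact (map_zero _).trans (u₂ a).symm
    · exact (linearCombination_smul_bas _ _ _).trans (u₂' a b hb).symm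
  · exact (linearCombination_smul_bas _ _ _).trans (u₃ a b).symm
  · unfold M₂.F₄
    split_ifs with hb
    · exact (linearCombination_smul_bas _ _ _).trans (u₄ a b hb).symm
    · exact ((Finsupp.linearCombination_single ℂ 1 _).trans (one_smul ℂ _)).trans (u₄' a b hb).symm

/-- If `x₂ v = 0` and `z v = κ v` with `κ ≠ 0`, then the vectors `wᵇ v` do not vanish for
`b < ord (r s⁻¹)`, since `x₂` maps each of them to a nonzero multiple of the preceding one. -/
theorem w_pow_apply_ne_zero (h : Standing r s m n) {v : V} (hv : v ≠ 0) (hv₂ : T.x₂ v = 0) {κ : ℂ}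
    (hκ : κ ≠ 0) (hz : T.z v = κ • v) {b : ℕ} (hb : b < orderOf (r * s⁻¹)) : (T.w ^ b) v ≠ 0 := by
  have hr := h.r_ne
  have hs := h.s_ne
  have hq0 : r * s⁻¹ ≠ 0 := mul_ne_zero hr (inv_ne_zero hs)
  induction b with
  | zero => simpa using hv
  | succ b ih =>
    intro h0
    have htv := t_apply_of_x₂_apply_eq_zero h hv₂ hz
    have h1 := congrArg T.x₂ h0
    rw [pow_succ', Module.End.mul_apply, ← Module.End.mul_apply, T.x₂_mul_w, LinearMap.add_apply,
      LinearMap.smul_apply, (T.q_tw hr hs h.div_ne).pow_apply htv, (T.q_zw hr hs).pow_apply hz,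
      smul_smul, ← add_smul, map_zero] at h1
    have h2 := (smul_eq_zero.1 h1).resolve_right (ih (by omega))
    have e : (r⁻¹ * s) ^ b = ((r * s⁻¹) ^ b)⁻¹ := by
      rw [← inv_pow]
      congr 1
      field_simp
    rw [e, one_pow] at h2
    have h3 : (s ^ 2 * (r ^ 2 - s ^ 2) / (1 - r * s⁻¹)) * κ * ((r * s⁻¹) ^ b)⁻¹ *
        (1 - (r * s⁻¹) ^ (b + 1)) = 0 := by
      rw [← h2, pow_succ (r * s⁻¹) b]
      have := pow_ne_zero b hq0
      generalize (r * s⁻¹) ^ b = Q at *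
      field_simp
      ring
    have h4 := (mul_eq_zero.1 h3).resolve_left
      (mul_ne_zero (mul_ne_zero h.d_ne hκ) (inv_ne_zero (pow_ne_zero b hq0)))
    exact Nat.not_le_of_lt hb (orderOf_le_of_pow_eq_one (Nat.succ_pos b) (sub_eq_zero.1 h4).symm)

/-- An eigenvector is found in the kernel of `x₂`. If a power of `w` kills a vector there, then
`μ₃ = 0` can be arranged; otherwise `μ₃ ≠ 0`, and `w ^ m₂` commutes with `x₁ ^ ℓ₂`. -/
theorem exists_isoTo_M₂ (h : Standing r s m n) (hT : T.IsIrred) (hS : T.IsSchur)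
    (hx₃ : ∀ v, T.x₃ v = 0 → v = 0) {v : V} (hv : v ≠ 0) (hv₂ : T.x₂ v = 0) :
    ∃ mu : Param₂, (M₂.ops h mu).IsoTo T := by
  have hr := h.r_ne
  have hs := h.s_ne
  have hK : m * n ≠ 0 := (Nat.mul_pos h.m_pos h.n_pos).ne'
  have hp0 : orderOf (r * s⁻¹) ≠ 0 := h.m₁_ne
  have hl : ((r * s) ^ 2) ^ ell₂ r s = 1 := h.per₂
  have cz₁ : QComm 1 T.z (T.x₁ ^ ell₂ r s) := (T.q_zx₁.pow_right _).of_eq hl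
  have q₂z : QComm (r * s⁻¹)⁻¹ T.x₂ T.z :=
    (T.q_zx₂ hr hs).symm (mul_ne_zero hr (inv_ne_zero hs))
  -- The two cases are whether `w ^ ord (r s⁻¹)` is injective on the kernel of `x₂`.
  by_cases hw : ∃ x, x ≠ 0 ∧ T.x₂ x = 0 ∧ (T.w ^ orderOf (r * s⁻¹)) x = 0
  -- Here `x₁ ^ ℓ₂` need not commute with `w ^ ord (r s⁻¹)`, but it preserves its kernel.
  · obtain ⟨x, hx, hx₂, hxw⟩ := hw
    have qwz : QComm ((r⁻¹ * s) ^ orderOf (r * s⁻¹))⁻¹ (T.w ^ orderOf (r * s⁻¹)) T.z :=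
      ((T.q_zw hr hs).pow_right _).symm (pow_ne_zero _ (mul_ne_zero (inv_ne_zero hr) hs))
    obtain ⟨v₁, κ₁, hv₁, e₁, i₁⟩ := (T.isNormal_z h).exists_eigenvector hS hK hx
    obtain ⟨v₂, κ₂, hv₂, e₂, i₂⟩ :=
      ((T.isNormal_x₁ h).pow (ell₂ r s)).exists_eigenvector hS hK hv₁
    have f₁ : T.x₂ v₂ = 0 := LinearMap.mem_ker.1 <| i₂ _ (T.q_x₂x₁.pow_right _).ker_mapsTo <|
      i₁ _ q₂z.ker_mapsTo <| LinearMap.mem_ker.2 hx₂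
    have f₂ : (T.w ^ orderOf (r * s⁻¹)) v₂ = 0 := LinearMap.mem_ker.1 <|
      i₂ _ ((T.q_wx₁.pow_left _).pow_right _).ker_mapsTo <|
      i₁ _ qwz.ker_mapsTo <| LinearMap.mem_ker.2 hxw
    have f₃ : T.z v₂ = κ₁ • v₂ := Module.End.mem_eigenspace_iff.1 <|
      i₂ _ (cz₁.eigenspace_mapsTo κ₁) <| Module.End.mem_eigenspace_iff.2 e₁
    obtain ⟨l, hl, f₄⟩ := exists_root_eigenvalue T.x₁_injective h.ell₂_ne hv₂ e₂
    have hκ₁ : κ₁ ≠ 0 := by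
      rintro rfl
      exact hv₂ (z_injective hx₃ _ (by rw [f₃, zero_smul]))
    have hm : m₂ r s 0 = orderOf (r * s⁻¹) := if_pos (Or.inr rfl)
    refine ⟨⟨l, κ₁, 0, hl, hκ₁⟩, isoTo_M₂ h hT _ (fun b hb => ?_) f₄ f₁ f₃ ?_⟩
    · exact w_pow_apply_ne_zero h hv₂ f₁ hκ₁ f₃ (hb.trans_eq hm)
    · dsimp only
      rw [hm, f₂, zero_smul]
  · push Not at hw
    -- For `μ₃ ≠ 0` the number `m₂` does not depend on `μ₃`.
    have hM : ∃ M, M ≠ 0 ∧ (∀ μ : ℂ, μ ≠ 0 → m₂ r s μ = M) := by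
      refine ⟨m₂ r s 1, h.m₂_ne 1, fun μ hμ => ?_⟩
      simp [m₂, hμ]
    obtain ⟨M, hM0, hM⟩ := hM
    have hM1 : (r ^ (2 * M)) ^ ell₂ r s = 1 := by
      rw [← hM 1 one_ne_zero]; exact h.per₂' one_ne_zero
    have hM2 : M = orderOf (r * s⁻¹) ∨ M = orderOf (r * s⁻¹) * 2 := by
      rcases h.m₂_eq 1 with e | ⟨e, -⟩
      · exact Or.inl (by rw [← hM 1 one_ne_zero, e])
      · exact Or.inr (by rw [← hM 1 one_ne_zero, e, mul_comm])
    have hqM : (r * s⁻¹) ^ M = 1 := by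
      rcases hM2 with e | e
      · rw [e, pow_orderOf_eq_one]
      · rw [e, pow_mul, pow_orderOf_eq_one, one_pow]
    have c₂w : ∀ {k : ℕ}, k ≠ 0 → (r * s⁻¹) ^ k = 1 → QComm 1 T.x₂ (T.w ^ k) :=
      T.q_x₂_w_pow hr hs h.div_ne
    have hwM : ∀ x, T.x₂ x = 0 → (T.w ^ M) x = 0 → x = 0 := by
      intro x hx hxw
      by_contra hx0
      rcases hM2 with e | e
      · exact hw x hx0 hx (e ▸ hxw)
      · rw [e, mul_two, pow_add, Module.End.mul_apply] at hxw
        refine hw _ (hw x hx0 hx) ?_ hxw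
        exact LinearMap.mem_ker.1
          ((c₂w hp0 (pow_orderOf_eq_one _)).ker_mapsTo x (LinearMap.mem_ker.2 hx))
    have czw : QComm 1 T.z (T.w ^ M) := ((T.q_zw hr hs).pow_right M).of_eq (by
      rw [show r⁻¹ * s = (r * s⁻¹)⁻¹ by field_simp, inv_pow, hqM, inv_one])
    have cw₁ : QComm 1 (T.w ^ M) (T.x₁ ^ ell₂ r s) :=
      ((T.q_wx₁.pow_left M).pow_right _).of_eq (by rw [← pow_mul r, hM1])
    obtain ⟨v₁, κ₁, hv₁, e₁, i₁⟩ := (T.isNormal_z h).exists_eigenvector hS hK hv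
    obtain ⟨v₂, κ₂, hv₂, e₂, i₂⟩ :=
      (T.isNormal_w_pow h (one_pow _) (c₂w hM0 hqM)).exists_eigenvector hS hK hv₁
    obtain ⟨v₃, κ₃, hv₃, e₃, i₃⟩ :=
      ((T.isNormal_x₁ h).pow (ell₂ r s)).exists_eigenvector hS hK hv₂
    have f₁ : T.x₂ v₃ = 0 := LinearMap.mem_ker.1 <| i₃ _ (T.q_x₂x₁.pow_right _).ker_mapsTo <|
      i₂ _ (c₂w hM0 hqM).ker_mapsTo <| i₁ _ q₂z.ker_mapsTo <| LinearMap.mem_ker.2 ‹T.x₂ v = 0›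
    have f₂ : (T.w ^ M) v₃ = κ₂ • v₃ := Module.End.mem_eigenspace_iff.1 <|
      i₃ _ (cw₁.eigenspace_mapsTo κ₂) <| Module.End.mem_eigenspace_iff.2 e₂
    have f₃ : T.z v₃ = κ₁ • v₃ := Module.End.mem_eigenspace_iff.1 <|
      i₃ _ (cz₁.eigenspace_mapsTo κ₁) <| i₂ _ (czw.eigenspace_mapsTo κ₁) <|
      Module.End.mem_eigenspace_iff.2 e₁
    obtain ⟨l, hl, f₄⟩ := exists_root_eigenvalue T.x₁_injective h.ell₂_ne hv₃ e₃
    have hκ₁ : κ₁ ≠ 0 := by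
      rintro rfl
      exact hv₃ (z_injective hx₃ _ (by rw [f₃, zero_smul]))
    have hκ₂ : κ₂ ≠ 0 := by
      rintro rfl
      exact hv₃ (hwM _ f₁ (by rw [f₂, zero_smul]))
    refine ⟨⟨l, κ₁, κ₂, hl, hκ₁⟩, isoTo_M₂ h hT _ (fun b hb h0 => ?_) f₄ f₁ f₃ ?_⟩
    · dsimp only at hb
      rw [hM κ₂ hκ₂] at hb
      refine hv₃ (hwM _ f₁ ?_)
      rw [← Nat.sub_add_cancel hb.le, pow_add, Module.End.mul_apply, h0, map_zero]
    · dsimp only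
      rw [hM κ₂ hκ₂, f₂]

end Ops
end B2

/-! ### The commutation relations of the generators of `B` -/

namespace B2

open MulOpposite

namespace U

variable (r s : ℂ)

theorem q_X₁X₂ : QComm (s ^ 2) (X₁ r s) (X₂ r s) := by
  have h := RingQuot.mkAlgHom_rel ℂ (SerreRel.rel₁ (r := r) (s := s))
  simp only [map_add, map_sub, map_smul, map_mul, map_pow, map_zero] at h
  change X₁ r s ^ 2 * X₄ r s - (r ^ 2 + s ^ 2) • (X₁ r s * X₄ r s * X₁ r s) +
    (r ^ 2 * s ^ 2) • (X₄ r s * X₁ r s ^ 2) = 0 at h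
  rw [QComm, ← sub_eq_zero, ← h, X₂]
  simp only [mul_sub, sub_mul, mul_smul_comm, smul_mul_assoc, mul_assoc, smul_sub, pow_two]
  match_scalars <;> ring

theorem X₁_mul_X₄ : X₁ r s * X₄ r s = X₂ r s + r ^ 2 • (X₄ r s * X₁ r s) := by
  rw [X₂, sub_add_cancel]

variable {s} (hs : s ≠ 0)
include hs

theorem q_X₃X₄ : QComm (r * s) (X₃ r s) (X₄ r s) := by
  have h := RingQuot.mkAlgHom_rel ℂ (SerreRel.rel₂ (r := r) (s := s))
  simp only [map_add, map_sub, map_smul, map_mul, map_pow, map_zero] at h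
  change X₁ r s * X₄ r s ^ 3 - (r ^ 2 + r * s + s ^ 2) • (X₄ r s * X₁ r s * X₄ r s ^ 2) +
    (r * s * (r ^ 2 + r * s + s ^ 2)) • (X₄ r s ^ 2 * X₁ r s * X₄ r s) -
    (r ^ 3 * s ^ 3) • (X₄ r s ^ 3 * X₁ r s) = 0 at h
  have h' := congrArg (fun x => (-(s ^ 2)⁻¹) • x) h
  simp only [smul_zero] at h'
  rw [QComm, ← sub_eq_zero, ← h', X₃, X₂]
  simp only [mul_sub, sub_mul, mul_smul_comm, smul_mul_assoc, mul_assoc, smul_sub, pow_succ,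
    pow_zero, one_mul]
  match_scalars <;> field_simp <;> ring

theorem q_X₁X₃ : QComm (r ^ 2 * s ^ 2) (X₁ r s) (X₃ r s) := by
  have h := q_X₁X₂ r s
  rw [QComm] at h
  rw [QComm, X₃, mul_sub, mul_smul_comm, ← mul_assoc, ← mul_assoc, X₁_mul_X₄, h, add_mul,
    smul_mul_assoc, mul_assoc (X₄ r s), h, smul_mul_assoc, mul_assoc (X₂ r s), X₁_mul_X₄]
  simp only [sub_mul, mul_add, mul_smul_comm, smul_mul_assoc, mul_assoc, smul_sub]
  match_scalars <;> (field_simp; try ring)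

theorem q_X₂X₃ (hr : r ≠ 0) : QComm (r * s) (X₂ r s) (X₃ r s) := by
  have h := (q_X₃X₄ r hs).symm (mul_ne_zero hr hs)
  rw [X₂]
  exact (((q_X₁X₃ r hs).mul_left h).of_eq (by field_simp)).sub_smul_left
    ((h.mul_left (q_X₁X₃ r hs)).of_eq (by field_simp)) _

theorem q_WX₃ (hr : r ≠ 0) : QComm (r * s) (W r s) (X₃ r s) := by
  have h := (q_X₃X₄ r hs).symm (mul_ne_zero hr hs)
  exact (q_X₂X₃ r hs hr).add_smul_left ((h.mul_left (q_X₁X₃ r hs)).of_eq (by field_simp)) _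

omit hs

variable (s)

theorem q_X₁W : QComm (r ^ 2) (X₁ r s) (W r s) := by
  have h := q_X₁X₂ r s
  rw [QComm] at h
  rw [QComm, W, mul_add, mul_smul_comm, ← mul_assoc, X₁_mul_X₄, h]
  simp only [add_mul, smul_mul_assoc, mul_assoc, smul_add]
  match_scalars <;> ring

theorem W_mul_X₂ (hs : s ≠ 0) : W r s * X₂ r s =
    X₂ r s * W r s + (s ^ 2 * (r ^ 2 - s ^ 2)) • (X₃ r s * X₁ r s) := by
  have h := q_X₁X₂ r s
  rw [QComm] at h
  rw [W, add_mul, smul_mul_assoc, mul_assoc, h, X₃]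
  simp only [mul_add, sub_mul, mul_smul_comm, smul_mul_assoc, mul_assoc, smul_sub]
  match_scalars <;> field_simp
  ring

end U

theorem rank_B_op_le (r s : ℂ) : Module.rank ℂ (B r s)ᵐᵒᵖ ≤ Cardinal.aleph0 := by
  rw [← (opLinearEquiv ℂ (M := B r s)).rank_eq]
  refine (Submodule.rank_le (Subalgebra.toSubmodule (B r s))).trans ?_
  refine (LinearMap.rank_le_of_surjective (RingQuot.mkAlgHom ℂ (SerreRel r s)).toLinearMap
    (RingQuot.mkAlgHom_surjective ℂ (SerreRel r s))).trans ?_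
  rw [FreeAlgebra.rank_eq, Cardinal.lift_le_aleph0]
  exact Cardinal.mk_le_aleph0

/-- A property of elements of `B` follows from the generators. -/
theorem B.induction {r s : ℂ} {p : B r s → Prop} (halg : ∀ c, p (algebraMap ℂ (B r s) c))
    (h₁ : p (B.X₁ r s)) (h₂ : p (B.X₂ r s)) (h₃ : p (B.X₃ r s)) (h₄ : p (B.W r s))
    (hadd : ∀ x y, p x → p y → p (x + y)) (hmul : ∀ x y, p x → p y → p (x * y)) (x : B r s) :
    p x := by
  obtain ⟨x, hx⟩ := x
  refine Algebra.adjoin_induction (p := fun x hx => p ⟨x, hx⟩) ?_ halg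
    (fun x y hx hy => hadd ⟨x, hx⟩ ⟨y, hy⟩) (fun x y hx hy => hmul ⟨x, hx⟩ ⟨y, hy⟩) hx
  intro x hx'
  simp only [Set.mem_insert_iff, Set.mem_singleton_iff] at hx'
  rcases hx' with rfl | rfl | rfl | rfl
  exacts [h₁, h₂, h₃, h₄]

/-! ### Simple right `B`-modules as irreducible families of operators -/

section Modules

variable {r s : ℂ} {m n : ℕ} {N : Type*} [AddCommGroup N] [Module (B r s)ᵐᵒᵖ N]

theorem eq_zero_of_isTorsionFreeAt {x : B r s} (h : IsTorsionFreeAt x N) (v : N)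
    (hv : op x • v = 0) : v = 0 := by
  have h1 : v ∈ torsionPart x N := ⟨1, by rwa [pow_one]⟩
  rwa [show torsionPart x N = {0} from h] at h1

theorem exists_op_smul_eq_zero_of_isTorsionAt [Nontrivial N] {x : B r s} (h : IsTorsionAt x N) :
    ∃ v : N, v ≠ 0 ∧ op x • v = 0 := by
  by_contra! hcon
  obtain ⟨v, hv⟩ := exists_ne (0 : N)
  have h1 : v ∈ torsionPart x N := by rw [show torsionPart x N = Set.univ from h]; trivial
  obtain ⟨k, hk⟩ := h1
  rw [op_pow] at hk
  induction k with
  | zero => exact hv (by simpa using hk)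
  | succ k ih =>
    rw [pow_succ', mul_smul] at hk
    refine hcon _ (fun h0 => ih h0) hk

variable [Module ℂ N]

/-- The operators of `T` are the actions of the generators of `B` on `N`. -/
def Ops.Represents (T : Ops r s N) : Prop :=
  (∀ v : N, op (B.X₁ r s) • v = T.x₁ v) ∧ (∀ v : N, op (B.X₂ r s) • v = T.x₂ v) ∧
    (∀ v : N, op (B.X₃ r s) • v = T.x₃ v) ∧ (∀ v : N, op (B.W r s) • v = T.w v)

theorem Ops.IsoTo.nonempty_equiv {M : Type*} [AddCommGroup M] [Module (B r s)ᵐᵒᵖ M] [Module ℂ M]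
    {T : Ops r s N} {S : Ops r s M} (hT : T.Represents) (hS : S.Represents)
    (hN : ∀ (c : ℂ) (v : N), op (algebraMap ℂ (B r s) c) • v = c • v)
    (hM : ∀ (c : ℂ) (v : M), op (algebraMap ℂ (B r s) c) • v = c • v) (hf : S.IsoTo T) :
    Nonempty (N ≃ₗ[(B r s)ᵐᵒᵖ] M) := by
  obtain ⟨f, hf⟩ := hf
  have key : ∀ (x : B r s) (v : M), f (op x • v) = op x • f v := by
    intro x
    induction x using B.induction with
    | halg c => intro v; rw [hN, hM, map_smul]
    | h₁ => intro v; rw [hS.1, hT.1, (hf v).1]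
    | h₂ => intro v; rw [hS.2.1, hT.2.1, (hf v).2.1]
    | h₃ => intro v; rw [hS.2.2.1, hT.2.2.1, (hf v).2.2.1]
    | h₄ => intro v; rw [hS.2.2.2, hT.2.2.2, (hf v).2.2.2]
    | hadd x y hx hy => intro v; rw [op_add, add_smul, add_smul, map_add, hx, hy]
    | hmul x y hx hy => intro v; rw [op_mul, mul_smul, mul_smul, hy, hx]
  exact ⟨LinearEquiv.symm { f with map_smul' := fun b v => key (unop b) v }⟩

theorem M₁.represents (h : Standing r s m n) (lam : Param₁ r s) : (M₁.ops h lam).Represents :=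
  ⟨fun v => by rw [M₁.op_smul, Ops.repB_X₁], fun v => by rw [M₁.op_smul, Ops.repB_X₂],
    fun v => by rw [M₁.op_smul, Ops.repB_X₃], fun v => by rw [M₁.op_smul, Ops.repB_W]⟩

theorem M₂.represents (h : Standing r s m n) (mu : Param₂) : (M₂.ops h mu).Represents :=
  ⟨fun v => by rw [M₂.op_smul, Ops.repB_X₁], fun v => by rw [M₂.op_smul, Ops.repB_X₂],
    fun v => by rw [M₂.op_smul, Ops.repB_X₃], fun v => by rw [M₂.op_smul, Ops.repB_W]⟩

theorem M₃.represents (h : Standing r s m n) (eps : Param₃) : (M₃.ops h eps).Represents :=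
  ⟨fun v => by rw [M₃.op_smul, Ops.repB_X₁], fun v => by rw [M₃.op_smul, Ops.repB_X₂],
    fun v => by rw [M₃.op_smul, Ops.repB_X₃], fun v => by rw [M₃.op_smul, Ops.repB_W]⟩

variable [IsScalarTower ℂ (B r s)ᵐᵒᵖ N]

theorem op_algebraMap_smul (c : ℂ) (v : N) : op (algebraMap ℂ (B r s) c) • v = c • v :=
  algebraMap_smul (B r s)ᵐᵒᵖ c v

variable [IsSimpleModule (B r s)ᵐᵒᵖ N]

/-- Subspaces of a simple module that are invariant under the generators of `B` are trivial. -/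
theorem eq_top_of_invariant (P : Submodule ℂ N) (hP : P ≠ ⊥)
    (h₁ : ∀ v ∈ P, op (B.X₁ r s) • v ∈ P) (h₂ : ∀ v ∈ P, op (B.X₂ r s) • v ∈ P)
    (h₃ : ∀ v ∈ P, op (B.X₃ r s) • v ∈ P) (h₄ : ∀ v ∈ P, op (B.W r s) • v ∈ P) : P = ⊤ := by
  have key : ∀ (x : B r s), ∀ v ∈ P, op x • v ∈ P := by
    intro x
    induction x using B.induction with
    | halg c => intro v hv; rw [op_algebraMap_smul]; exact P.smul_mem c hv
    | h₁ => exact h₁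
    | h₂ => exact h₂
    | h₃ => exact h₃
    | h₄ => exact h₄
    | hadd x y hx hy => intro v hv; rw [op_add, add_smul]; exact P.add_mem (hx v hv) (hy v hv)
    | hmul x y hx hy => intro v hv; rw [op_mul, mul_smul]; exact hy _ (hx v hv)
  let Q : Submodule (B r s)ᵐᵒᵖ N := { P with smul_mem' := fun b v hv => key (unop b) v hv }
  rcases ‹IsSimpleModule (B r s)ᵐᵒᵖ N›.toIsSimpleOrder.eq_bot_or_eq_top Q with hQ | hQ
  · refine absurd ((Submodule.eq_bot_iff P).2 fun v hv => ?_) hP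
    exact (Submodule.mem_bot _).1 (hQ ▸ (show v ∈ Q from hv))
  · exact (Submodule.eq_top_iff').2 fun v => show v ∈ Q from hQ ▸ Submodule.mem_top

theorem Ops.Represents.isIrred {T : Ops r s N} (hT : T.Represents) : T.IsIrred :=
  fun P hP h => eq_top_of_invariant P hP (fun v hv => hT.1 v ▸ (h v hv).1)
    (fun v hv => hT.2.1 v ▸ (h v hv).2.1) (fun v hv => hT.2.2.1 v ▸ (h v hv).2.2.1)
    (fun v hv => hT.2.2.2 v ▸ (h v hv).2.2.2)

variable [SMulCommClass (B r s)ᵐᵒᵖ ℂ N]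

/-- On a simple `X₁`-torsionfree module `X₁` is invertible, its image being invariant. -/
theorem exists_ops_represents (h : Standing r s m n) (hX₁ : IsTorsionFreeAt (B.X₁ r s) N) :
    ∃ T : Ops r s N, T.Represents ∧ ∀ v : N, op (B.Xt r s) • v = T.t v := by
  have hr := h.r_ne
  have hs := h.s_ne
  let ρ : (B r s)ᵐᵒᵖ →ₐ[ℂ] Module.End ℂ N := Algebra.lsmul ℂ ℂ N
  have rel : ∀ {x y : B r s} {c : ℂ}, QComm c (x : U r s) (y : U r s) →
      ρ (op y) * ρ (op x) = c • (ρ (op x) * ρ (op y)) := by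
    intro x y c hxy
    have h1 : x * y = c • (y * x) := Subtype.ext hxy
    rw [← map_mul, ← map_mul, ← op_mul, ← op_mul, h1, op_smul, map_smul]
  have r₁₂ := rel (x := B.X₁ r s) (y := B.X₂ r s) (U.q_X₁X₂ r s)
  have r₁₃ := rel (x := B.X₁ r s) (y := B.X₃ r s) (U.q_X₁X₃ r hs)
  have r₁w := rel (x := B.X₁ r s) (y := B.W r s) (U.q_X₁W r s)
  have hsurj : LinearMap.range (ρ (op (B.X₁ r s))) = ⊤ := by
    have hinv : ∀ {S : Module.End ℂ N} {c : ℂ}, QComm c S (ρ (op (B.X₁ r s))) →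
        ∀ v ∈ LinearMap.range (ρ (op (B.X₁ r s))), S v ∈ LinearMap.range (ρ (op (B.X₁ r s))) := by
      rintro S c hS _ ⟨v, rfl⟩
      rw [hS.apply]
      exact Submodule.smul_mem _ _ ⟨_, rfl⟩
    refine eq_top_of_invariant _ ?_ (fun v _ => ⟨v, rfl⟩) (hinv r₁₂) (hinv r₁₃) (hinv r₁w)
    have := IsSimpleModule.nontrivial (B r s)ᵐᵒᵖ N
    obtain ⟨v, hv⟩ := exists_ne (0 : N)
    exact (Submodule.ne_bot_iff _).2 ⟨_, ⟨v, rfl⟩, fun h0 => hv (eq_zero_of_isTorsionFreeAt hX₁ v h0)⟩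
  let f : N ≃ₗ[ℂ] N := LinearEquiv.ofBijective (ρ (op (B.X₁ r s)))
    ⟨(injective_iff_map_eq_zero _).2 (eq_zero_of_isTorsionFreeAt hX₁),
      LinearMap.range_eq_top.1 hsurj⟩
  have hXt : ρ (op (B.Xt r s)) = ρ (op (B.X₂ r s)) * ρ (op (B.W r s)) -
      (s ^ 2 * (r ^ 2 - s ^ 2) / (1 - r * s⁻¹)) •
        (ρ (op (B.X₁ r s)) * ρ (op (B.X₃ r s))) := by
    rw [B.Xt, op_sub, op_smul, op_mul, op_mul, ← map_mul, ← map_mul, ← map_smul]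
    exact map_sub ρ _ _
  refine ⟨{
    x₁ := ρ (op (B.X₁ r s))
    x₁' := f.symm
    x₂ := ρ (op (B.X₂ r s))
    x₃ := ρ (op (B.X₃ r s))
    w := ρ (op (B.W r s))
    inv₁ := LinearMap.ext fun v => f.symm_apply_apply v
    inv₂ := LinearMap.ext fun v => f.apply_symm_apply v
    rel₁₂ := r₁₂
    rel₁₃ := r₁₃
    rel₂₃ := rel (x := B.X₂ r s) (y := B.X₃ r s) (U.q_X₂X₃ r hs hr)
    rel₁w := r₁w
    rel_w₃ := rel (x := B.W r s) (y := B.X₃ r s) (U.q_WX₃ r hs hr)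
    rel_w₂ := ?_ }, ⟨fun _ => rfl, fun _ => rfl, fun _ => rfl, fun _ => rfl⟩, fun v => LinearMap.congr_fun hXt v⟩
  have h1 : B.W r s * B.X₂ r s = B.X₂ r s * B.W r s +
      (s ^ 2 * (r ^ 2 - s ^ 2)) • (B.X₃ r s * B.X₁ r s) := Subtype.ext (U.W_mul_X₂ r s hs)
  rw [← map_mul, ← map_mul, ← map_mul, ← op_mul, ← op_mul, ← op_mul, h1, op_add, op_smul,
    map_add, map_smul]

/-- `N` is a quotient of `B`, so it has countable dimension and Schur's lemma applies. -/
theorem Ops.Represents.isSchur {T : Ops r s N} (hT : T.Represents) : T.IsSchur := by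
  intro φ h₁ h₂ h₃ h₄
  have hrank : Module.rank ℂ N ≤ Cardinal.aleph0 := by
    have := IsSimpleModule.nontrivial (B r s)ᵐᵒᵖ N
    obtain ⟨v, hv⟩ := exists_ne (0 : N)
    have h1 := LinearMap.lift_rank_le_of_surjective
      ((LinearMap.toSpanSingleton (B r s)ᵐᵒᵖ N v).restrictScalars ℂ)
      (fun x => IsSimpleModule.toSpanSingleton_surjective (B r s)ᵐᵒᵖ hv x)
    rw [← Cardinal.lift_le_aleph0]
    exact h1.trans (Cardinal.lift_le_aleph0.2 (rank_B_op_le r s))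
  have key : ∀ (x : B r s) (v : N), φ (op x • v) = op x • φ v := by
    have gen : ∀ {S : Module.End ℂ N}, QComm 1 S φ → ∀ v, φ (S v) = S (φ v) := fun hS v => by
      rw [hS.apply, one_smul]
    intro x
    induction x using B.induction with
    | halg c => intro v; rw [op_algebraMap_smul, op_algebraMap_smul, map_smul]
    | h₁ => intro v; rw [hT.1, hT.1, gen h₁]
    | h₂ => intro v; rw [hT.2.1, hT.2.1, gen h₂]
    | h₃ => intro v; rw [hT.2.2.1, hT.2.2.1, gen h₃]
    | h₄ => intro v; rw [hT.2.2.2, hT.2.2.2, gen h₄]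
    | hadd x y hx hy => intro v; rw [op_add, add_smul, add_smul, map_add, hx, hy]
    | hmul x y hx hy => intro v; rw [op_mul, mul_smul, mul_smul, hy, hx]
  obtain ⟨c, hc⟩ := exists_eq_smul_of_simple hrank φ fun b v => key (unop b) v
  exact ⟨c, LinearMap.ext hc⟩

end Modules

end B2

theorem mainTheorem3 {r s : ℂ} {m n : ℕ} (h : B2.Standing r s m n)
    (N : Type*) [AddCommGroup N] [Module (B2.B r s)ᵐᵒᵖ N] [IsSimpleModule (B2.B r s)ᵐᵒᵖ N]
    (hX₁ : B2.IsTorsionFreeAt (B2.B.X₁ r s) N)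
    (hX₃ : B2.IsTorsionFreeAt (B2.B.X₃ r s) N) :
    ((∃ lam : B2.Param₁ r s, Nonempty (N ≃ₗ[(B2.B r s)ᵐᵒᵖ] B2.M₁ h lam)) ∨
      (∃ mu : B2.Param₂, Nonempty (N ≃ₗ[(B2.B r s)ᵐᵒᵖ] B2.M₂ h mu)) ∨
      (∃ eps : B2.Param₃, Nonempty (N ≃ₗ[(B2.B r s)ᵐᵒᵖ] B2.M₃ h eps))) ∧
    (B2.IsTorsionFreeAt (B2.B.Xt r s) N → B2.IsTorsionFreeAt (B2.B.X₂ r s) N →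
      ∃ lam : B2.Param₁ r s, Nonempty (N ≃ₗ[(B2.B r s)ᵐᵒᵖ] B2.M₁ h lam)) ∧
    (B2.IsTorsionFreeAt (B2.B.Xt r s) N → B2.IsTorsionAt (B2.B.X₂ r s) N →
      ∃ mu : B2.Param₂, Nonempty (N ≃ₗ[(B2.B r s)ᵐᵒᵖ] B2.M₂ h mu)) ∧
    (B2.IsTorsionAt (B2.B.Xt r s) N →
      ∃ eps : B2.Param₃, Nonempty (N ≃ₗ[(B2.B r s)ᵐᵒᵖ] B2.M₃ h eps)) := by
  -- The complex vector space structure of `N` comes from the scalars of `B`.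
  let : Module ℂ N := Module.compHom N (algebraMap ℂ (B2.B r s)ᵐᵒᵖ)
  have : IsScalarTower ℂ (B2.B r s)ᵐᵒᵖ N := ⟨fun c b v => by
    rw [Algebra.smul_def, mul_smul]; rfl⟩
  have : SMulCommClass (B2.B r s)ᵐᵒᵖ ℂ N := ⟨fun b c v => by
    change b • algebraMap ℂ (B2.B r s)ᵐᵒᵖ c • v = algebraMap ℂ (B2.B r s)ᵐᵒᵖ c • b • v
    rw [← mul_smul, ← mul_smul, Algebra.commutes]⟩
  have : Nontrivial N := IsSimpleModule.nontrivial (B2.B r s)ᵐᵒᵖ N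
  obtain ⟨v₀, hv₀⟩ := exists_ne (0 : N)
  obtain ⟨T, hT, hXt⟩ := B2.exists_ops_represents h hX₁
  have hx₃ : ∀ v, T.x₃ v = 0 → v = 0 := fun v hv =>
    B2.eq_zero_of_isTorsionFreeAt hX₃ v (by rw [hT.2.2.1, hv])
  have case₁ : (∀ v, T.t v = 0 → v = 0) → (∀ v, T.x₂ v = 0 → v = 0) →
      ∃ lam : B2.Param₁ r s, Nonempty (N ≃ₗ[(B2.B r s)ᵐᵒᵖ] B2.M₁ h lam) := fun ht hx₂ => by
    obtain ⟨lam, hl⟩ := B2.Ops.exists_isoTo_M₁ h hT.isIrred hT.isSchur hx₃ ht hx₂ hv₀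
    exact ⟨lam, hl.nonempty_equiv hT (B2.M₁.represents h lam) B2.op_algebraMap_smul
      (B2.M₁.op_algebraMap h lam)⟩
  have case₂ : (∃ v, v ≠ 0 ∧ T.x₂ v = 0) →
      ∃ mu : B2.Param₂, Nonempty (N ≃ₗ[(B2.B r s)ᵐᵒᵖ] B2.M₂ h mu) := fun ⟨v, hv, hv₂⟩ => by
    obtain ⟨mu, hl⟩ := B2.Ops.exists_isoTo_M₂ h hT.isIrred hT.isSchur hx₃ hv hv₂
    exact ⟨mu, hl.nonempty_equiv hT (B2.M₂.represents h mu) B2.op_algebraMap_smul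
      (B2.M₂.op_algebraMap h mu)⟩
  have case₃ : (∃ v, v ≠ 0 ∧ T.t v = 0) →
      ∃ eps : B2.Param₃, Nonempty (N ≃ₗ[(B2.B r s)ᵐᵒᵖ] B2.M₃ h eps) := fun ⟨v, hv, htv⟩ => by
    obtain ⟨eps, hl⟩ := B2.Ops.exists_isoTo_M₃ h hT.isIrred hT.isSchur hx₃ hv htv
    exact ⟨eps, hl.nonempty_equiv hT (B2.M₃.represents h eps) B2.op_algebraMap_smul
      (B2.M₃.op_algebraMap h eps)⟩
  refine ⟨?_, fun ht hx₂ => ?_, fun _ hx₂ => ?_, fun ht => ?_⟩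
  · by_cases ht : ∃ v, v ≠ 0 ∧ T.t v = 0
    · exact Or.inr (Or.inr (case₃ ht))
    · by_cases hx₂ : ∃ v, v ≠ 0 ∧ T.x₂ v = 0
      · exact Or.inr (Or.inl (case₂ hx₂))
      · push Not at ht hx₂
        exact Or.inl (case₁ (fun v hv => by_contra fun h0 => ht v h0 hv)
          fun v hv => by_contra fun h0 => hx₂ v h0 hv)
  · exact case₁ (fun v hv => B2.eq_zero_of_isTorsionFreeAt ht v (by rw [hXt, hv]))
      fun v hv => B2.eq_zero_of_isTorsionFreeAt hx₂ v (by rw [hT.2.1, hv])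
  · obtain ⟨v, hv, h0⟩ := B2.exists_op_smul_eq_zero_of_isTorsionAt hx₂
    exact case₂ ⟨v, hv, by rw [← hT.2.1, h0]⟩
  · obtain ⟨v, hv, h0⟩ := B2.exists_op_smul_eq_zero_of_isTorsionAt ht
    exact case₃ ⟨v, hv, by rw [← hXt, h0]⟩
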